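/- **Theorem.** Let $\Omega\subset\mathbb{R}^3$ be a domain (a non-empty connected open set, with no further assumption on $\Omega$ or $\partial\Omega$), let $\mu>0$, $\eta\ge 0$, and let $$\mathbb{S}(\nabla u)=\mu\Big(\nabla u+\nabla^t u-\tfrac23\,\mathrm{div}\,u\,\mathbb{I}\Big)+\eta\,\mathrm{div}\,u\,\mathbb{I}.$$ Let $p\in C[0,\infty)$ satisfy $p(0)=0$, $p(s)\ge 0$ for all $s\ge 0$, and, for some constant $C$, $p(s)\le C\sqrt{s}$ for $0\le s<1$. For $1\le q<\infty$, let $D_0^{1,q}(\Omega)$ denote the completion of $C_c^\infty(\Omega)$ in the norm $\|\nabla\varphi\|_{L^q(\Omega)}$. For the potential $G$, this space is regarded as a space of functions with weak gradient in $L^q(\Omega)$, modulo constants; for the velocity, $D_0^{1,2}(\Omega;\mathbb{R}^3)$ is regarded (by the Sobolev inequality) as a space of functions: $u\in D_0^{1,2}(\Omega;\mathbb{R}^3)$ if some $\varphi_n\in C_c^\infty(\Omega;\mathbb{R}^3)$ satisfy $\varphi_n\to u$ in $L^1_{\rm loc}(\Omega)$ and $\nabla\varphi_n\to\nabla u$ in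 $L^2(\Omega)$. Assume that $G\in D_0^{1,q}(\Omega)$ for some $6/5\le q<\infty$, or $G\in W^{1,\infty}(\Omega)$. Let $(\rho,u)$ be a weak solution of $$\mathrm{div}(\rho u)=0,\qquad \mathrm{div}(\rho u\otimes u)+\nabla p(\rho)-\mathrm{div}\,\mathbb{S}(\nabla u)=\rho\nabla G\quad\text{in }\Omega,\qquad u|_{\partial\Omega}=0,$$ in the following sense: 1. $\rho:\Omega\to\mathbb{R}$ and $u:\Omega\to\mathbb{R}^3$ are measurable and $\rho\ge 0$ a.e. in $\Omega$; 2. $\rho u\in L^1_{\rm loc}(\overline\Omega;\mathbb{R}^3)$ (that is, $\rho u$ is integrable on $K\cap\Omega$ for every compact $K\subset\mathbb{R}^3$) and $\int_\Omega \rho u\cdot\nabla\phi\,dx=0$ for all $\phi\in C_c^\infty(\mathbb{R}^3)$; 3. $\rho,\ \rho|u|^2,\ p(\rho),\ \rho\nabla G\in L^1_{\rm loc}(\Omega)$, $u\in D_0^{1,2}(\Omega;\mathbb{R}^3)$, and $$\int_\Omega\big[\rho u\otimes u:\nabla\varphi+p(\rho)\,\mathrm{div}\,\varphi\big]dx=\int_\Omega\mathbb{S}(\nabla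 u):\nabla\varphi\,dx-\int_\Omega\rho\nabla G\cdot\varphi\,dx$$ for all $\varphi\in C_c^1(\Omega;\mathbb{R}^3)$. If $\rho\in L^1\cap L^\infty(\Omega)$, then $u=0$ a.e. in $\Omega$. -/

import Mathlib

open MeasureTheory Set Filter Topology
open scoped ENNReal

/-- Three-dimensional Euclidean space. -/
abbrev R3 : Type := EuclideanSpace ℝ (Fin 3)

/-- `φ ∈ C_c^k(Ω; F)`: `φ` is of class `C^k` on the whole space, with compact support
contained in `Ω`. Here `k = ⊤`, the top element of `ℕ∞`, means smooth (`C^∞`). -/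
structure IsTestFunction {F : Type*} [NormedAddCommGroup F] [NormedSpace ℝ F]
    (k : ℕ∞) (Ω : Set R3) (φ : R3 → F) : Prop where
  contDiff : ContDiff ℝ k φ
  hasCompactSupport : HasCompactSupport φ
  tsupport_subset : tsupport φ ⊆ Ω

/-- `Df` is the weak (distributional) derivative of `f` in the open set `Ω`; both are
locally integrable in `Ω`. The vector `Df x v` is the derivative of `f` in direction `v`. -/
structure HasWeakDeriv {F : Type*} [NormedAddCommGroup F] [NormedSpace ℝ F]
    (Ω : Set R3) (f : R3 → F) (Df : R3 → R3 →L[ℝ] F) : Prop where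
  locallyIntegrableOn : LocallyIntegrableOn f Ω
  locallyIntegrableOn_deriv : LocallyIntegrableOn Df Ω
  integral_eq : ∀ φ : R3 → ℝ, IsTestFunction ⊤ Ω φ → ∀ v : R3,
    ∫ x in Ω, (fderiv ℝ φ x v) • f x = - ∫ x in Ω, φ x • Df x v

/-- The class of `f` modulo constants belongs to `D_0^{1,q}(Ω; F)`, the completion of
`C_c^∞(Ω; F)` in the norm `‖∇φ‖_{L^q(Ω)}`, seen as a closed subspace of the space of functions
with weak gradient in `L^q(Ω)` modulo constants. Here `Df` is the weak derivative of `f`. -/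
structure MemD0ModConst {F : Type*} [NormedAddCommGroup F] [NormedSpace ℝ F]
    (q : ℝ≥0∞) (Ω : Set R3) (f : R3 → F) (Df : R3 → R3 →L[ℝ] F) : Prop where
  hasWeakDeriv : HasWeakDeriv Ω f Df
  memLp_deriv : MemLp Df q (volume.restrict Ω)
  exists_approx : ∃ φ : ℕ → R3 → F, (∀ n, IsTestFunction ⊤ Ω (φ n)) ∧
    Tendsto (fun n => eLpNorm (fun x => fderiv ℝ (φ n) x - Df x) q (volume.restrict Ω))
      atTop (𝓝 0)

/-- `f ∈ D_0^{1,q}(Ω; F)` as a genuine function, not only modulo constants (for `q < 3`, where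
the completion of `C_c^∞(Ω; F)` in the norm `‖∇φ‖_{L^q(Ω)}` is a space of functions by the
Sobolev inequality): test functions converge to `f` in `L^1_loc(Ω)`, and their gradients
converge in `L^q(Ω)` to the weak derivative `Df` of `f`. -/
structure MemD0 {F : Type*} [NormedAddCommGroup F] [NormedSpace ℝ F]
    (q : ℝ≥0∞) (Ω : Set R3) (f : R3 → F) (Df : R3 → R3 →L[ℝ] F) : Prop where
  hasWeakDeriv : HasWeakDeriv Ω f Df
  memLp_deriv : MemLp Df q (volume.restrict Ω)
  exists_approx : ∃ φ : ℕ → R3 → F, (∀ n, IsTestFunction ⊤ Ω (φ n)) ∧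
    Tendsto (fun n => eLpNorm (fun x => fderiv ℝ (φ n) x - Df x) q (volume.restrict Ω))
      atTop (𝓝 0) ∧
    ∀ K : Set R3, IsCompact K → K ⊆ Ω →
      Tendsto (fun n => eLpNorm (fun x => φ n x - f x) 1 (volume.restrict K)) atTop (𝓝 0)

/-- `f ∈ W^{1,∞}(Ω; F)`, with weak derivative `Df`. -/
structure MemW1Infty {F : Type*} [NormedAddCommGroup F] [NormedSpace ℝ F]
    (Ω : Set R3) (f : R3 → F) (Df : R3 → R3 →L[ℝ] F) : Prop where
  hasWeakDeriv : HasWeakDeriv Ω f Df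
  memLp : MemLp f ∞ (volume.restrict Ω)
  memLp_deriv : MemLp Df ∞ (volume.restrict Ω)

/-- The matrix of a linear map in the standard basis; for `L = ∇u(x)` its `(i, j)` entry is
`∂_j u_i(x)`. -/
noncomputable def jacobian (L : R3 →L[ℝ] R3) : Matrix (Fin 3) (Fin 3) ℝ :=
  Matrix.of fun i j => L (EuclideanSpace.single j 1) i

/-- The contraction `A : B = ∑_{i,j} A_ij B_ij`. -/
def contract (A B : Matrix (Fin 3) (Fin 3) ℝ) : ℝ := ∑ i, ∑ j, A i j * B i j

/-- Newton's viscous stress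
`𝕊(A) = μ (A + Aᵗ - (2/3) (tr A) 𝕀) + η (tr A) 𝕀`, where `tr ∇u = div u`. -/
noncomputable def viscousStress (μ η : ℝ) (A : Matrix (Fin 3) (Fin 3) ℝ) :
    Matrix (Fin 3) (Fin 3) ℝ :=
  μ • (A + A.transpose - ((2 / 3 : ℝ) * A.trace) • (1 : Matrix (Fin 3) (Fin 3) ℝ))
    + (η * A.trace) • (1 : Matrix (Fin 3) (Fin 3) ℝ)

/-- `(ρ, u)` is a weak solution in `Ω` of the steady barotropic Navier-Stokes system
`div (ρ u) = 0`, `div (ρ u ⊗ u) + ∇p(ρ) - div 𝕊(∇u) = ρ ∇G`, with the no-slip condition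
`u = 0` on `∂Ω`, where `DG` is the weak derivative of `G`. -/
structure IsWeakSolution (Ω : Set R3) (μ η : ℝ) (p : ℝ → ℝ) (DG : R3 → R3 →L[ℝ] ℝ)
    (ρ : R3 → ℝ) (u : R3 → R3) : Prop where
  aemeasurable_density : AEMeasurable ρ (volume.restrict Ω)
  aemeasurable_velocity : AEMeasurable u (volume.restrict Ω)
  density_nonneg : ∀ᵐ x ∂(volume.restrict Ω), 0 ≤ ρ x
  /-- `ρ u` is locally integrable up to the boundary of `Ω`. -/
  momentum_integrableOn : ∀ K : Set R3, IsCompact K →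
    IntegrableOn (fun x => ρ x • u x) (K ∩ Ω)
  /-- The continuity equation, tested with functions that need not vanish on `∂Ω`. -/
  continuity_eq : ∀ φ : R3 → ℝ, IsTestFunction ⊤ univ φ →
    ∫ x in Ω, ρ x * fderiv ℝ φ x (u x) = 0
  density_locallyIntegrableOn : LocallyIntegrableOn ρ Ω
  kinetic_locallyIntegrableOn : LocallyIntegrableOn (fun x => ρ x * ‖u x‖ ^ 2) Ω
  pressure_locallyIntegrableOn : LocallyIntegrableOn (fun x => p (ρ x)) Ω
  force_locallyIntegrableOn : LocallyIntegrableOn (fun x => ρ x • DG x) Ω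
  /-- `u ∈ D_0^{1,2}(Ω)` and the momentum equation. -/
  momentum_eq : ∃ Du : R3 → R3 →L[ℝ] R3, MemD0 2 Ω u Du ∧
    ∀ φ : R3 → R3, IsTestFunction 1 Ω φ →
      ∫ x in Ω, (contract (ρ x • Matrix.vecMulVec (u x) (u x)) (jacobian (fderiv ℝ φ x))
          + p (ρ x) * (jacobian (fderiv ℝ φ x)).trace)
        = (∫ x in Ω, contract (viscousStress μ η (jacobian (Du x))) (jacobian (fderiv ℝ φ x)))
          - ∫ x in Ω, ρ x * DG x (φ x)

/-!
The velocity `u` itself is used as a test function in the momentum equation: this gives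
`∫ 𝕊(∇u) : ∇u = ∫ ρ u ⊗ u : ∇u + ∫ p(ρ) div u + ∫ ρ ∇G · u`, and each term on the right vanishes.
Then Korn's identity `∫ ∇φ : ∇ᵗφ = ∫ (div φ)²` for test functions makes `μ ∫ |∇u|²` at most the
left-hand side, and the Sobolev inequality gives `u = 0`. To make this rigorous, `u` is replaced by
test functions `φₙ` whose gradients converge to `∇u` in `L²`. By the Sobolev inequality
`φₙ → u` in `L⁶` (`MemD0.exists_approx_six`), and since `ρ` lies in every `L^s`, `ρ u` lies in `L^s`
for `1 ≤ s ≤ 6` and all the integrals above pass to the limit by Hölder's inequality.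

* Convection: `∫ ρ φₙ · (u · ∇)φₙ = ½ ∫ ρ u · ∇|φₙ|² = 0` by the continuity equation
  (`IsVelocityApprox.tendsto_convective`).

* Pressure: the bound `p(s) ≤ C √s` puts `p(ρ)` in `L²`. After extension by zero, `div (ρu) = 0` holds
  on the whole space, because the continuity equation is tested with functions that need not vanish
  on `∂Ω`. With `ρ_ε` the mollified density and `F` of class `C¹`, the commutator
  `R_ε = u · ∇ρ_ε - div (ρu)_ε` satisfies `∫ F'(ρ_ε) R_ε = -∫ F(ρ_ε) div u`, and `R_ε → -ρ div u`,
  so that `∫ (F(ρ) - ρ F'(ρ)) div u = 0` (`integral_renormalized_mul_divergence_eq_zero`). The bound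
  on the commutator that is uniform in `ε` needs only `∇u ∈ L²`, so the limit `ε → 0` is computed
  for the test functions `φₙ` and transferred to `u`. The choice `F(s) = s ∫₀ˢ q` with
  `q(s) = p(s) / (s² + δ)`, followed by `δ → 0`, gives `∫ p(ρ) div u = 0`
  (`integral_pressure_mul_divergence_eq_zero`).

* Potential in `D_0^{1,q}`: for `ψ ∈ C_c^∞(Ω)` the continuity equation says `∫ ρ u · ∇ψ = 0`, and
  `ρ u` lies in the dual of `L^q` since `q ≥ 6/5`
  (`MemD0ModConst.integral_potential_eq_zero`).

* Potential in `W^{1,∞}`: here `G` need not vanish on `∂Ω`, but `u` does. The continuity equation may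
  be tested with `χ G` for the cutoffs `χ = |φₙ|² / (|φₙ|² + δ)`. As `n → ∞` the term with `∇χ`
  becomes the integral of `ρ G` against `2 δ u · (u · ∇)u / (|u|² + δ)²`, which is dominated by
  `ρ |G| |∇u|` and tends to zero pointwise as `δ → 0`, while `χ → 1` wherever `u ≠ 0`
  (`integral_bounded_potential_eq_zero`).
-/

/-! ### Mollifiers and Lebesgue points -/

/-- `e` is a smooth probability density supported in the closed ball of radius `ε`, with the
pointwise bounds on `e` and on its derivative that scaling a fixed bump function gives. Only
the constant `C` is meant to be uniform in `ε`. -/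
structure IsMollifier (C ε : ℝ) (e : R3 → ℝ) : Prop where
  contDiff : ContDiff ℝ (⊤ : ℕ∞) e
  tsupport_subset : tsupport e ⊆ Metric.closedBall 0 ε
  nonneg : ∀ w, 0 ≤ e w
  integral_eq_one : ∫ w, e w = 1
  le_div : ∀ w, e w ≤ C / volume.real (Metric.closedBall (0 : R3) ε)
  norm_fderiv_le : ∀ w, ‖fderiv ℝ e w‖ ≤ C / (ε * volume.real (Metric.closedBall (0 : R3) ε))

theorem exists_isMollifier : ∃ C : ℝ, 0 ≤ C ∧ ∀ ε : ℝ, 0 < ε → ∃ e, IsMollifier C ε e := by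
  let b : ContDiffBump (0 : R3) := ⟨1/2, 1, by norm_num, by norm_num⟩
  let η : R3 → ℝ := b.normed volume
  have hη : ContDiff ℝ (⊤ : ℕ∞) η := b.contDiff_normed
  have hηs : HasCompactSupport η := b.hasCompactSupport_normed
  obtain ⟨C₁, hC₁⟩ := hηs.exists_bound_of_continuous hη.continuous
  obtain ⟨C₂, hC₂⟩ := (hηs.fderiv ℝ).exists_bound_of_continuous
    (hη.continuous_fderiv (by simp))
  set V : ℝ → ℝ := fun ε => volume.real (Metric.closedBall (0 : R3) ε) with hV
  have hV1 : 0 < V 1 := by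
    simp only [hV]
    exact ENNReal.toReal_pos (Metric.measure_closedBall_pos _ _ one_pos).ne'
      measure_closedBall_lt_top.ne
  have hVε : ∀ ε, 0 < ε → V ε = ε ^ 3 * V 1 := by
    intro ε hε
    simp only [hV, Measure.real]
    rw [Measure.addHaar_closedBall _ _ hε.le, Measure.addHaar_closedBall _ _ (zero_le_one (α := ℝ))]
    simp [hε.le]
  have hC₁0 : 0 ≤ C₁ := (norm_nonneg _).trans (hC₁ 0)
  have hC₂0 : 0 ≤ C₂ := (norm_nonneg _).trans (hC₂ 0)
  refine ⟨max C₁ C₂ * V 1, by positivity, fun ε hε => ?_⟩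
  have hd : ∀ w : R3, HasFDerivAt (fun w : R3 => (ε ^ 3)⁻¹ * η (ε⁻¹ • w))
      ((ε ^ 3)⁻¹ • (ε⁻¹ • fderiv ℝ η (ε⁻¹ • w))) w := by
    intro w
    have h1 : HasFDerivAt (fun w : R3 => ε⁻¹ • w) (ε⁻¹ • ContinuousLinearMap.id ℝ R3) w :=
      (ContinuousLinearMap.id ℝ R3).hasFDerivAt.fun_const_smul ε⁻¹
    have h2 := ((hη.differentiable (by simp)) (ε⁻¹ • w)).hasFDerivAt.comp w h1
    have h3 := h2.const_mul (ε ^ 3)⁻¹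
    refine h3.congr_fderiv ?_
    ext v
    simp
  refine ⟨fun w => (ε ^ 3)⁻¹ * η (ε⁻¹ • w), ?_, ?_, ?_, ?_, ?_, ?_⟩
  · exact contDiff_const.mul (hη.comp (contDiff_const_smul _))
  · refine closure_minimal ?_ Metric.isClosed_closedBall
    intro w hw
    have h1 : ε⁻¹ • w ∈ Function.support η := by
      intro h
      exact hw (by simp [h])
    rw [ContDiffBump.support_normed_eq] at h1
    simp only [Metric.mem_ball, dist_zero_right, norm_smul, norm_inv, Real.norm_eq_abs,
      abs_of_pos hε] at h1
    simp only [Metric.mem_closedBall, dist_zero_right]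
    have : ε⁻¹ * ‖w‖ < 1 := h1
    rw [inv_mul_lt_iff₀ hε] at this
    linarith
  · intro w
    have := b.nonneg_normed (μ := volume) (ε⁻¹ • w)
    positivity
  · rw [integral_const_mul, Measure.integral_comp_smul volume η ε⁻¹]
    have : ∫ x, η x = 1 := b.integral_normed
    rw [this]
    have h3 : Module.finrank ℝ R3 = 3 := by simp
    rw [h3, inv_pow, inv_inv, abs_of_pos (by positivity)]
    simp
    field_simp
  · intro w
    have := (Real.norm_eq_abs _ ▸ hC₁ (ε⁻¹ • w))
    have h2 := (le_abs_self _).trans this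
    change _ ≤ _ / V ε
    rw [hVε ε hε, mul_div_mul_right _ _ hV1.ne', div_eq_inv_mul]
    gcongr
    exact h2.trans (le_max_left _ _)
  · intro w
    rw [(hd w).fderiv, norm_smul, norm_smul]
    change _ ≤ _ / (ε * V ε)
    rw [hVε ε hε, ← mul_assoc ‖(ε ^ 3)⁻¹‖, ← mul_assoc ε, mul_div_mul_right _ _ hV1.ne',
      div_eq_inv_mul, mul_inv, norm_inv, norm_inv, Real.norm_of_nonneg hε.le, Real.norm_of_nonneg (by positivity)]
    rw [mul_comm (ε ^ 3)⁻¹]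
    gcongr
    exact (hC₂ _).trans (le_max_right _ _)

namespace IsMollifier
variable {C ε : ℝ} {e : R3 → ℝ}

theorem hasCompactSupport (h : IsMollifier C ε e) : HasCompactSupport e :=
  (isCompact_closedBall _ _).of_isClosed_subset (isClosed_tsupport _) h.tsupport_subset

theorem eq_zero (h : IsMollifier C ε e) {w : R3} (hw : ε < ‖w‖) : e w = 0 := by
  by_contra hne
  have := h.tsupport_subset (subset_tsupport _ hne)
  simp at this
  linarith

theorem fderiv_eq_zero (h : IsMollifier C ε e) {w : R3} (hw : ε < ‖w‖) : fderiv ℝ e w = 0 := by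
  by_contra hne
  have := h.tsupport_subset (support_fderiv_subset ℝ hne)
  simp at this
  linarith

theorem continuous_fderiv (h : IsMollifier C ε e) : Continuous (fderiv ℝ e) :=
  h.contDiff.continuous_fderiv (by simp)

theorem differentiable (h : IsMollifier C ε e) : Differentiable ℝ e :=
  h.contDiff.differentiable (by simp)

theorem integral_sub_eq_one (h : IsMollifier C ε e) (x : R3) : ∫ y, e (y - x) = 1 := by
  rw [integral_sub_right_eq_self (fun y => e y) x, h.integral_eq_one]

theorem isTestFunction_sub (h : IsMollifier C ε e) (x : R3) :
    IsTestFunction ⊤ univ (fun y => e (y - x)) where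
  contDiff := h.contDiff.comp (contDiff_id.sub contDiff_const)
  hasCompactSupport := h.hasCompactSupport.comp_homeomorph (Homeomorph.subRight x)
  tsupport_subset := subset_univ _

theorem fderiv_sub (x y : R3) : fderiv ℝ (fun y => e (y - x)) y = fderiv ℝ e (y - x) := by
  simp_rw [sub_eq_add_neg]
  exact fderiv_comp_add_right (-x)

end IsMollifier

section
variable {E : Type*} [NormedAddCommGroup E] [NormedSpace ℝ E]

/-- The mollification `x ↦ ∫ e (y - x) h(y) dy` of `h`. -/
noncomputable def mollify (e : R3 → ℝ) (h : R3 → E) (x : R3) : E := ∫ y, e (y - x) • h y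

theorem mollify_eq_convolution (e : R3 → ℝ) (h : R3 → ℝ) :
    mollify e h = MeasureTheory.convolution h (fun w => e (-w)) (ContinuousLinearMap.mul ℝ ℝ)
      volume := by
  ext x
  simp [mollify, convolution, mul_comm]

namespace IsMollifier
variable {C ε : ℝ} {e : R3 → ℝ}

theorem hasCompactSupport_neg (he : IsMollifier C ε e) : HasCompactSupport fun w => e (-w) :=
  he.hasCompactSupport.comp_homeomorph (Homeomorph.neg R3)

theorem contDiff_neg (he : IsMollifier C ε e) : ContDiff ℝ (⊤ : ℕ∞) fun w => e (-w) :=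
  he.contDiff.comp _root_.contDiff_neg

theorem contDiff_mollify (he : IsMollifier C ε e) {h : R3 → ℝ} (hh : LocallyIntegrable h) :
    ContDiff ℝ (⊤ : ℕ∞) (mollify e h) := by
  rw [mollify_eq_convolution]
  exact he.hasCompactSupport_neg.contDiff_convolution_right _ hh he.contDiff_neg

/-- The compactly supported continuous kernels obtained from `e` are integrable against any
locally integrable function. -/
theorem _root_.integrable_kernel_smul {k : R3 → ℝ} (hk : Continuous k) (hks : HasCompactSupport k)
    {h : R3 → E} (hh : LocallyIntegrable h) (x : R3) : Integrable fun y => k (y - x) • h y := by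
  refine hh.integrable_smul_left_of_hasCompactSupport (g := fun y => k (y - x)) (by fun_prop) ?_
  exact hks.comp_homeomorph (Homeomorph.subRight x)

theorem fderiv_mollify (he : IsMollifier C ε e) {h : R3 → ℝ} (hh : LocallyIntegrable h)
    (x v : R3) : fderiv ℝ (mollify e h) x v = -∫ y, h y * fderiv ℝ e (y - x) v := by
  have h1 := he.hasCompactSupport_neg.hasFDerivAt_convolution_right
    (ContinuousLinearMap.mul ℝ ℝ) hh (he.contDiff_neg.of_le (by simp)) x
  rw [← mollify_eq_convolution] at h1
  rw [h1.fderiv]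
  have hd : ∀ w, fderiv ℝ (fun w => e (-w)) w = - fderiv ℝ e (-w) := fun w => by
    simpa using! ((he.differentiable (-w)).hasFDerivAt.comp w (hasFDerivAt_id w).neg).fderiv
  have hex : Integrable (fun t => ((ContinuousLinearMap.mul ℝ ℝ).precompR R3) (h t)
      (fderiv ℝ (fun w => e (-w)) (x - t))) :=
    (he.hasCompactSupport_neg.fderiv ℝ).convolutionExists_right _ hh
      (he.contDiff_neg.continuous_fderiv (by simp)) x
  rw [convolution, ContinuousLinearMap.integral_apply hex, ← integral_neg]
  refine integral_congr_ae (Eventually.of_forall fun t => ?_)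
  simp [hd]

end IsMollifier

theorem tendsto_mollify_ae {C : ℝ} {ε : ℕ → ℝ} (hε : ∀ j, 0 < ε j) (hε0 : Tendsto ε atTop (𝓝 0))
    {e : ℕ → R3 → ℝ} (he : ∀ j, IsMollifier C (ε j) (e j)) [CompleteSpace E] {h : R3 → E}
    (hh : LocallyIntegrable h) :
    ∀ᵐ x, Tendsto (fun j => ⨍ y in Metric.closedBall x (ε j), ‖h y - h x‖) atTop (𝓝 0) ∧
      Tendsto (fun j => mollify (e j) h x) atTop (𝓝 (h x)) := by
  filter_upwards [IsUnifLocDoublingMeasure.ae_tendsto_average_norm_sub volume hh 1] with x hx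
  have h1 := hx (fun _ : ℕ => x) ε
    (tendsto_nhdsWithin_iff.2 ⟨hε0, Eventually.of_forall hε⟩)
    (Eventually.of_forall fun j => by simp [(hε j).le])
  refine ⟨h1, ?_⟩
  refine tendsto_integral_smul_of_tendsto_average_norm_sub C h1 ?_ ?_ ?_ ?_
  · exact Eventually.of_forall fun j => hh.integrableOn_isCompact (isCompact_closedBall _ _)
  · exact tendsto_const_nhds.congr fun j => ((he j).integral_sub_eq_one x).symm
  · refine Eventually.of_forall fun j y hy => ?_
    by_contra hne
    rw [Metric.mem_closedBall, dist_eq_norm, not_le] at hne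
    exact hy ((he j).eq_zero hne)
  · refine Eventually.of_forall fun j y => ?_
    rw [abs_of_nonneg ((he j).nonneg _)]
    refine ((he j).le_div _).trans_eq ?_
    simp only [Measure.real]
    rw [Measure.addHaar_closedBall_center volume x]

end

/-! ### Divergence, integration by parts and difference quotients -/

/-- The trace of the Jacobian matrix of `L`; for `L = ∇u(x)` it is `div u(x)`. -/
noncomputable def divergence (L : R3 →L[ℝ] R3) : ℝ := (jacobian L).trace

theorem divergence_eq_sum (L : R3 →L[ℝ] R3) :
    divergence L = ∑ i, L (EuclideanSpace.single i 1) i := by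
  simp [divergence, jacobian, Matrix.trace]

theorem abs_apply_single_le (L : R3 →L[ℝ] R3) (i j : Fin 3) :
    |L (EuclideanSpace.single j 1) i| ≤ ‖L‖ := by
  rw [← Real.norm_eq_abs]
  calc ‖L (EuclideanSpace.single j 1) i‖ ≤ ‖L (EuclideanSpace.single j 1)‖ :=
        PiLp.norm_apply_le _ _
    _ ≤ ‖L‖ * ‖(EuclideanSpace.single j 1 : R3)‖ := L.le_opNorm _
    _ = ‖L‖ := by simp

theorem abs_divergence_le (L : R3 →L[ℝ] R3) : |divergence L| ≤ 3 * ‖L‖ := by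
  rw [divergence_eq_sum]
  calc |∑ i, L (EuclideanSpace.single i 1) i| ≤ ∑ i : Fin 3, ‖L‖ :=
        (Finset.abs_sum_le_sum_abs _ _).trans (Finset.sum_le_sum fun i _ =>
          abs_apply_single_le L i i)
    _ = 3 * ‖L‖ := by simp

theorem continuous_divergence : Continuous divergence := by
  have : divergence = fun L => ∑ i, L (EuclideanSpace.single i 1) i := funext divergence_eq_sum
  rw [this]
  fun_prop

theorem divergence_sub (L L' : R3 →L[ℝ] R3) :
    divergence (L - L') = divergence L - divergence L' := by
  simp [divergence_eq_sum]

theorem apply_eq_sum {F : Type*} [NormedAddCommGroup F] [NormedSpace ℝ F] (L : R3 →L[ℝ] F)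
    (v : R3) : L v = ∑ i, v i • L (EuclideanSpace.single i 1) := by
  have : v = ∑ i, v i • (EuclideanSpace.single i 1 : R3) := by
    ext j
    simp [Finset.sum_apply, Pi.single_apply]
  conv_lhs => rw [this]
  simp

theorem fderiv_apply_coord {φ : R3 → R3} (hφ : Differentiable ℝ φ) (i : Fin 3) (x v : R3) :
    fderiv ℝ (fun x => φ x i) x v = fderiv ℝ φ x v i := by
  have h := ((EuclideanSpace.proj i : R3 →L[ℝ] ℝ).hasFDerivAt.comp x (hφ x).hasFDerivAt).fderiv
  have h2 : (fun x => φ x i) = (EuclideanSpace.proj i : R3 →L[ℝ] ℝ) ∘ φ := rfl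
  rw [h2, h]
  rfl

theorem hasCompactSupport_coord {φ : R3 → R3} (hφ : HasCompactSupport φ) (i : Fin 3) :
    HasCompactSupport fun x => φ x i :=
  hφ.comp_left (g := fun v : R3 => v i) rfl

theorem contDiff_coord {n : WithTop ℕ∞} {φ : R3 → R3} (hφ : ContDiff ℝ n φ) (i : Fin 3) :
    ContDiff ℝ n fun x => φ x i :=
  (EuclideanSpace.proj i : R3 →L[ℝ] ℝ).contDiff.comp hφ

/-- Integration by parts in one variable; only the second factor has compact support. -/
theorem integral_mul_fderiv_of_hasCompactSupport {a b : R3 → ℝ} (ha : ContDiff ℝ 1 a)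
    (hb : ContDiff ℝ 1 b) (hbs : HasCompactSupport b) (v : R3) :
    ∫ x, fderiv ℝ a x v * b x = -∫ x, a x * fderiv ℝ b x v := by
  have hca := ha.continuous_fderiv one_ne_zero
  have hcb := hb.continuous_fderiv one_ne_zero
  have h := integral_mul_fderiv_eq_neg_fderiv_mul_of_integrable (μ := volume) (f := a) (g := b)
    (v := v) ?_ ?_ ?_ (fun x _ => ha.differentiable one_ne_zero x)
    (fun x _ => hb.differentiable one_ne_zero x)
  · rw [h, neg_neg]
  · exact ((hca.clm_apply continuous_const).mul hb.continuous).integrable_of_hasCompactSupport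
      hbs.mul_left
  · refine (ha.continuous.mul (hcb.clm_apply continuous_const)).integrable_of_hasCompactSupport ?_
    exact HasCompactSupport.mul_left
      ((hbs.fderiv ℝ).comp_left (g := fun L : R3 →L[ℝ] ℝ => L v) (by simp))
  · exact (ha.continuous.mul hb.continuous).integrable_of_hasCompactSupport hbs.mul_left

theorem hasCompactSupport_fderiv_apply {F : Type*} [NormedAddCommGroup F] [NormedSpace ℝ F]
    {φ : R3 → F} (hφ : HasCompactSupport φ) (v : R3) :
    HasCompactSupport fun x => fderiv ℝ φ x v :=
  (hφ.fderiv ℝ).comp_left (g := fun L : R3 →L[ℝ] F => L v) (by simp)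

theorem integral_fderiv_apply_eq_neg_integral_mul_divergence {g : R3 → ℝ} (hg : ContDiff ℝ 1 g)
    {φ : R3 → R3} (hφ : ContDiff ℝ 1 φ) (hφs : HasCompactSupport φ) :
    ∫ x, fderiv ℝ g x (φ x) = -∫ x, g x * divergence (fderiv ℝ φ x) := by
  have hcg := hg.continuous_fderiv one_ne_zero
  have hcφ := hφ.continuous_fderiv one_ne_zero
  have e1 : ∀ x, fderiv ℝ g x (φ x)
      = ∑ i, fderiv ℝ g x (EuclideanSpace.single i 1) * φ x i := fun x => by
    rw [apply_eq_sum]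
    exact Finset.sum_congr rfl fun i _ => by rw [smul_eq_mul, mul_comm]
  have e2 : ∀ x, g x * divergence (fderiv ℝ φ x)
      = ∑ i, g x * fderiv ℝ (fun x => φ x i) x (EuclideanSpace.single i 1) := fun x => by
    rw [divergence_eq_sum, Finset.mul_sum]
    exact Finset.sum_congr rfl fun i _ => by
      rw [fderiv_apply_coord (hφ.differentiable one_ne_zero)]
  simp_rw [e1, e2]
  rw [integral_finsetSum, integral_finsetSum, ← Finset.sum_neg_distrib]
  · exact Finset.sum_congr rfl fun i _ => integral_mul_fderiv_of_hasCompactSupport hg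
      (contDiff_coord hφ i) (hasCompactSupport_coord hφs i) _
  · intro i _
    have hc := (contDiff_coord hφ i).continuous_fderiv one_ne_zero
    exact (hg.continuous.mul (hc.clm_apply continuous_const)).integrable_of_hasCompactSupport
      (hasCompactSupport_fderiv_apply (hasCompactSupport_coord hφs i) _).mul_left
  · intro i _
    exact ((hcg.clm_apply continuous_const).mul
      (contDiff_coord hφ i).continuous).integrable_of_hasCompactSupport
      (hasCompactSupport_coord hφs i).mul_left

theorem lintegral_mul_le_sqrt {α : Type*} [MeasurableSpace α] {ν : Measure α} {g : α → ℝ≥0∞}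
    (hg : AEMeasurable g ν) {F : Type*} [NormedAddCommGroup F] {h : α → F}
    (hh : AEStronglyMeasurable h ν) :
    ∫⁻ x, g x * ‖h x‖ₑ ∂ν ≤ (∫⁻ x, g x ^ 2 ∂ν) ^ (1 / 2 : ℝ) * eLpNorm h 2 ν := by
  have h1 := ENNReal.lintegral_mul_le_Lp_mul_Lq ν (p := 2) (q := 2)
    (by constructor <;> norm_num) hg hh.enorm
  refine h1.trans_eq ?_
  rw [eLpNorm_eq_lintegral_rpow_enorm_toReal (by simp) (by simp)]
  simp

/-- The difference quotients of `φ` are bounded in `L²` by the gradient, in dual form. -/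
theorem lintegral_mul_enorm_sub_le {φ : R3 → R3} (hφ : ContDiff ℝ 1 φ)
    {g : R3 → ℝ≥0∞} (hg : Measurable g) (w : R3) :
    ∫⁻ x, g x * ‖φ (x + w) - φ x‖ₑ
      ≤ ‖w‖ₑ * ((∫⁻ x, g x ^ 2) ^ (1 / 2 : ℝ) * eLpNorm (fderiv ℝ φ) 2 volume) := by
  have hc := hφ.continuous_fderiv one_ne_zero
  have h1 : ∀ x, ‖φ (x + w) - φ x‖ₑ ≤ ‖w‖ₑ * ∫⁻ t in Ioc (0:ℝ) 1, ‖fderiv ℝ φ (x + t • w)‖ₑ := by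
    intro x
    have hd : ∀ t : ℝ, HasDerivAt (fun t : ℝ => φ (x + t • w)) (fderiv ℝ φ (x + t • w) w) t := by
      intro t
      have h2 : HasDerivAt (fun t : ℝ => x + t • w) w t := by
        simpa using ((hasDerivAt_id t).smul_const w).const_add x
      exact (hφ.differentiable one_ne_zero _).hasFDerivAt.comp_hasDerivAt t h2
    have h3 := intervalIntegral.integral_eq_sub_of_hasDerivAt (a := 0) (b := 1)
      (fun t _ => hd t) (Continuous.intervalIntegrable (by fun_prop) _ _)
    simp only [one_smul, zero_smul, add_zero] at h3
    rw [← h3, intervalIntegral.integral_of_le zero_le_one]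
    refine (enorm_integral_le_lintegral_enorm _).trans ?_
    rw [← lintegral_const_mul _ (by fun_prop)]
    refine lintegral_mono fun t => ?_
    rw [mul_comm]
    exact (fderiv ℝ φ (x + t • w)).le_opENorm w
  calc ∫⁻ x, g x * ‖φ (x + w) - φ x‖ₑ
      ≤ ∫⁻ x, ‖w‖ₑ * ∫⁻ t in Ioc (0:ℝ) 1, g x * ‖fderiv ℝ φ (x + t • w)‖ₑ := by
        refine lintegral_mono fun x => ?_
        rw [lintegral_const_mul _ (by fun_prop), ← mul_assoc, mul_comm ‖w‖ₑ, mul_assoc]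
        exact mul_le_mul_right (h1 x) _
    _ = ‖w‖ₑ * ∫⁻ t in Ioc (0:ℝ) 1, ∫⁻ x, g x * ‖fderiv ℝ φ (x + t • w)‖ₑ := by
        rw [lintegral_const_mul, lintegral_lintegral_swap]
        · exact Measurable.aemeasurable (by fun_prop)
        · exact Measurable.lintegral_prod_right' (f := fun p : R3 × ℝ =>
            g p.1 * ‖fderiv ℝ φ (p.1 + p.2 • w)‖ₑ) (by fun_prop)
    _ ≤ ‖w‖ₑ * ∫⁻ t in Ioc (0:ℝ) 1,
          ((∫⁻ x, g x ^ 2) ^ (1 / 2 : ℝ) * eLpNorm (fderiv ℝ φ) 2 volume) := by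
        gcongr with t
        refine (lintegral_mul_le_sqrt hg.aemeasurable
          (h := fun x => fderiv ℝ φ (x + t • w)) (by fun_prop)).trans_eq ?_
        congr 1
        exact eLpNorm_comp_measurePreserving (g := fderiv ℝ φ) (ν := volume)
          hc.aestronglyMeasurable (measurePreserving_add_right volume (t • w))
    _ = _ := by simp

namespace IsMollifier
variable {C ε : ℝ} {e : R3 → ℝ}

theorem lintegral_fderiv_mul_norm_le (he : IsMollifier C ε e) (hε : 0 < ε) :
    ∫⁻ w, ‖fderiv ℝ e w‖ₑ * ‖w‖ₑ ≤ ENNReal.ofReal C := by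
  set V := volume.real (Metric.closedBall (0 : R3) ε) with hV
  have hVpos : 0 < V := ENNReal.toReal_pos (Metric.measure_closedBall_pos _ _ hε).ne'
      measure_closedBall_lt_top.ne
  have hVe : volume (Metric.closedBall (0 : R3) ε) = ENNReal.ofReal V := by
    rw [hV, Measure.real, ENNReal.ofReal_toReal measure_closedBall_lt_top.ne]
  calc ∫⁻ w, ‖fderiv ℝ e w‖ₑ * ‖w‖ₑ
      ≤ ∫⁻ w, (Metric.closedBall (0 : R3) ε).indicator (fun _ => ENNReal.ofReal (C / V)) w := by
        refine lintegral_mono fun w => ?_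
        by_cases hw : ‖w‖ ≤ ε
        · rw [indicator_of_mem (by simpa using hw), ← ofReal_norm, ← ofReal_norm,
            ← ENNReal.ofReal_mul (norm_nonneg _)]
          refine ENNReal.ofReal_le_ofReal ?_
          calc ‖fderiv ℝ e w‖ * ‖w‖ ≤ C / (ε * V) * ε :=
                mul_le_mul (he.norm_fderiv_le w) hw (norm_nonneg _)
                  ((norm_nonneg _).trans (he.norm_fderiv_le w))
            _ = C / V := by field_simp
        · have h0 : ‖fderiv ℝ e w‖ₑ = 0 := by
            rw [← ofReal_norm, he.fderiv_eq_zero (not_le.1 hw), norm_zero, ENNReal.ofReal_zero]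
          rw [h0, zero_mul]
          exact zero_le
    _ = ENNReal.ofReal (C / V) * ENNReal.ofReal V := by
        rw [lintegral_indicator_const measurableSet_closedBall, hVe]
    _ = ENNReal.ofReal C := by
        rw [← ENNReal.ofReal_mul' hVpos.le, div_mul_cancel₀ _ hVpos.ne']

/-- The commutator estimate behind the DiPerna-Lions theory: one derivative falls on the
mollifier and is paid for by the difference quotient of `φ`, uniformly in `ε`. -/
theorem lintegral_commutator_le (he : IsMollifier C ε e) (hε : 0 < ε) {φ : R3 → R3}
    (hφ : ContDiff ℝ 1 φ) {g : R3 → ℝ≥0∞} (hg : Measurable g) :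
    ∫⁻ x, ∫⁻ y, g x * (‖fderiv ℝ e (y - x)‖ₑ * ‖φ y - φ x‖ₑ)
      ≤ ENNReal.ofReal C * ((∫⁻ x, g x ^ 2) ^ (1 / 2 : ℝ) * eLpNorm (fderiv ℝ φ) 2 volume) := by
  have hc := he.continuous_fderiv
  have hcφ := hφ.continuous
  calc ∫⁻ x, ∫⁻ y, g x * (‖fderiv ℝ e (y - x)‖ₑ * ‖φ y - φ x‖ₑ)
      = ∫⁻ x, ∫⁻ w, g x * (‖fderiv ℝ e w‖ₑ * ‖φ (x + w) - φ x‖ₑ) := by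
        refine lintegral_congr fun x => ?_
        rw [← lintegral_add_right_eq_self _ x]
        exact lintegral_congr fun w => by rw [add_sub_cancel_right, add_comm w x]
    _ = ∫⁻ w, ∫⁻ x, g x * (‖fderiv ℝ e w‖ₑ * ‖φ (x + w) - φ x‖ₑ) := by
        rw [lintegral_lintegral_swap]
        exact Measurable.aemeasurable (by fun_prop)
    _ = ∫⁻ w, ‖fderiv ℝ e w‖ₑ * ∫⁻ x, g x * ‖φ (x + w) - φ x‖ₑ := by
        refine lintegral_congr fun w => ?_
        rw [← lintegral_const_mul _ (by fun_prop)]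
        exact lintegral_congr fun x => by ring
    _ ≤ ∫⁻ w, ‖fderiv ℝ e w‖ₑ * (‖w‖ₑ *
          ((∫⁻ x, g x ^ 2) ^ (1 / 2 : ℝ) * eLpNorm (fderiv ℝ φ) 2 volume)) := by
        gcongr with w
        exact lintegral_mul_enorm_sub_le hφ hg w
    _ = (∫⁻ w, ‖fderiv ℝ e w‖ₑ * ‖w‖ₑ) *
          ((∫⁻ x, g x ^ 2) ^ (1 / 2 : ℝ) * eLpNorm (fderiv ℝ φ) 2 volume) := by
        rw [← lintegral_mul_const _ (by fun_prop)]
        exact lintegral_congr fun w => by ring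
    _ ≤ _ := by
        gcongr
        exact he.lintegral_fderiv_mul_norm_le hε

theorem lintegral_enorm_fderiv_lt_top (he : IsMollifier C ε e) :
    ∫⁻ w, ‖fderiv ℝ e w‖ₑ < ∞ :=
  (he.continuous_fderiv.integrable_of_hasCompactSupport (he.hasCompactSupport.fderiv ℝ)).2

theorem lintegral_lintegral_fderiv_eq (he : IsMollifier C ε e) {V : R3 → R3}
    (hV : AEStronglyMeasurable V volume) :
    ∫⁻ x, ∫⁻ y, ‖fderiv ℝ e (y - x)‖ₑ * ‖V y‖ₑ
      = (∫⁻ w, ‖fderiv ℝ e w‖ₑ) * ∫⁻ y, ‖V y‖ₑ := by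
  have hc := he.continuous_fderiv
  rw [lintegral_lintegral_swap, ← lintegral_const_mul'' _ hV.enorm]
  · refine lintegral_congr fun y => ?_
    rw [lintegral_mul_const _ (by fun_prop)]
    congr 1
    exact lintegral_sub_left_eq_self (fun w => ‖fderiv ℝ e w‖ₑ) y
  · have h1 : Measurable fun p : R3 × R3 => ‖fderiv ℝ e (p.2 - p.1)‖ₑ := by fun_prop
    refine h1.aemeasurable.mul ?_
    exact hV.enorm.comp_quasiMeasurePreserving Measure.quasiMeasurePreserving_snd

end IsMollifier

/-! ### Renormalization of the continuity equation -/

/-- A measurable, nonnegative, integrable function bounded by `M`, everywhere and not only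
almost everywhere. -/
structure IsBoundedDensity (M : ℝ) (r : R3 → ℝ) : Prop where
  measurable : Measurable r
  nonneg : ∀ x, 0 ≤ r x
  le : ∀ x, r x ≤ M
  integrable : Integrable r

/-- `F` is a `C¹` function with derivative `f`, and both are at most linear at the origin,
on the range `[0, M]` of the density. -/
structure IsRenormalizer (M K : ℝ) (F f : ℝ → ℝ) : Prop where
  hasDerivAt : ∀ s, HasDerivAt F (f s) s
  continuous_deriv : Continuous f
  nonneg : 0 ≤ K
  abs_deriv_le : ∀ s ∈ Icc 0 M, |f s| ≤ K * s
  abs_le : ∀ s ∈ Icc 0 M, |F s| ≤ K * s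

theorem IsRenormalizer.continuous {M K : ℝ} {F f : ℝ → ℝ} (hF : IsRenormalizer M K F f) :
    Continuous F :=
  continuous_iff_continuousAt.2 fun s => (hF.hasDerivAt s).continuousAt

theorem IsRenormalizer.contDiff {M K : ℝ} {F f : ℝ → ℝ} (hF : IsRenormalizer M K F f) :
    ContDiff ℝ 1 F := by
  rw [contDiff_one_iff_deriv]
  refine ⟨fun s => (hF.hasDerivAt s).differentiableAt, ?_⟩
  rw [show deriv F = f from funext fun s => (hF.hasDerivAt s).deriv]
  exact hF.continuous_deriv

section
variable {C ε M K : ℝ} {e r : R3 → ℝ} {F f : ℝ → ℝ}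

theorem IsMollifier.mollify_mem_Icc (he : IsMollifier C ε e) (hr : IsBoundedDensity M r)
    (x : R3) : mollify e r x ∈ Icc 0 M := by
  have h1 := integrable_kernel_smul he.contDiff.continuous he.hasCompactSupport
    hr.integrable.locallyIntegrable x
  refine ⟨integral_nonneg fun y => mul_nonneg (he.nonneg _) (hr.nonneg _), ?_⟩
  calc mollify e r x ≤ ∫ y, e (y - x) * M := by
        refine integral_mono h1 ?_ fun y => mul_le_mul_of_nonneg_left (hr.le y) (he.nonneg _)
        refine Integrable.mul_const ?_ _
        exact (he.contDiff.continuous.integrable_of_hasCompactSupport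
          he.hasCompactSupport).comp_sub_right x
    _ = M := by rw [integral_mul_const, he.integral_sub_eq_one, one_mul]

theorem IsMollifier.lintegral_enorm_mollify_le (he : IsMollifier C ε e)
    (hr : IsBoundedDensity M r) : ∫⁻ x, ‖mollify e r x‖ₑ ≤ ∫⁻ x, ‖r x‖ₑ := by
  have hc := he.contDiff.continuous.measurable
  have hm := hr.measurable
  have h1 : ∫⁻ w, ‖e w‖ₑ = 1 := by
    have hi : Integrable e := he.contDiff.continuous.integrable_of_hasCompactSupport he.hasCompactSupport
    have h2 := ofReal_integral_eq_lintegral_ofReal hi (Eventually.of_forall he.nonneg)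
    rw [he.integral_eq_one, ENNReal.ofReal_one] at h2
    rw [h2]
    exact lintegral_congr fun w => Real.enorm_of_nonneg (he.nonneg w)
  calc ∫⁻ x, ‖mollify e r x‖ₑ ≤ ∫⁻ x, ∫⁻ y, ‖e (y - x)‖ₑ * ‖r y‖ₑ := by
        refine lintegral_mono fun x => (enorm_integral_le_lintegral_enorm _).trans_eq ?_
        exact lintegral_congr fun y => enorm_smul _ _
    _ = ∫⁻ y, ∫⁻ x, ‖e (y - x)‖ₑ * ‖r y‖ₑ := by
        rw [lintegral_lintegral_swap]
        exact Measurable.aemeasurable (by fun_prop)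
    _ = ∫⁻ y, ‖r y‖ₑ := by
        refine lintegral_congr fun y => ?_
        rw [lintegral_mul_const _ (by fun_prop),
          lintegral_sub_left_eq_self (fun w => ‖e w‖ₑ) y, h1, one_mul]

theorem IsMollifier.lintegral_sq_le (he : IsMollifier C ε e) (hr : IsBoundedDensity M r)
    {G : R3 → ℝ} (hG : ∀ x, |G x| ≤ K * mollify e r x) :
    ∫⁻ x, ‖G x‖ₑ ^ 2 ≤ ENNReal.ofReal (K ^ 2 * M) * ∫⁻ x, ‖r x‖ₑ := by
  calc ∫⁻ x, ‖G x‖ₑ ^ 2 ≤ ∫⁻ x, ENNReal.ofReal (K ^ 2 * M) * ‖mollify e r x‖ₑ := by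
        refine lintegral_mono fun x => ?_
        have h1 := he.mollify_mem_Icc hr x
        rw [Real.enorm_of_nonneg h1.1, ← ofReal_norm, ← ENNReal.ofReal_pow (norm_nonneg _),
          ← ENNReal.ofReal_mul (by have := h1.1.trans h1.2; positivity)]
        refine ENNReal.ofReal_le_ofReal ?_
        rw [Real.norm_eq_abs]
        calc |G x| ^ 2 ≤ (K * mollify e r x) ^ 2 := by gcongr; exact hG x
          _ = K ^ 2 * mollify e r x * mollify e r x := by ring
          _ ≤ K ^ 2 * M * mollify e r x := by
            gcongr
            · exact h1.1
            · exact h1.2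
    _ = ENNReal.ofReal (K ^ 2 * M) * ∫⁻ x, ‖mollify e r x‖ₑ := by
        rw [lintegral_const_mul' _ _ ENNReal.ofReal_ne_top]
    _ ≤ _ := mul_le_mul_right (he.lintegral_enorm_mollify_le hr) _

theorem IsMollifier.integrable_fderiv_apply (he : IsMollifier C ε e) {W : R3 → R3}
    (hW : LocallyIntegrable W) (x : R3) : Integrable fun y => fderiv ℝ e (y - x) (W y) := by
  have h1 : ∀ y, fderiv ℝ e (y - x) (W y)
      = ∑ i, fderiv ℝ e (y - x) (EuclideanSpace.single i 1) • W y i := fun y => by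
    rw [apply_eq_sum]
    exact Finset.sum_congr rfl fun i _ => by rw [smul_eq_mul, smul_eq_mul, mul_comm]
  simp_rw [h1]
  refine integrable_finsetSum _ fun i _ => ?_
  have hc := he.continuous_fderiv
  refine integrable_kernel_smul (k := fun w => fderiv ℝ e w (EuclideanSpace.single i 1))
    (by fun_prop) (hasCompactSupport_fderiv_apply he.hasCompactSupport _) (h := fun y => W y i) ?_ x
  intro z
  obtain ⟨s, hs, hi⟩ := hW z
  exact ⟨s, hs, (EuclideanSpace.proj i : R3 →L[ℝ] ℝ).integrable_comp hi⟩

theorem IsMollifier.lintegral_kernel_le (he : IsMollifier C ε e) {W : R3 → R3}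
    (hW : AEStronglyMeasurable W volume) :
    ∫⁻ x, ‖∫ y, fderiv ℝ e (y - x) (W y)‖ₑ ≤ (∫⁻ w, ‖fderiv ℝ e w‖ₑ) * ∫⁻ y, ‖W y‖ₑ := by
  rw [← he.lintegral_lintegral_fderiv_eq hW]
  refine lintegral_mono fun x => (enorm_integral_le_lintegral_enorm _).trans ?_
  exact lintegral_mono fun y => (fderiv ℝ e (y - x)).le_opENorm _

theorem IsMollifier.integrable_kernel (he : IsMollifier C ε e) {W : R3 → R3}
    (hW : Integrable W) : Integrable fun x => ∫ y, fderiv ℝ e (y - x) (W y) := by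
  refine ⟨?_, (he.lintegral_kernel_le hW.1).trans_lt
    (ENNReal.mul_lt_top he.lintegral_enorm_fderiv_lt_top hW.2)⟩
  have hc := he.continuous_fderiv
  refine AEStronglyMeasurable.integral_prod_right' (f := fun p : R3 × R3 =>
    fderiv ℝ e (p.2 - p.1) (W p.2)) ?_
  have h1 : AEStronglyMeasurable (fun p : R3 × R3 => fderiv ℝ e (p.2 - p.1))
    (volume.prod volume) := Continuous.aestronglyMeasurable (by fun_prop)
  exact isBoundedBilinearMap_apply.continuous.comp_aestronglyMeasurable
    (h1.prodMk hW.1.comp_snd)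

/-- Writing `r_ε` for the mollified density, this is the identity
`-∫ f(r_ε) div((rφ)_ε) = ∫ f(r_ε) R + ∫ F(r_ε) div φ`, where `R = φ · ∇r_ε - div((rφ)_ε)` is the
commutator. -/
theorem IsMollifier.integral_deriv_mul_kernel_eq (he : IsMollifier C ε e)
    (hr : IsBoundedDensity M r) (hF : IsRenormalizer M K F f) {φ : R3 → R3}
    (hφ : ContDiff ℝ 1 φ) (hφs : HasCompactSupport φ) :
    ∫ x, f (mollify e r x) * ∫ y, fderiv ℝ e (y - x) (r y • φ y)
      = (∫ x, f (mollify e r x) * ∫ y, fderiv ℝ e (y - x) (r y • (φ y - φ x)))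
        + ∫ x, F (mollify e r x) * divergence (fderiv ℝ φ x) := by
  have hl := hr.integrable.locallyIntegrable
  have hsm := he.contDiff_mollify hl
  have hcm := hsm.continuous
  have hcd := hsm.continuous_fderiv (by simp)
  have hcφ := hφ.continuous
  have hcf := hF.continuous_deriv
  have hdens : ∀ v : R3, LocallyIntegrable fun y => r y • v := fun v =>
    (hr.integrable.smul_const v).locallyIntegrable
  have hrφ : Integrable fun y => r y • φ y := by
    obtain ⟨B, hB⟩ := hφs.exists_bound_of_continuous hcφ
    exact hr.integrable.smul_bdd B hcφ.aestronglyMeasurable (Eventually.of_forall hB)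
  have hsplit : ∀ x, ∫ y, fderiv ℝ e (y - x) (r y • (φ y - φ x))
      = (∫ y, fderiv ℝ e (y - x) (r y • φ y)) + fderiv ℝ (mollify e r) x (φ x) := fun x => by
    rw [he.fderiv_mollify hl, ← sub_eq_add_neg, ← integral_sub
      (he.integrable_fderiv_apply hrφ.locallyIntegrable x)]
    · refine integral_congr_ae (Eventually.of_forall fun y => ?_)
      simp [smul_sub]
    · simpa using he.integrable_fderiv_apply (hdens (φ x)) x
  have hchain : ∀ x, f (mollify e r x) * fderiv ℝ (mollify e r) x (φ x)
      = fderiv ℝ (fun x => F (mollify e r x)) x (φ x) := fun x => by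
    have h1 := (hF.hasDerivAt (mollify e r x)).comp_hasFDerivAt x
      (hsm.differentiable (by simp) x).hasFDerivAt
    have h2 := h1.fderiv
    rw [Function.comp_def] at h2
    rw [h2]
    simp
  have hbd : ∀ x, ‖f (mollify e r x)‖ ≤ K * M := fun x => by
    have h1 := he.mollify_mem_Icc hr x
    rw [Real.norm_eq_abs]
    exact (hF.abs_deriv_le _ h1).trans (mul_le_mul_of_nonneg_left h1.2 hF.nonneg)
  have hi1 : Integrable fun x => f (mollify e r x) * ∫ y, fderiv ℝ e (y - x) (r y • φ y) :=
    (he.integrable_kernel hrφ).bdd_mul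
      (hcf.comp hcm).aestronglyMeasurable (Eventually.of_forall hbd)
  have hi2 : Integrable fun x => f (mollify e r x) * fderiv ℝ (mollify e r) x (φ x) := by
    refine Continuous.integrable_of_hasCompactSupport (by fun_prop) (HasCompactSupport.mul_left ?_)
    refine hφs.mono fun x hx h => hx ?_
    simp [h]
  have hparts := integral_fderiv_apply_eq_neg_integral_mul_divergence
    (g := fun x => F (mollify e r x)) (hF.contDiff.comp (hsm.of_le (by simp))) hφ hφs
  simp_rw [hsplit, mul_add]
  rw [integral_add hi1 hi2]
  simp_rw [hchain]
  rw [hparts]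
  ring

/-- The bound on the mollified equation that is uniform in the mollification parameter. -/
theorem IsMollifier.enorm_integral_deriv_mul_kernel_le (he : IsMollifier C ε e) (hε : 0 < ε)
    (hr : IsBoundedDensity M r) (hF : IsRenormalizer M K F f) {φ : R3 → R3}
    (hφ : ContDiff ℝ 1 φ) (hφs : HasCompactSupport φ) :
    ‖∫ x, f (mollify e r x) * ∫ y, fderiv ℝ e (y - x) (r y • φ y)‖ₑ
      ≤ (ENNReal.ofReal M * ENNReal.ofReal C + 3)
        * (ENNReal.ofReal (K ^ 2 * M) * ∫⁻ x, ‖r x‖ₑ) ^ (1 / 2 : ℝ)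
        * eLpNorm (fderiv ℝ φ) 2 volume := by
  have hl := hr.integrable.locallyIntegrable
  have hcm := (he.contDiff_mollify hl).continuous
  have hmf : Measurable fun x => f (mollify e r x) :=
    (hF.continuous_deriv.comp hcm).measurable
  have hmF : Measurable fun x => F (mollify e r x) := (hF.continuous.comp hcm).measurable
  have hcd := hφ.continuous_fderiv one_ne_zero
  set N := (ENNReal.ofReal (K ^ 2 * M) * ∫⁻ x, ‖r x‖ₑ) ^ (1 / 2 : ℝ) with hN
  have h1 : (∫⁻ x, ‖f (mollify e r x)‖ₑ ^ 2) ^ (1 / 2 : ℝ) ≤ N :=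
    ENNReal.rpow_le_rpow (he.lintegral_sq_le hr
      (fun x => hF.abs_deriv_le _ (he.mollify_mem_Icc hr x))) (by norm_num)
  have h2 : (∫⁻ x, ‖F (mollify e r x)‖ₑ ^ 2) ^ (1 / 2 : ℝ) ≤ N :=
    ENNReal.rpow_le_rpow (he.lintegral_sq_le hr
      (fun x => hF.abs_le _ (he.mollify_mem_Icc hr x))) (by norm_num)
  rw [he.integral_deriv_mul_kernel_eq hr hF hφ hφs]
  refine (enorm_add_le _ _).trans ?_
  have h3 : ‖∫ x, f (mollify e r x) * ∫ y, fderiv ℝ e (y - x) (r y • (φ y - φ x))‖ₑ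
      ≤ ENNReal.ofReal M * (ENNReal.ofReal C * (N * eLpNorm (fderiv ℝ φ) 2 volume)) := by
    calc _ ≤ ∫⁻ x, ENNReal.ofReal M * ∫⁻ y, ‖f (mollify e r x)‖ₑ *
          (‖fderiv ℝ e (y - x)‖ₑ * ‖φ y - φ x‖ₑ) := by
          refine (enorm_integral_le_lintegral_enorm _).trans (lintegral_mono fun x => ?_)
          rw [enorm_mul, ← lintegral_const_mul' _ _ ENNReal.ofReal_ne_top]
          calc _ ≤ ‖f (mollify e r x)‖ₑ * ∫⁻ y, ‖fderiv ℝ e (y - x) (r y • (φ y - φ x))‖ₑ := by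
                gcongr
                exact enorm_integral_le_lintegral_enorm _
            _ = ∫⁻ y, ‖f (mollify e r x)‖ₑ * ‖fderiv ℝ e (y - x) (r y • (φ y - φ x))‖ₑ := by
                rw [lintegral_const_mul' _ _ enorm_ne_top]
            _ ≤ _ := by
                refine lintegral_mono fun y => ?_
                rw [mul_left_comm]
                gcongr
                refine ((fderiv ℝ e (y - x)).le_opENorm _).trans ?_
                rw [enorm_smul, mul_left_comm]
                gcongr
                rw [Real.enorm_of_nonneg (hr.nonneg y)]
                exact ENNReal.ofReal_le_ofReal (hr.le y)
      _ = ENNReal.ofReal M * ∫⁻ x, ∫⁻ y, ‖f (mollify e r x)‖ₑ *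
          (‖fderiv ℝ e (y - x)‖ₑ * ‖φ y - φ x‖ₑ) := by
          rw [lintegral_const_mul' _ _ ENNReal.ofReal_ne_top]
      _ ≤ _ := by
          gcongr
          refine (he.lintegral_commutator_le hε hφ
            (g := fun x => ‖f (mollify e r x)‖ₑ) hmf.enorm).trans ?_
          gcongr
  have h4 : ‖∫ x, F (mollify e r x) * divergence (fderiv ℝ φ x)‖ₑ
      ≤ 3 * (N * eLpNorm (fderiv ℝ φ) 2 volume) := by
    calc _ ≤ ∫⁻ x, 3 * (‖F (mollify e r x)‖ₑ * ‖fderiv ℝ φ x‖ₑ) := by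
          refine (enorm_integral_le_lintegral_enorm _).trans (lintegral_mono fun x => ?_)
          rw [enorm_mul, mul_left_comm]
          gcongr
          rw [← ofReal_norm, ← ofReal_norm, Real.norm_eq_abs,
            show (3 : ℝ≥0∞) = ENNReal.ofReal 3 by simp, ← ENNReal.ofReal_mul (by norm_num)]
          exact ENNReal.ofReal_le_ofReal (abs_divergence_le _)
      _ = 3 * ∫⁻ x, ‖F (mollify e r x)‖ₑ * ‖fderiv ℝ φ x‖ₑ := by
          rw [lintegral_const_mul' _ _ (by simp)]
      _ ≤ _ := by
          gcongr
          refine (lintegral_mul_le_sqrt (g := fun x => ‖F (mollify e r x)‖ₑ)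
            hmF.enorm.aemeasurable hcd.aestronglyMeasurable).trans ?_
          gcongr
  exact (add_le_add h3 h4).trans_eq (by ring)

/-- If `r U` is divergence free, the mollified equation for `φ` only sees `r (φ - U)`. -/
theorem IsMollifier.enorm_integral_deriv_mul_kernel_le_of_continuity (he : IsMollifier C ε e)
    (hr : IsBoundedDensity M r) (hF : IsRenormalizer M K F f) {U : R3 → R3}
    (hrU : Integrable fun x => r x • U x)
    (hU : ∀ ψ : R3 → ℝ, IsTestFunction ⊤ univ ψ → ∫ x, r x * fderiv ℝ ψ x (U x) = 0)
    {φ : R3 → R3} (hφ : Continuous φ) (hφs : HasCompactSupport φ) :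
    ‖∫ x, f (mollify e r x) * ∫ y, fderiv ℝ e (y - x) (r y • φ y)‖ₑ
      ≤ ENNReal.ofReal (K * M) * ((∫⁻ w, ‖fderiv ℝ e w‖ₑ) * ∫⁻ y, ‖r y • (φ y - U y)‖ₑ) := by
  have hrφ : Integrable fun y => r y • φ y := by
    obtain ⟨B, hB⟩ := hφs.exists_bound_of_continuous hφ
    exact hr.integrable.smul_bdd B hφ.aestronglyMeasurable (Eventually.of_forall hB)
  have hI : ∀ x, ∫ y, fderiv ℝ e (y - x) (r y • φ y)
      = ∫ y, fderiv ℝ e (y - x) (r y • (φ y - U y)) := fun x => by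
    have h0 : ∫ y, fderiv ℝ e (y - x) (r y • U y) = 0 := by
      have := hU _ (he.isTestFunction_sub x)
      simp_rw [IsMollifier.fderiv_sub] at this
      simpa using this
    rw [← sub_zero (∫ y, fderiv ℝ e (y - x) (r y • φ y)), ← h0, ← integral_sub
      (he.integrable_fderiv_apply hrφ.locallyIntegrable x)
      (he.integrable_fderiv_apply hrU.locallyIntegrable x)]
    simp [smul_sub]
  have hbd : ∀ x, ‖f (mollify e r x)‖ₑ ≤ ENNReal.ofReal (K * M) := fun x => by
    have h1 := he.mollify_mem_Icc hr x
    rw [← ofReal_norm, Real.norm_eq_abs]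
    exact ENNReal.ofReal_le_ofReal
      ((hF.abs_deriv_le _ h1).trans (mul_le_mul_of_nonneg_left h1.2 hF.nonneg))
  calc _ ≤ ∫⁻ x, ENNReal.ofReal (K * M) * ‖∫ y, fderiv ℝ e (y - x) (r y • (φ y - U y))‖ₑ := by
        refine (enorm_integral_le_lintegral_enorm _).trans (lintegral_mono fun x => ?_)
        rw [enorm_mul, hI]
        gcongr
        exact hbd x
    _ = ENNReal.ofReal (K * M) * ∫⁻ x, ‖∫ y, fderiv ℝ e (y - x) (r y • (φ y - U y))‖ₑ := by
        rw [lintegral_const_mul' _ _ ENNReal.ofReal_ne_top]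
    _ ≤ _ := by
        gcongr
        refine he.lintegral_kernel_le (W := fun y => r y • (φ y - U y)) ?_
        simp_rw [smul_sub]
        exact (hrφ.sub hrU).1

theorem IsMollifier.abs_kernel_le (he : IsMollifier C ε e) (hε : 0 < ε) {W : R3 → R3} {w : R3 → ℝ}
    (x : R3) (hw : IntegrableOn w (Metric.closedBall x ε))
    (hW : ∀ y ∈ Metric.closedBall x ε, ‖W y‖ ≤ ε * w y) :
    |∫ y, fderiv ℝ e (y - x) (W y)| ≤ C * ⨍ y in Metric.closedBall x ε, w y := by
  set V := volume.real (Metric.closedBall (0 : R3) ε) with hV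
  have hVx : volume.real (Metric.closedBall x ε) = V := by
    simp only [hV, Measure.real]
    rw [Measure.addHaar_closedBall_center volume x]
  have h1 : ∀ y, ‖fderiv ℝ e (y - x) (W y)‖
      ≤ (Metric.closedBall x ε).indicator (fun y => C / V * w y) y := fun y => by
    by_cases hy : y ∈ Metric.closedBall x ε
    · rw [indicator_of_mem hy]
      calc ‖fderiv ℝ e (y - x) (W y)‖ ≤ ‖fderiv ℝ e (y - x)‖ * ‖W y‖ :=
            (fderiv ℝ e (y - x)).le_opNorm _
        _ ≤ C / (ε * V) * (ε * w y) := mul_le_mul (he.norm_fderiv_le _) (hW y hy)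
            (norm_nonneg _) ((norm_nonneg _).trans (he.norm_fderiv_le 0))
        _ = C / V * w y := by
            have := hε.ne'
            field_simp
    · rw [indicator_of_notMem hy, he.fderiv_eq_zero]
      · simp
      · rwa [Metric.mem_closedBall, dist_eq_norm, not_le] at hy
  rw [← Real.norm_eq_abs]
  refine (norm_integral_le_of_norm_le ?_ (Eventually.of_forall h1)).trans_eq ?_
  · rw [integrable_indicator_iff measurableSet_closedBall]
    exact hw.const_mul _
  · rw [integral_indicator measurableSet_closedBall, integral_const_mul, setAverage_eq, hVx,
      smul_eq_mul]
    ring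

theorem IsMollifier.integral_fderiv_sub_apply (he : IsMollifier C ε e) {φ : R3 → R3}
    (hφ : ContDiff ℝ 1 φ) (hφs : HasCompactSupport φ) (x : R3) :
    ∫ y, fderiv ℝ e (y - x) (φ y - φ x)
      = -mollify e (fun y => divergence (fderiv ℝ φ y)) x := by
  have h1 : ∫ y, fderiv ℝ e (y - x) (φ y)
      = -mollify e (fun y => divergence (fderiv ℝ φ y)) x := by
    have := integral_fderiv_apply_eq_neg_integral_mul_divergence
      (g := fun y => e (y - x)) ((he.isTestFunction_sub x).contDiff.of_le (by simp)) hφ hφs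
    simp_rw [IsMollifier.fderiv_sub] at this
    exact this
  have h2 : ∫ y, fderiv ℝ e (y - x) (φ x) = 0 := by
    have := integral_mul_fderiv_of_hasCompactSupport (a := fun _ => 1) contDiff_const
      ((he.isTestFunction_sub x).contDiff.of_le (by simp)) (he.isTestFunction_sub x).2 (φ x)
    simp_rw [IsMollifier.fderiv_sub] at this
    simpa using this
  simp_rw [map_sub]
  rw [integral_sub, h1, h2, sub_zero]
  · exact he.integrable_fderiv_apply
      (hφ.continuous.integrable_of_hasCompactSupport hφs).locallyIntegrable x
  · exact he.integrable_fderiv_apply (continuous_const.locallyIntegrable (μ := volume)) x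

/-- As the mollification parameter tends to zero, the commutator `φ · ∇r_ε - div((rφ)_ε)` converges
to `-r div φ` at the common Lebesgue points of `r` and `div φ`, which gives the limit of the
mollified equation. -/
theorem tendsto_integral_deriv_mul_kernel {ε : ℕ → ℝ} (hε : ∀ j, 0 < ε j) (hε1 : ∀ j, ε j ≤ 1)
    (hε0 : Tendsto ε atTop (𝓝 0)) {e : ℕ → R3 → ℝ} (he : ∀ j, IsMollifier C (ε j) (e j))
    (hr : IsBoundedDensity M r) (hF : IsRenormalizer M K F f) {φ : R3 → R3}
    (hφ : ContDiff ℝ 1 φ) (hφs : HasCompactSupport φ) :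
    Tendsto (fun j => ∫ x, f (mollify (e j) r x) * ∫ y, fderiv ℝ (e j) (y - x) (r y • φ y)) atTop
      (𝓝 (∫ x, (F (r x) - r x * f (r x)) * divergence (fderiv ℝ φ x))) := by
  have hl := hr.integrable.locallyIntegrable
  have hcm : ∀ j, Continuous (mollify (e j) r) := fun j => ((he j).contDiff_mollify hl).continuous
  have hcd := hφ.continuous_fderiv one_ne_zero
  have hdiv : Continuous fun x => divergence (fderiv ℝ φ x) := continuous_divergence.comp hcd
  have hdivs : HasCompactSupport fun x => divergence (fderiv ℝ φ x) :=
    (hφs.fderiv ℝ).comp_left (g := divergence) (by simp [divergence_eq_sum])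
  have hM : 0 ≤ M := (hr.nonneg 0).trans (hr.le 0)
  have hrI : ∀ x, r x ∈ Icc 0 M := fun x => ⟨hr.nonneg x, hr.le x⟩
  have hbf : ∀ s ∈ Icc 0 M, |f s| ≤ K * M := fun s hs =>
    (hF.abs_deriv_le s hs).trans (mul_le_mul_of_nonneg_left hs.2 hF.nonneg)
  have hbF : ∀ s ∈ Icc 0 M, |F s| ≤ K * M := fun s hs =>
    (hF.abs_le s hs).trans (mul_le_mul_of_nonneg_left hs.2 hF.nonneg)
  have hleb := tendsto_mollify_ae hε hε0 he hl
  have hlim2 : Tendsto (fun j => ∫ x, F (mollify (e j) r x) * divergence (fderiv ℝ φ x)) atTop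
      (𝓝 (∫ x, F (r x) * divergence (fderiv ℝ φ x))) := by
    refine tendsto_integral_of_dominated_convergence
      (fun x => K * M * |divergence (fderiv ℝ φ x)|) ?_ ?_ ?_ ?_
    · exact fun j => ((hF.continuous.comp (hcm j)).mul hdiv).aestronglyMeasurable
    · exact ((hdiv.integrable_of_hasCompactSupport hdivs).abs).const_mul _
    · refine fun j => Eventually.of_forall fun x => ?_
      rw [Real.norm_eq_abs, abs_mul]
      gcongr
      exact hbF _ ((he j).mollify_mem_Icc hr x)
    · filter_upwards [hleb] with x hx
      exact ((hF.continuous.tendsto _).comp hx.2).mul_const _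
  obtain ⟨L, hL⟩ := hφ.lipschitzWith_of_hasCompactSupport hφs one_ne_zero
  obtain ⟨R, hR⟩ := hφs.isCompact.isBounded.subset_closedBall 0
  have hlim1 : Tendsto (fun j => ∫ x, f (mollify (e j) r x) *
      ∫ y, fderiv ℝ (e j) (y - x) (r y • (φ y - φ x))) atTop
      (𝓝 (∫ x, f (r x) * (-(r x * divergence (fderiv ℝ φ x))))) := by
    have hWle : ∀ j x y, y ∈ Metric.closedBall x (ε j) → ‖φ y - φ x‖ ≤ ε j * L := by
      intro j x y hy
      rw [mul_comm, ← dist_eq_norm]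
      exact (hL.dist_le_mul y x).trans (mul_le_mul_of_nonneg_left hy L.2)
    have hwint : ∀ j x, IntegrableOn (fun y => ‖r y - r x‖) (Metric.closedBall x (ε j)) :=
      fun j x => (hr.integrable.integrableOn.sub
        (integrableOn_const measure_closedBall_lt_top.ne)).norm
    refine tendsto_integral_of_dominated_convergence
      (fun x => (Metric.closedBall (0 : R3) (R + 1)).indicator
        (fun _ => K * M * (C * (M * L))) x) ?_ ?_ ?_ ?_
    · intro j
      refine (hF.continuous_deriv.comp (hcm j)).aestronglyMeasurable.mul ?_
      refine AEStronglyMeasurable.integral_prod_right' (f := fun p : R3 × R3 =>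
        fderiv ℝ (e j) (p.2 - p.1) (r p.2 • (φ p.2 - φ p.1))) ?_
      have hc := (he j).continuous_fderiv
      have h1 : AEStronglyMeasurable (fun p : R3 × R3 => fderiv ℝ (e j) (p.2 - p.1))
        (volume.prod volume) := Continuous.aestronglyMeasurable (by fun_prop)
      have h2 : AEStronglyMeasurable (fun p : R3 × R3 => φ p.2 - φ p.1)
        (volume.prod volume) := by
        have := hφ.continuous
        exact Continuous.aestronglyMeasurable (by fun_prop)
      have h3 : AEStronglyMeasurable (fun p : R3 × R3 => r p.2) (volume.prod volume) :=
        hr.measurable.aestronglyMeasurable.comp_snd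
      exact isBoundedBilinearMap_apply.continuous.comp_aestronglyMeasurable (h1.prodMk (h3.smul h2))
    · rw [integrable_indicator_iff measurableSet_closedBall]
      exact integrableOn_const measure_closedBall_lt_top.ne
    · refine fun j => Eventually.of_forall fun x => ?_
      by_cases hx : x ∈ Metric.closedBall (0 : R3) (R + 1)
      · rw [indicator_of_mem hx, Real.norm_eq_abs, abs_mul]
        refine mul_le_mul (hbf _ ((he j).mollify_mem_Icc hr x)) ?_ (abs_nonneg _)
          (mul_nonneg hF.nonneg hM)
        refine ((he j).abs_kernel_le (hε j) (w := fun _ => M * L) x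
          (integrableOn_const measure_closedBall_lt_top.ne) ?_).trans_eq ?_
        · intro y hy
          rw [norm_smul, Real.norm_of_nonneg (hr.nonneg y), mul_left_comm]
          exact mul_le_mul (hr.le y) (hWle j x y hy) (norm_nonneg _) hM
        · rw [setAverage_const (Metric.measure_closedBall_pos _ _ (hε j)).ne'
            measure_closedBall_lt_top.ne]
      · rw [indicator_of_notMem hx]
        have hx' : R + 1 < ‖x‖ := by simpa using hx
        have hz : ∀ z : R3, R < ‖z‖ → φ z = 0 := fun z hz => by
          by_contra hne
          have := hR (subset_tsupport _ hne)
          simp at this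
          linarith
        have h0 : ∀ y, fderiv ℝ (e j) (y - x) (r y • (φ y - φ x)) = 0 := fun y => by
          by_cases hy : ε j < ‖y - x‖
          · rw [(he j).fderiv_eq_zero hy]
            simp
          · have h3 : R < ‖y‖ := by
              have h4 := norm_sub_norm_le x y
              rw [norm_sub_rev] at h4
              linarith [hε1 j, not_lt.1 hy]
            rw [hz y h3, hz x (by linarith)]
            simp
        simp [h0]
    · have hlebdiv := tendsto_mollify_ae hε hε0 he (hdiv.locallyIntegrable (μ := volume))
      filter_upwards [hleb, hlebdiv] with x hx hx'
      refine ((hF.continuous_deriv.tendsto _).comp hx.2).mul ?_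
      have hsplit : ∀ j, ∫ y, fderiv ℝ (e j) (y - x) (r y • (φ y - φ x))
          = (∫ y, fderiv ℝ (e j) (y - x) ((r y - r x) • (φ y - φ x)))
            + -(r x * mollify (e j) (fun y => divergence (fderiv ℝ φ y)) x) := fun j => by
        have hd : Integrable fun y => r y • (φ y - φ x) := by
          obtain ⟨B, hB⟩ := hφs.exists_bound_of_continuous hφ.continuous
          refine hr.integrable.smul_bdd (B + B) ?_ (Eventually.of_forall fun y =>
            (norm_sub_le _ _).trans (add_le_add (hB y) (hB x)))
          exact (hφ.continuous.sub continuous_const).aestronglyMeasurable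
        have hd2 : LocallyIntegrable (fun y => r x • (φ y - φ x)) volume := by
          have hcφ := hφ.continuous
          exact Continuous.locallyIntegrable (by fun_prop)
        rw [← mul_neg, ← (he j).integral_fderiv_sub_apply hφ hφs x, ← integral_const_mul,
          ← integral_add]
        · refine integral_congr_ae (Eventually.of_forall fun y => ?_)
          simp only [sub_smul, map_sub, map_smul, smul_eq_mul]
          ring
        · simp_rw [sub_smul]
          exact (he j).integrable_fderiv_apply (W := fun y => r y • (φ y - φ x) - r x • (φ y - φ x))
            (hd.locallyIntegrable.sub hd2) x
        · simpa using (he j).integrable_fderiv_apply hd2 x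
      simp_rw [hsplit]
      have h0 : Tendsto (fun j => ∫ y, fderiv ℝ (e j) (y - x) ((r y - r x) • (φ y - φ x))) atTop
          (𝓝 0) := by
        refine squeeze_zero_norm (a := fun j => C * (L * ⨍ y in Metric.closedBall x (ε j),
          ‖r y - r x‖)) (fun j => ?_) ?_
        · rw [Real.norm_eq_abs]
          refine ((he j).abs_kernel_le (hε j) (w := fun y => L * ‖r y - r x‖) x
            ((hwint j x).const_mul _) ?_).trans_eq ?_
          · intro y hy
            rw [norm_smul, mul_left_comm, mul_comm]
            calc _ ≤ (ε j * L) * ‖r y - r x‖ := by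
                  gcongr
                  exact hWle j x y hy
              _ = _ := by ring
          · rw [setAverage_eq, setAverage_eq, integral_const_mul, smul_eq_mul, smul_eq_mul]
            ring
        · simpa using (hx.1.const_mul (L : ℝ)).const_mul C
      simpa using h0.add ((hx'.2.const_mul (r x)).neg)
  simp_rw [fun j => (he j).integral_deriv_mul_kernel_eq hr hF hφ hφs]
  have hlim := hlim1.add hlim2
  rw [← integral_add] at hlim
  · refine hlim.trans_eq (congrArg 𝓝 (integral_congr_ae (Eventually.of_forall fun x => ?_)))
    simp only
    ring
  · have h1 : Integrable fun x => (f (r x) * -r x) * divergence (fderiv ℝ φ x) := by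
      refine (hdiv.integrable_of_hasCompactSupport hdivs).bdd_mul (c := K * M * M) ?_
        (Eventually.of_forall fun x => ?_)
      · exact ((hF.continuous_deriv.measurable.comp hr.measurable).mul
          hr.measurable.neg).aestronglyMeasurable
      · rw [norm_mul, norm_neg, Real.norm_of_nonneg (hr.nonneg x)]
        exact mul_le_mul (hbf _ (hrI x)) (hr.le x) (hr.nonneg x) (mul_nonneg hF.nonneg hM)
    refine h1.congr (Eventually.of_forall fun x => ?_)
    simp only
    ring
  · refine (hdiv.integrable_of_hasCompactSupport hdivs).bdd_mul (c := K * M)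
      (hF.continuous.measurable.comp hr.measurable).aestronglyMeasurable
      (Eventually.of_forall fun x => hbF _ (hrI x))

theorem IsMollifier.integral_deriv_mul_kernel_sub (he : IsMollifier C ε e)
    (hr : IsBoundedDensity M r) (hF : IsRenormalizer M K F f) {φ φ' : R3 → R3}
    (hφ : Continuous φ) (hφs : HasCompactSupport φ)
    (hφ' : Continuous φ') (hφs' : HasCompactSupport φ') :
    ∫ x, f (mollify e r x) * ∫ y, fderiv ℝ e (y - x) (r y • (φ y - φ' y))
      = (∫ x, f (mollify e r x) * ∫ y, fderiv ℝ e (y - x) (r y • φ y))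
        - ∫ x, f (mollify e r x) * ∫ y, fderiv ℝ e (y - x) (r y • φ' y) := by
  have hint : ∀ {χ : R3 → R3}, Continuous χ → HasCompactSupport χ →
      Integrable fun y => r y • χ y := fun hχ hχs => by
    obtain ⟨B, hB⟩ := hχs.exists_bound_of_continuous hχ
    exact hr.integrable.smul_bdd B hχ.aestronglyMeasurable (Eventually.of_forall hB)
  have hint2 : ∀ {χ : R3 → R3}, Continuous χ → HasCompactSupport χ →
      Integrable fun x => f (mollify e r x) * ∫ y, fderiv ℝ e (y - x) (r y • χ y) :=
    fun hχ hχs => by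
    refine (he.integrable_kernel (hint hχ hχs)).bdd_mul (c := K * M)
      (hF.continuous_deriv.comp (he.contDiff_mollify
        hr.integrable.locallyIntegrable).continuous).aestronglyMeasurable
      (Eventually.of_forall fun x => ?_)
    have h1 := he.mollify_mem_Icc hr x
    exact (hF.abs_deriv_le _ h1).trans (mul_le_mul_of_nonneg_left h1.2 hF.nonneg)
  rw [← integral_sub (hint2 hφ hφs) (hint2 hφ' hφs')]
  refine integral_congr_ae (Eventually.of_forall fun x => ?_)
  simp only [smul_sub, map_sub]
  rw [integral_sub (he.integrable_fderiv_apply (hint hφ hφs).locallyIntegrable x)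
    (he.integrable_fderiv_apply (hint hφ' hφs').locallyIntegrable x), mul_sub]

theorem tendsto_integral_mul_divergence {ν : Measure R3} {c : R3 → ℝ} (hc : MemLp c 2 ν)
    {L : ℕ → R3 → R3 →L[ℝ] R3} {L' : R3 → R3 →L[ℝ] R3}
    (hL : ∀ n, MemLp (L n) 2 ν) (hL' : MemLp L' 2 ν)
    (h : Tendsto (fun n => eLpNorm (fun x => L n x - L' x) 2 ν) atTop (𝓝 0)) :
    Tendsto (fun n => ∫ x, c x * divergence (L n x) ∂ν) atTop
      (𝓝 (∫ x, c x * divergence (L' x) ∂ν)) := by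
  have hdiv : ∀ {A : R3 → R3 →L[ℝ] R3}, MemLp A 2 ν → Integrable (fun x => c x * divergence (A x)) ν
    := fun {A} hA => by
    refine MemLp.integrable_mul hc (q := 2) ?_
    refine MemLp.of_le_mul (c := 3) hA (continuous_divergence.comp_aestronglyMeasurable hA.1)
      (Eventually.of_forall fun x => abs_divergence_le _)
  refine tendsto_integral_of_L1 _ (hdiv hL').1 (Eventually.of_forall fun n => hdiv (hL n)) ?_
  have hb : ∀ n, ∫⁻ x, ‖c x * divergence (L n x) - c x * divergence (L' x)‖ₑ ∂ν
      ≤ 3 * ((∫⁻ x, ‖c x‖ₑ ^ 2 ∂ν) ^ (1 / 2 : ℝ) * eLpNorm (fun x => L n x - L' x) 2 ν) := fun n => by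
    calc _ ≤ ∫⁻ x, 3 * (‖c x‖ₑ * ‖L n x - L' x‖ₑ) ∂ν := by
          refine lintegral_mono fun x => ?_
          rw [← mul_sub, ← divergence_sub, enorm_mul, mul_left_comm]
          gcongr
          rw [← ofReal_norm, ← ofReal_norm, Real.norm_eq_abs,
            show (3 : ℝ≥0∞) = ENNReal.ofReal 3 by simp, ← ENNReal.ofReal_mul (by norm_num)]
          exact ENNReal.ofReal_le_ofReal (abs_divergence_le _)
      _ = 3 * ∫⁻ x, ‖c x‖ₑ * ‖L n x - L' x‖ₑ ∂ν := lintegral_const_mul' _ _ (by simp)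
      _ ≤ _ := by
          gcongr
          exact lintegral_mul_le_sqrt hc.1.enorm ((hL n).1.sub hL'.1)
  refine tendsto_of_tendsto_of_tendsto_of_le_of_le tendsto_const_nhds ?_ (fun _ => zero_le) hb
  have hfin : (∫⁻ x, ‖c x‖ₑ ^ 2 ∂ν) ^ (1 / 2 : ℝ) ≠ ∞ := by
    have := hc.2
    rw [eLpNorm_eq_lintegral_rpow_enorm_toReal (by simp) (by simp)] at this
    simpa using this.ne
  have := ENNReal.Tendsto.const_mul (a := 3) (ENNReal.Tendsto.const_mul h (Or.inr hfin))
    (Or.inr (by simp))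
  simpa using this

/-- The renormalized continuity equation, integrated over the whole space: if `div (r U) = 0`
and `U` is a limit of test functions whose gradients converge in `L²`, then
`∫ (F(r) - r F'(r)) div U = 0`. -/
theorem integral_renormalized_mul_divergence_eq_zero
    (hr : IsBoundedDensity M r) (hF : IsRenormalizer M K F f) {U : R3 → R3}
    {DU : R3 → R3 →L[ℝ] R3} (hrU : Integrable fun x => r x • U x)
    (hU : ∀ ψ : R3 → ℝ, IsTestFunction ⊤ univ ψ → ∫ x, r x * fderiv ℝ ψ x (U x) = 0)
    (hDU : MemLp DU 2 volume) {φ : ℕ → R3 → R3} (hφ : ∀ n, IsTestFunction ⊤ univ (φ n))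
    (hφU : Tendsto (fun n => ∫⁻ y, ‖r y • (φ n y - U y)‖ₑ) atTop (𝓝 0))
    (hφDU : Tendsto (fun n => eLpNorm (fun x => fderiv ℝ (φ n) x - DU x) 2 volume) atTop (𝓝 0)) :
    ∫ x, (F (r x) - r x * f (r x)) * divergence (DU x) = 0 := by
  obtain ⟨C, hC, hCe⟩ := exists_isMollifier
  let ε : ℕ → ℝ := fun j => 1 / ((j : ℝ) + 1)
  have hε : ∀ j, 0 < ε j := fun j => Nat.one_div_pos_of_nat
  have hε0 : Tendsto ε atTop (𝓝 0) := tendsto_one_div_add_atTop_nhds_zero_nat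
  have hε1 : ∀ j, ε j ≤ 1 := fun j => by
    simp only [ε]
    rw [div_le_one (by positivity)]
    linarith [Nat.cast_nonneg (α := ℝ) j]
  choose e he using fun j => hCe (ε j) (hε j)
  have hM : 0 ≤ M := (hr.nonneg 0).trans (hr.le 0)
  have hφ1 : ∀ n, ContDiff ℝ 1 (φ n) := fun n => (hφ n).1.of_le (by simp)
  have hφm : ∀ n, MemLp (fderiv ℝ (φ n)) 2 volume := fun n =>
    ((hφ1 n).continuous_fderiv one_ne_zero).memLp_of_hasCompactSupport ((hφ n).2.fderiv ℝ)
  set A : ℕ → ℕ → ℝ := fun j n =>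
    ∫ x, f (mollify (e j) r x) * ∫ y, fderiv ℝ (e j) (y - x) (r y • φ n y) with hA
  set d : ℕ → ℝ≥0∞ := fun n => eLpNorm (fun x => fderiv ℝ (φ n) x - DU x) 2 volume with hd
  set B : ℝ≥0∞ := (ENNReal.ofReal M * ENNReal.ofReal C + 3)
        * (ENNReal.ofReal (K ^ 2 * M) * ∫⁻ x, ‖r x‖ₑ) ^ (1 / 2 : ℝ) with hB
  have hBtop : B ≠ ∞ := by
    have h1 : ∫⁻ x, ‖r x‖ₑ ≠ ∞ := hr.integrable.2.ne
    refine ENNReal.mul_ne_top ?_ (ENNReal.rpow_ne_top_of_nonneg (by norm_num) ?_)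
    · exact ENNReal.add_ne_top.2
        ⟨ENNReal.mul_ne_top ENNReal.ofReal_ne_top ENNReal.ofReal_ne_top, by simp⟩
    · exact ENNReal.mul_ne_top ENNReal.ofReal_ne_top h1
  -- For fixed `j`, the quantity `A j m` tends to zero with `m`, because `r U` is divergence free.
  have hAle : ∀ j n, ‖A j n‖ₑ ≤ B * d n := by
    intro j n
    have h1 : ∀ m, ‖A j n‖ₑ ≤ B * (d n + d m) + ENNReal.ofReal (K * M) *
        ((∫⁻ w, ‖fderiv ℝ (e j) w‖ₑ) * ∫⁻ y, ‖r y • (φ m y - U y)‖ₑ) := by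
      intro m
      have h2 : A j n = (∫ x, f (mollify (e j) r x) *
          ∫ y, fderiv ℝ (e j) (y - x) (r y • (φ n y - φ m y))) + A j m := by
        rw [(he j).integral_deriv_mul_kernel_sub hr hF (hφ n).1.continuous (hφ n).2
          (hφ m).1.continuous (hφ m).2]
        simp [hA]
      rw [h2]
      refine (enorm_add_le _ _).trans (add_le_add ?_ ?_)
      · refine ((he j).enorm_integral_deriv_mul_kernel_le (hε j) hr hF
          (φ := fun y => φ n y - φ m y) ((hφ1 n).sub (hφ1 m)) ((hφ n).2.sub (hφ m).2)).trans ?_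
        refine mul_le_mul_right ?_ _
        have h3 : fderiv ℝ (fun y => φ n y - φ m y)
            = (fun x => fderiv ℝ (φ n) x - DU x) - fun x => fderiv ℝ (φ m) x - DU x := by
          ext1 x
          rw [fderiv_fun_sub ((hφ1 n).differentiable one_ne_zero x)
            ((hφ1 m).differentiable one_ne_zero x)]
          simp
        rw [h3]
        exact eLpNorm_sub_le ((hφm n).1.sub hDU.1) ((hφm m).1.sub hDU.1) (by norm_num)
      · exact (he j).enorm_integral_deriv_mul_kernel_le_of_continuity hr hF hrU hU
          (hφ m).1.continuous (hφ m).2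
    have h2 : Tendsto (fun m => B * (d n + d m) + ENNReal.ofReal (K * M) *
        ((∫⁻ w, ‖fderiv ℝ (e j) w‖ₑ) * ∫⁻ y, ‖r y • (φ m y - U y)‖ₑ)) atTop (𝓝 (B * d n)) := by
      have h3 := ENNReal.Tendsto.const_mul (a := B) (hφDU.const_add (d n)) (Or.inr hBtop)
      have h4 := ENNReal.Tendsto.const_mul (a := ENNReal.ofReal (K * M))
        (ENNReal.Tendsto.const_mul (a := ∫⁻ w, ‖fderiv ℝ (e j) w‖ₑ) hφU
          (Or.inr (he j).lintegral_enorm_fderiv_lt_top.ne)) (Or.inr ENNReal.ofReal_ne_top)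
      simpa using h3.add h4
    exact ge_of_tendsto' h2 h1
  set l : ℕ → ℝ := fun n => ∫ x, (F (r x) - r x * f (r x)) * divergence (fderiv ℝ (φ n) x) with hl
  have hlle : ∀ n, ‖l n‖ₑ ≤ B * d n := fun n =>
    le_of_tendsto' (tendsto_integral_deriv_mul_kernel hε hε1 hε0 he hr hF (hφ1 n) (hφ n).2).enorm
      fun j => hAle j n
  have hl0 : Tendsto l atTop (𝓝 0) := by
    rw [tendsto_zero_iff_enorm_tendsto_zero]
    refine tendsto_of_tendsto_of_tendsto_of_le_of_le tendsto_const_nhds ?_ (fun _ => zero_le) hlle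
    simpa using ENNReal.Tendsto.const_mul hφDU (Or.inr hBtop)
  refine tendsto_nhds_unique (tendsto_integral_mul_divergence ?_ hφm hDU hφDU) hl0
  have hr2 : MemLp r 2 volume := by
    refine (memLp_two_iff_integrable_sq hr.measurable.aestronglyMeasurable).2 ?_
    simp_rw [sq]
    refine hr.integrable.bdd_mul (c := M) hr.measurable.aestronglyMeasurable
      (Eventually.of_forall fun x => ?_)
    rw [Real.norm_of_nonneg (hr.nonneg x)]
    exact hr.le x
  refine MemLp.of_le_mul (c := K + M * K) hr2 ?_ (Eventually.of_forall fun x => ?_)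
  · exact ((hF.continuous.measurable.comp hr.measurable).sub (hr.measurable.mul
      (hF.continuous_deriv.measurable.comp hr.measurable))).aestronglyMeasurable
  · have h1 := hF.abs_le (r x) ⟨hr.nonneg x, hr.le x⟩
    have h2 := hF.abs_deriv_le (r x) ⟨hr.nonneg x, hr.le x⟩
    rw [Real.norm_of_nonneg (hr.nonneg x)]
    refine (norm_sub_le _ _).trans ?_
    rw [norm_mul, Real.norm_of_nonneg (hr.nonneg x), Real.norm_eq_abs, Real.norm_eq_abs, add_mul]
    refine add_le_add h1 ?_
    rw [mul_assoc]
    exact mul_le_mul (hr.le x) h2 (abs_nonneg _) hM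

/-- For every continuous `q` there is a renormalizer `F` with `F(s) - s F'(s) = -s² q(s)`,
namely `F(s) = s ∫₀ˢ q`. -/
theorem exists_isRenormalizer (hM : 0 ≤ M) {q : ℝ → ℝ} (hq : Continuous q) :
    ∃ (K : ℝ) (F f : ℝ → ℝ), IsRenormalizer M K F f ∧ ∀ s, F s - s * f s = -(s ^ 2 * q s) := by
  obtain ⟨Q, hQ⟩ := isCompact_Icc.exists_bound_of_continuousOn (s := Icc 0 M) hq.continuousOn
  have hQ0 : 0 ≤ Q := (norm_nonneg _).trans (hQ 0 ⟨le_rfl, hM⟩)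
  have hH : ∀ s, HasDerivAt (fun s => ∫ t in (0 : ℝ)..s, q t) (q s) s := fun s =>
    intervalIntegral.integral_hasDerivAt_right (hq.intervalIntegrable _ _)
      hq.stronglyMeasurable.stronglyMeasurableAtFilter hq.continuousAt
  have hHc : Continuous fun s => ∫ t in (0 : ℝ)..s, q t :=
    continuous_iff_continuousAt.2 fun s => (hH s).continuousAt
  have hHle : ∀ s ∈ Icc 0 M, |∫ t in (0 : ℝ)..s, q t| ≤ Q * s := by
    intro s hs
    have h1 := intervalIntegral.norm_integral_le_of_norm_le_const (a := 0) (b := s) (f := q)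
      (C := Q) (fun t ht => by
        rw [uIoc_of_le hs.1] at ht
        exact hQ t ⟨ht.1.le, ht.2.trans hs.2⟩)
    rwa [sub_zero, abs_of_nonneg hs.1] at h1
  refine ⟨Q * (2 + M), fun s => s * ∫ t in (0 : ℝ)..s, q t,
    fun s => (∫ t in (0 : ℝ)..s, q t) + s * q s, ⟨fun s => ?_, ?_, by positivity, ?_, ?_⟩, ?_⟩
  · simpa using! (hasDerivAt_id s).fun_mul (hH s)
  · fun_prop
  · intro s hs
    have h1 := hHle s hs
    have h2 := hQ s hs
    rw [Real.norm_eq_abs] at h2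
    have h3 : |s * q s| ≤ Q * s := by
      rw [abs_mul, abs_of_nonneg hs.1, mul_comm]
      exact mul_le_mul_of_nonneg_right h2 hs.1
    have h4 : 0 ≤ Q * M * s := mul_nonneg (mul_nonneg hQ0 hM) hs.1
    have := abs_add_le (∫ t in (0 : ℝ)..s, q t) (s * q s)
    nlinarith
  · intro s hs
    have h1 := hHle s hs
    rw [abs_mul, abs_of_nonneg hs.1]
    calc s * |∫ t in (0 : ℝ)..s, q t| ≤ M * (Q * s) :=
          mul_le_mul hs.2 h1 (abs_nonneg _) hM
      _ ≤ Q * (2 + M) * s := by nlinarith [mul_nonneg hQ0 hs.1]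
  · intro s
    ring

/-- The pressure does no work on `U` when `div (r U) = 0`. -/
theorem integral_pressure_mul_divergence_eq_zero
    (hr : IsBoundedDensity M r) {U : R3 → R3}
    {DU : R3 → R3 →L[ℝ] R3} (hrU : Integrable fun x => r x • U x)
    (hU : ∀ ψ : R3 → ℝ, IsTestFunction ⊤ univ ψ → ∫ x, r x * fderiv ℝ ψ x (U x) = 0)
    (hDU : MemLp DU 2 volume) {φ : ℕ → R3 → R3} (hφ : ∀ n, IsTestFunction ⊤ univ (φ n))
    (hφU : Tendsto (fun n => ∫⁻ y, ‖r y • (φ n y - U y)‖ₑ) atTop (𝓝 0))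
    (hφDU : Tendsto (fun n => eLpNorm (fun x => fderiv ℝ (φ n) x - DU x) 2 volume) atTop (𝓝 0))
    {p : ℝ → ℝ} (hp : ContinuousOn p (Ici 0)) (hp0 : p 0 = 0)
    (hp2 : MemLp (fun x => p (r x)) 2 volume) :
    ∫ x, p (r x) * divergence (DU x) = 0 := by
  have hM : 0 ≤ M := (hr.nonneg 0).trans (hr.le 0)
  let δ : ℕ → ℝ := fun j => 1 / ((j : ℝ) + 1)
  have hδ : ∀ j, 0 < δ j := fun j => Nat.one_div_pos_of_nat
  have hδ0 : Tendsto δ atTop (𝓝 0) := tendsto_one_div_add_atTop_nhds_zero_nat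
  have hpc : Continuous fun t : ℝ => p (max t 0) :=
    hp.comp_continuous (by fun_prop) fun t => mem_Ici.2 (le_max_right _ _)
  have hDUm : MemLp (fun x => divergence (DU x)) 2 volume :=
    MemLp.of_le_mul (c := 3) hDU (continuous_divergence.comp_aestronglyMeasurable hDU.1)
      (Eventually.of_forall fun x => abs_divergence_le _)
  have hzero : ∀ j, ∫ x, (r x ^ 2 / (r x ^ 2 + δ j)) * (p (r x) * divergence (DU x)) = 0 := by
    intro j
    have hden : ∀ t : ℝ, t ^ 2 + δ j ≠ 0 := fun t => by
      have := hδ j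
      positivity
    obtain ⟨K, F, f, hF, hFf⟩ := exists_isRenormalizer hM
      (q := fun t => p (max t 0) / (t ^ 2 + δ j)) (hpc.div (by fun_prop) hden)
    have h1 := integral_renormalized_mul_divergence_eq_zero hr hF hrU hU hDU hφ hφU hφDU
    simp_rw [hFf, neg_mul, integral_neg, neg_eq_zero] at h1
    rw [← h1]
    refine integral_congr_ae (Eventually.of_forall fun x => ?_)
    simp only [max_eq_left (hr.nonneg x)]
    ring
  have hmeas : AEStronglyMeasurable (fun x => p (r x) * divergence (DU x)) volume :=
    hp2.1.mul hDUm.1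
  have hlim : Tendsto (fun j => ∫ x, (r x ^ 2 / (r x ^ 2 + δ j)) * (p (r x) * divergence (DU x)))
      atTop (𝓝 (∫ x, p (r x) * divergence (DU x))) := by
    refine tendsto_integral_of_dominated_convergence
      (fun x => |p (r x) * divergence (DU x)|) ?_ ?_ ?_ ?_
    · intro j
      refine AEStronglyMeasurable.mul ?_ hmeas
      exact ((hr.measurable.pow_const 2).div
        ((hr.measurable.pow_const 2).add_const _)).aestronglyMeasurable
    · exact (MemLp.integrable_mul hp2 hDUm).abs
    · refine fun j => Eventually.of_forall fun x => ?_
      rw [Real.norm_eq_abs, abs_mul]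
      have h1 : |r x ^ 2 / (r x ^ 2 + δ j)| ≤ 1 := by
        have := hδ j
        rw [abs_of_nonneg (by positivity), div_le_one (by positivity)]
        linarith
      exact mul_le_of_le_one_left (abs_nonneg _) h1
    · refine Eventually.of_forall fun x => ?_
      rcases (hr.nonneg x).eq_or_lt with h | h
      · simp [← h, hp0]
      · have h1 : Tendsto (fun j => r x ^ 2 / (r x ^ 2 + δ j)) atTop
            (𝓝 (r x ^ 2 / (r x ^ 2 + 0))) :=
          tendsto_const_nhds.div (tendsto_const_nhds.add hδ0) (by positivity)
        rw [add_zero, div_self (by positivity)] at h1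
        simpa using h1.mul_const (p (r x) * divergence (DU x))
  simp_rw [hzero] at hlim
  exact tendsto_nhds_unique hlim tendsto_const_nhds

end

/-! ### Lebesgue exponents and Hölder's inequality -/

section Holder
variable {α : Type*} [MeasurableSpace α] {ν : Measure α} {A E : Type*} [NormedAddCommGroup A]
  [NormedAddCommGroup E]

theorem holderTriple_of_toReal {p q r : ℝ≥0∞} (hp : p ≠ 0) (hq : q ≠ 0) (hr : r ≠ 0)
    (h : p.toReal⁻¹ + q.toReal⁻¹ = r.toReal⁻¹) : ENNReal.HolderTriple p q r := by
  refine ⟨?_⟩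
  rw [← ENNReal.toReal_eq_toReal_iff' (by simp [hp, hq]) (by simp [hr]),
    ENNReal.toReal_add (by simpa) (by simpa)]
  simpa using h

theorem memLp_of_one_of_top {a : α → A} (h1 : MemLp a 1 ν) (ht : MemLp a ∞ ν) {s : ℝ≥0∞}
    (hs : 1 ≤ s) : MemLp a s ν := by
  rcases eq_or_ne s ∞ with rfl | hst
  · exact ht
  have hs0 : s ≠ 0 := (zero_lt_one.trans_le hs).ne'
  have hs1 : 1 ≤ s.toReal := by
    rw [← ENNReal.toReal_one]
    exact ENNReal.toReal_mono hst hs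
  rw [← integrable_norm_rpow_iff h1.1 hs0 hst]
  obtain ⟨B, hB⟩ : ∃ B : ℝ, ∀ᵐ x ∂ν, ‖a x‖ ≤ B := by
    have h2 := ht.2
    rw [eLpNorm_exponent_top] at h2
    exact ⟨_, ae_le_eLpNormEssSup.mono fun x hx => by
      have := ENNReal.toReal_mono h2.ne hx
      simpa using this⟩
  have h3 : ∀ x, ‖a x‖ ^ s.toReal = ‖a x‖ ^ (s.toReal - 1) * ‖a x‖ := fun x => by
    conv_rhs => rw [← Real.rpow_one ‖a x‖, ← Real.rpow_mul (norm_nonneg _)]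
    rw [one_mul, ← Real.rpow_add_of_nonneg (norm_nonneg _) (by linarith) zero_le_one]
    simp
  simp_rw [h3]
  refine (memLp_one_iff_integrable.1 h1).norm.bdd_mul (c := B ^ (s.toReal - 1)) ?_ ?_
  · exact ((Real.continuous_rpow_const (by linarith)).comp_aestronglyMeasurable h1.1.norm)
  · filter_upwards [hB] with x hx
    rw [Real.norm_of_nonneg (by positivity)]
    exact Real.rpow_le_rpow (norm_nonneg _) hx (by linarith)

/-- If the difference `X n - X'` is dominated by a product of a sequence bounded in `L^p` and a
sequence tending to zero in the conjugate `L^q`, then the integrals converge. -/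
theorem tendsto_integral_of_norm_sub_le_mul {p q : ℝ≥0∞} [hpq : ENNReal.HolderTriple p q 1]
    {a : ℕ → α → ℝ} {N : ℝ≥0∞} (hN : N ≠ ∞) (ham : ∀ n, AEStronglyMeasurable (a n) ν)
    (haN : ∀ᶠ n in atTop, eLpNorm (a n) p ν ≤ N) {β : ℕ → α → E}
    (hβm : ∀ n, AEStronglyMeasurable (β n) ν)
    (hβ : Tendsto (fun n => eLpNorm (β n) q ν) atTop (𝓝 0))
    {X : ℕ → α → ℝ} {X' : α → ℝ} (hX : ∀ n, Integrable (X n) ν) (hX' : AEStronglyMeasurable X' ν)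
    (C : ℝ) (hle : ∀ n, ∀ᵐ x ∂ν, |X n x - X' x| ≤ C * (|a n x| * ‖β n x‖)) :
    Tendsto (fun n => ∫ x, X n x ∂ν) atTop (𝓝 (∫ x, X' x ∂ν)) := by
  refine tendsto_integral_of_L1' _ hX' (Eventually.of_forall hX) ?_
  have h1 : ∀ᶠ n in atTop, eLpNorm (X n - X') 1 ν ≤ ENNReal.ofReal C * (N * eLpNorm (β n) q ν) := by
    filter_upwards [haN] with n hn
    have h2 : eLpNorm (X n - X') 1 ν
        ≤ ENNReal.ofReal C * eLpNorm (a n • fun x => ‖β n x‖) 1 ν := by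
      refine eLpNorm_le_mul_eLpNorm_of_ae_le_mul ?_ 1
      filter_upwards [hle n] with x hx
      simpa [abs_mul] using hx
    refine h2.trans (mul_le_mul_right ?_ _)
    refine (eLpNorm_smul_le_mul_eLpNorm (hβm n).norm (ham n) (p := p) (q := q)).trans ?_
    rw [eLpNorm_norm]
    gcongr
  refine tendsto_of_tendsto_of_tendsto_of_le_of_le' tendsto_const_nhds ?_
    (Eventually.of_forall fun _ => zero_le) h1
  have := ENNReal.Tendsto.const_mul (a := ENNReal.ofReal C) (ENNReal.Tendsto.const_mul hβ
    (Or.inr hN)) (Or.inr ENNReal.ofReal_ne_top)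
  simpa using this

theorem tendsto_integral_of_norm_sub_le_mul_const {p q : ℝ≥0∞} [hpq : ENNReal.HolderTriple p q 1]
    {a : α → ℝ} (ha : MemLp a p ν) {β : ℕ → α → E}
    (hβm : ∀ n, AEStronglyMeasurable (β n) ν)
    (hβ : Tendsto (fun n => eLpNorm (β n) q ν) atTop (𝓝 0))
    {X : ℕ → α → ℝ} {X' : α → ℝ} (hX : ∀ n, Integrable (X n) ν) (hX' : AEStronglyMeasurable X' ν)
    (C : ℝ) (hle : ∀ n, ∀ᵐ x ∂ν, |X n x - X' x| ≤ C * (|a x| * ‖β n x‖)) :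
    Tendsto (fun n => ∫ x, X n x ∂ν) atTop (𝓝 (∫ x, X' x ∂ν)) :=
  tendsto_integral_of_norm_sub_le_mul (a := fun _ => a) ha.2.ne (fun _ => ha.1)
    (Eventually.of_forall fun _ => le_rfl) hβm hβ hX hX' C hle

theorem eventually_eLpNorm_le_add_one {q : ℝ≥0∞} (hq : 1 ≤ q) {β : ℕ → α → E} {β' : α → E}
    (hβm : ∀ n, AEStronglyMeasurable (β n) ν) (hβ' : AEStronglyMeasurable β' ν)
    (hβ : Tendsto (fun n => eLpNorm (fun x => β n x - β' x) q ν) atTop (𝓝 0)) :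
    ∀ᶠ n in atTop, eLpNorm (β n) q ν ≤ eLpNorm β' q ν + 1 := by
  filter_upwards [hβ.eventually_le_const (u := 1) one_pos] with n hn
  calc eLpNorm (β n) q ν = eLpNorm (β' + fun x => β n x - β' x) q ν := by
        congr 1
        ext x
        simp
    _ ≤ eLpNorm β' q ν + eLpNorm (fun x => β n x - β' x) q ν :=
        eLpNorm_add_le hβ' ((hβm n).sub hβ') hq
    _ ≤ _ := by gcongr

/-- `ρ` lies in every Lebesgue space and `v` in `L^q`, hence `ρ v` lies in `L^t` for every
`t ≤ q`. -/
theorem memLp_mul_norm_of_le {ρ : α → ℝ} (h1 : MemLp ρ 1 ν) (ht : MemLp ρ ∞ ν) {v : α → E}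
    {q t : ℝ≥0∞} (hv : MemLp v q ν) (h1t : 1 ≤ t) (htq : t ≤ q) :
    MemLp (fun x => ρ x * ‖v x‖) t ν := by
  have hle : q⁻¹ ≤ t⁻¹ := ENNReal.inv_le_inv.2 htq
  have hT : ENNReal.HolderTriple (t⁻¹ - q⁻¹)⁻¹ q t := ⟨by
    rw [inv_inv, tsub_add_cancel_of_le hle]⟩
  have h1s : 1 ≤ (t⁻¹ - q⁻¹)⁻¹ := by
    rw [ENNReal.one_le_inv]
    exact tsub_le_self.trans (ENNReal.inv_le_one.2 h1t)
  exact hv.norm.smul (memLp_of_one_of_top h1 ht h1s)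

end Holder

/-! ### The velocity as an `L⁶` function -/

theorem exists_sobolev_const : ∃ S : ℝ≥0∞, S ≠ ∞ ∧ ∀ φ : R3 → R3, ContDiff ℝ 1 φ →
    HasCompactSupport φ → eLpNorm φ 6 volume ≤ S * eLpNorm (fderiv ℝ φ) 2 volume := by
  refine ⟨SNormLESNormFDerivOfEqConst R3 (volume : Measure R3) 2, ENNReal.coe_ne_top, fun φ hφ hφs => ?_⟩
  exact eLpNorm_le_eLpNorm_fderiv_of_eq volume hφ hφs (p := 2) (p' := 6) (by norm_num)
    (by simp) (by simp; norm_num)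

namespace IsTestFunction
variable {F : Type*} [NormedAddCommGroup F] [NormedSpace ℝ F] {k : ℕ∞} {Ω : Set R3} {φ : R3 → F}

theorem memLp (hφ : IsTestFunction k Ω φ) (q : ℝ≥0∞) (ν : Measure R3)
    [IsFiniteMeasureOnCompacts ν] : MemLp φ q ν :=
  hφ.contDiff.continuous.memLp_of_hasCompactSupport hφ.hasCompactSupport

theorem continuous_fderiv (hφ : IsTestFunction ⊤ Ω φ) : Continuous (fderiv ℝ φ) :=
  hφ.contDiff.continuous_fderiv (by simp)

theorem memLp_fderiv (hφ : IsTestFunction ⊤ Ω φ) (q : ℝ≥0∞) (ν : Measure R3)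
    [IsFiniteMeasureOnCompacts ν] : MemLp (fderiv ℝ φ) q ν :=
  hφ.continuous_fderiv.memLp_of_hasCompactSupport (hφ.hasCompactSupport.fderiv ℝ)

theorem fderiv_eq_zero_of_notMem (hφ : IsTestFunction k Ω φ) {x : R3} (hx : x ∉ Ω) :
    fderiv ℝ φ x = 0 := by
  by_contra h
  exact hx (hφ.tsupport_subset (support_fderiv_subset ℝ h))

theorem mono (hφ : IsTestFunction ⊤ Ω φ) : IsTestFunction ⊤ univ φ :=
  ⟨hφ.1, hφ.2, subset_univ _⟩

theorem sub {ψ : R3 → F} (hφ : IsTestFunction k Ω φ) (hψ : IsTestFunction k Ω ψ) :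
    IsTestFunction k Ω (φ - ψ) := by
  refine ⟨hφ.1.sub hψ.1, hφ.2.sub hψ.2, ?_⟩
  exact (tsupport_sub φ ψ).trans (union_subset hφ.3 hψ.3)

theorem eLpNorm_le (hφ : IsTestFunction ⊤ Ω φ) {S : ℝ≥0∞} {p q : ℝ≥0∞}
    (h : eLpNorm φ p volume ≤ S * eLpNorm (fderiv ℝ φ) q volume) :
    eLpNorm φ p (volume.restrict Ω) ≤ S * eLpNorm (fderiv ℝ φ) q (volume.restrict Ω) := by
  refine (eLpNorm_mono_measure _ Measure.restrict_le_self).trans (h.trans_eq ?_)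
  rw [eLpNorm_restrict_eq_of_support_subset (f := fderiv ℝ φ) (s := Ω)]
  exact (support_fderiv_subset ℝ).trans hφ.tsupport_subset

end IsTestFunction

/-- By the Sobolev inequality, `D_0^{1,2}` embeds in `L⁶`, and the approximation takes place in
`L⁶` as well. -/
theorem MemD0.exists_approx_six {Ω : Set R3} (hΩ : IsOpen Ω) {u : R3 → R3}
    {Du : R3 → R3 →L[ℝ] R3} (h : MemD0 2 Ω u Du) :
    MemLp u 6 (volume.restrict Ω) ∧ ∃ φ : ℕ → R3 → R3, (∀ n, IsTestFunction ⊤ Ω (φ n)) ∧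
      Tendsto (fun n => eLpNorm (fun x => fderiv ℝ (φ n) x - Du x) 2 (volume.restrict Ω))
        atTop (𝓝 0) ∧
      Tendsto (fun n => eLpNorm (fun x => φ n x - u x) 6 (volume.restrict Ω)) atTop (𝓝 0) := by
  obtain ⟨φ, hφ, hD, hK⟩ := h.exists_approx
  obtain ⟨S, hS, hSob⟩ := exists_sobolev_const
  set ν := volume.restrict Ω with hν
  have hφ6 : ∀ n, MemLp (φ n) 6 ν := fun n => (hφ n).memLp 6 ν
  have hDm : AEStronglyMeasurable Du ν := h.memLp_deriv.1
  set d : ℕ → ℝ≥0∞ := fun n => eLpNorm (fun x => fderiv ℝ (φ n) x - Du x) 2 ν with hd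
  have hle : ∀ n m, eLpNorm (φ n - φ m) 6 ν ≤ S * d n + S * d m := by
    intro n m
    have ht := (hφ n).sub (hφ m)
    refine (ht.eLpNorm_le (hSob _ (ht.1.of_le (by simp)) ht.2)).trans ?_
    rw [← mul_add]
    refine mul_le_mul_right ?_ _
    have h3 : fderiv ℝ (φ n - φ m)
        = (fun x => fderiv ℝ (φ n) x - Du x) - fun x => fderiv ℝ (φ m) x - Du x := by
      ext1 x
      rw [fderiv_sub ((hφ n).1.differentiable (by simp) x)
        ((hφ m).1.differentiable (by simp) x)]
      simp
    rw [h3]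
    exact eLpNorm_sub_le (((hφ n).memLp_fderiv 2 ν).1.sub hDm)
      (((hφ m).memLp_fderiv 2 ν).1.sub hDm) (by norm_num)
  have hSd : Tendsto (fun n => S * d n) atTop (𝓝 0) := by
    simpa using ENNReal.Tendsto.const_mul hD (Or.inr hS)
  have : Fact ((1 : ℝ≥0∞) ≤ 6) := ⟨by norm_num⟩
  have hcau : CauchySeq fun n => (hφ6 n).toLp (φ n) := by
    rw [EMetric.cauchySeq_iff]
    intro δ hδ
    have h2 : 0 < δ / 2 := ENNReal.half_pos hδ.ne'
    obtain ⟨N, hN⟩ := eventually_atTop.1 (hSd.eventually_lt_const h2)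
    refine ⟨N, fun m hm n hn => ?_⟩
    rw [Lp.edist_toLp_toLp]
    refine (hle m n).trans_lt ?_
    calc S * d m + S * d n < δ / 2 + δ / 2 := ENNReal.add_lt_add (hN m hm) (hN n hn)
      _ = δ := ENNReal.add_halves δ
  obtain ⟨v', hv⟩ := cauchySeq_tendsto_of_complete hcau
  let v : R3 → R3 := fun x => v' x
  have hv6 : Tendsto (fun n => eLpNorm (φ n - v) 6 ν) atTop (𝓝 0) := by
    rw [tendsto_iff_edist_tendsto_0] at hv
    refine hv.congr fun n => ?_
    rw [Lp.edist_def]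
    exact eLpNorm_congr_ae ((hφ6 n).coeFn_toLp.sub (EventuallyEq.refl _ _))
  have hum : AEStronglyMeasurable u ν := h.hasWeakDeriv.locallyIntegrableOn.aestronglyMeasurable
  have hvm : AEStronglyMeasurable v ν := (Lp.memLp v').1
  -- The `L⁶` limit and the `L¹_loc` limit agree on every compact ball inside `Ω`.
  have huv : u =ᵐ[ν] v := by
    have hball : ∀ K : Set R3, IsCompact K → K ⊆ Ω → u =ᵐ[volume.restrict K] v := by
      intro K hKc hKΩ
      have hle : volume.restrict K ≤ ν := Measure.restrict_mono hKΩ le_rfl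
      have hφm : ∀ n, AEStronglyMeasurable (φ n) (volume.restrict K) := fun n =>
        (hφ n).1.continuous.aestronglyMeasurable
      have h1 := tendstoInMeasure_of_tendsto_eLpNorm (p := 1) one_ne_zero hφm
        (hum.mono_measure hle) (hK K hKc hKΩ)
      have h2 := tendstoInMeasure_of_tendsto_eLpNorm (p := 6) (by simp) hφm
        (hvm.mono_measure hle) (tendsto_of_tendsto_of_tendsto_of_le_of_le tendsto_const_nhds hv6
          (fun _ => zero_le) fun n => eLpNorm_mono_measure _ hle)
      exact tendstoInMeasure_ae_unique h1 h2
    rw [hν, Filter.EventuallyEq, ae_restrict_iff' hΩ.measurableSet, ae_iff]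
    refine measure_null_of_locally_null _ fun x hx => ?_
    simp only [mem_ofPred_eq, Classical.not_imp] at hx
    obtain ⟨δ, hδ, hδΩ⟩ := Metric.nhds_basis_closedBall.mem_iff.1 (hΩ.mem_nhds hx.1)
    have h1 := hball _ (isCompact_closedBall x δ) hδΩ
    rw [Filter.EventuallyEq, ae_restrict_iff' measurableSet_closedBall, ae_iff] at h1
    refine ⟨_, inter_mem_nhdsWithin _ (Metric.closedBall_mem_nhds x hδ), measure_mono_null ?_ h1⟩
    rintro y ⟨hy, hyb⟩
    simp only [mem_ofPred_eq, Classical.not_imp] at hy ⊢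
    exact ⟨hyb, hy.2⟩
  refine ⟨(memLp_congr_ae huv).2 (Lp.memLp v'), φ, hφ, hD, hv6.congr fun n => ?_⟩
  exact eLpNorm_congr_ae ((EventuallyEq.refl _ _).sub huv.symm)

/-! ### Potentials that need not vanish on the boundary -/

theorem exists_ae_norm_le_of_memLp_top {α E : Type*} [MeasurableSpace α] {ν : Measure α}
    [NormedAddCommGroup E] {f : α → E} (hf : MemLp f ∞ ν) : ∃ B : ℝ, 0 ≤ B ∧ ∀ᵐ x ∂ν, ‖f x‖ ≤ B := by
  have h2 := hf.2
  rw [eLpNorm_exponent_top] at h2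
  exact ⟨_, ENNReal.toReal_nonneg, ae_le_eLpNormEssSup.mono fun x hx => by
    have := ENNReal.toReal_mono h2.ne hx
    simpa using this⟩

theorem IsMollifier.hasCompactSupport_mollify {C ε : ℝ} {e : R3 → ℝ} (he : IsMollifier C ε e)
    {h : R3 → ℝ} (hh : HasCompactSupport h) : HasCompactSupport (mollify e h) := by
  rw [mollify_eq_convolution]
  exact hh.convolution _ he.hasCompactSupport_neg

theorem integrable_indicator_smul_add_smul {E : Type*} [NormedAddCommGroup E] [NormedSpace ℝ E]
    {Ω : Set R3} (hΩ : MeasurableSet Ω) {a b : R3 → ℝ} {f g : R3 → E}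
    (ha : MemLp a 1 (volume.restrict Ω)) (hf : MemLp f ∞ (volume.restrict Ω))
    (hb : MemLp b ∞ (volume.restrict Ω)) (hg : MemLp g 1 (volume.restrict Ω)) :
    Integrable (Ω.indicator fun x => a x • f x + b x • g x) :=
  (integrable_indicator_iff hΩ).2
    (memLp_one_iff_integrable.1 ((hf.smul ha (r := 1)).add (hg.smul hb (r := 1))))

/-- The weak gradient of `G`, tested with `χ e(· - x)`, identifies the gradient of the
mollification of `χ G` with the mollification of `χ ∇G + G ∇χ`. -/
theorem IsMollifier.fderiv_mollify_indicator {C ε : ℝ} {e : R3 → ℝ} (he : IsMollifier C ε e)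
    {Ω : Set R3} (hΩ : IsOpen Ω) {G : R3 → ℝ} {DG : R3 → R3 →L[ℝ] ℝ} (hG : MemW1Infty Ω G DG)
    {χ : R3 → ℝ} (hχ : IsTestFunction ⊤ Ω χ)
    (hgi : Integrable (Ω.indicator fun x => χ x * G x))
    (hwi : Integrable (Ω.indicator fun x => χ x • DG x + G x • fderiv ℝ χ x)) (x v : R3) :
    fderiv ℝ (mollify e (Ω.indicator fun x => χ x * G x)) x v
      = mollify e (Ω.indicator fun x => χ x • DG x + G x • fderiv ℝ χ x) x v := by
  set ν := volume.restrict Ω with hν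
  have hψ : IsTestFunction ⊤ Ω fun y => χ y * e (y - x) := by
    refine ⟨hχ.1.mul (he.isTestFunction_sub x).1, hχ.2.mul_right, ?_⟩
    exact (closure_mono (Function.support_mul_subset_left _ _)).trans hχ.3
  have hd : ∀ y, fderiv ℝ (fun y => χ y * e (y - x)) y v
      = χ y * fderiv ℝ e (y - x) v + e (y - x) * fderiv ℝ χ y v := fun y => by
    rw [fderiv_fun_mul (hχ.1.differentiable (by simp) y)
      ((he.isTestFunction_sub x).1.differentiable (by simp) y), IsMollifier.fderiv_sub]
    simp
  have hweak := hG.hasWeakDeriv.integral_eq _ hψ v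
  simp_rw [hd] at hweak
  have hik : ∀ {k : R3 → ℝ} {q : R3 → ℝ}, Continuous k → HasCompactSupport k → MemLp q ∞ ν →
      Integrable (fun y => k y * q y) ν := fun {k q} hk hks hq =>
    memLp_one_iff_integrable.1
      (hq.mul (hk.memLp_of_hasCompactSupport (p := 1) (μ := ν) hks) (r := 1))
  have hDe := he.continuous_fderiv
  have hDχ := hχ.continuous_fderiv
  have hec := he.contDiff.continuous
  have hχc := hχ.1.continuous
  have i1 : Integrable (fun y => (χ y * fderiv ℝ e (y - x) v) * G y) ν :=
    hik (by fun_prop) hχ.2.mul_right hG.memLp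
  have i2 : Integrable (fun y => (e (y - x) * fderiv ℝ χ y v) * G y) ν :=
    hik (by fun_prop) (hasCompactSupport_fderiv_apply hχ.2 v).mul_left hG.memLp
  have i3 : Integrable (fun y => (χ y * e (y - x)) * DG y v) ν :=
    hik (by fun_prop) hχ.2.mul_right (hG.memLp_deriv.continuousLinearMap_comp
      (ContinuousLinearMap.apply ℝ ℝ v))
  simp only [smul_eq_mul, add_mul] at hweak
  rw [integral_add i1 i2] at hweak
  have hwk : Integrable fun y =>
      e (y - x) • (Ω.indicator fun x => χ x • DG x + G x • fderiv ℝ χ x) y :=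
    integrable_kernel_smul hec he.hasCompactSupport hwi.locallyIntegrable x
  rw [he.fderiv_mollify hgi.locallyIntegrable, mollify,
    ContinuousLinearMap.integral_apply hwk]
  have e1 : ∀ y, (Ω.indicator fun x => χ x * G x) y * fderiv ℝ e (y - x) v
      = Ω.indicator (fun y => (χ y * fderiv ℝ e (y - x) v) * G y) y := fun y => by
    by_cases hy : y ∈ Ω <;> simp [hy]
    ring
  have e2 : ∀ y, (e (y - x) • (Ω.indicator fun x => χ x • DG x + G x • fderiv ℝ χ x) y) v
      = Ω.indicator (fun y => (χ y * e (y - x)) * DG y v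
        + (e (y - x) * fderiv ℝ χ y v) * G y) y := fun y => by
    by_cases hy : y ∈ Ω <;> simp [hy]
    ring
  simp_rw [e1, e2]
  rw [integral_indicator hΩ.measurableSet, integral_indicator hΩ.measurableSet,
    integral_add i3 i2]
  linarith

/-- The function `χ G`, extended by zero, is an admissible test function for the continuity
equation when `G` and its weak gradient are bounded and `χ` is a test function in `Ω`. -/
theorem integral_cutoff_potential_eq_zero {Ω : Set R3} (hΩ : IsOpen Ω) {G : R3 → ℝ}
    {DG : R3 → R3 →L[ℝ] ℝ} (hG : MemW1Infty Ω G DG) {ρ : R3 → ℝ} {u : R3 → R3}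
    (hρu : Integrable (fun x => ρ x • u x) (volume.restrict Ω))
    (hcont : ∀ ψ : R3 → ℝ, IsTestFunction ⊤ univ ψ → ∫ x in Ω, ρ x * fderiv ℝ ψ x (u x) = 0)
    {χ : R3 → ℝ} (hχ : IsTestFunction ⊤ Ω χ) :
    ∫ x in Ω, ρ x * (χ x * DG x (u x) + G x * fderiv ℝ χ x (u x)) = 0 := by
  obtain ⟨C, hC, hCe⟩ := exists_isMollifier
  let ε : ℕ → ℝ := fun j => 1 / ((j : ℝ) + 1)
  have hε : ∀ j, 0 < ε j := fun j => Nat.one_div_pos_of_nat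
  have hε0 : Tendsto ε atTop (𝓝 0) := tendsto_one_div_add_atTop_nhds_zero_nat
  choose e he using fun j => hCe (ε j) (hε j)
  set ν := volume.restrict Ω with hν
  set g : R3 → ℝ := Ω.indicator fun x => χ x * G x with hg
  set w₀ : R3 → R3 →L[ℝ] ℝ := fun x => χ x • DG x + G x • fderiv ℝ χ x with hw₀
  set w : R3 → R3 →L[ℝ] ℝ := Ω.indicator w₀ with hw
  have hgΩ : Integrable (fun x => χ x * G x) ν :=
    memLp_one_iff_integrable.1 (hG.memLp.mul (hχ.memLp 1 ν) (r := 1))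
  have hgi : Integrable g := (integrable_indicator_iff hΩ.measurableSet).2 hgΩ
  have hwi : Integrable w := integrable_indicator_smul_add_smul hΩ.measurableSet
    (hχ.memLp 1 ν) hG.memLp_deriv hG.memLp (hχ.memLp_fderiv 1 ν)
  have hgs : HasCompactSupport g := by
    refine hχ.2.mono fun x hx h => hx ?_
    simp [hg, h]
  obtain ⟨B, hB0, hB⟩ := exists_ae_norm_le_of_memLp_top hG.memLp
  obtain ⟨B', hB'0, hB'⟩ := exists_ae_norm_le_of_memLp_top hG.memLp_deriv
  obtain ⟨c, hc⟩ := hχ.2.exists_bound_of_continuous hχ.1.continuous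
  obtain ⟨c', hc'⟩ := (hχ.2.fderiv ℝ).exists_bound_of_continuous hχ.continuous_fderiv
  have hc0 : 0 ≤ c := (norm_nonneg _).trans (hc 0)
  have hwb : ∀ᵐ x, ‖w x‖ ≤ c * B' + B * c' := by
    have h1 : ∀ᵐ x ∂ν, ‖w₀ x‖ ≤ c * B' + B * c' := by
      filter_upwards [hB, hB'] with x hx hx'
      refine (norm_add_le _ _).trans ?_
      rw [norm_smul, norm_smul]
      exact add_le_add (mul_le_mul (hc x) hx' (norm_nonneg _) hc0)
        (mul_le_mul hx (hc' x) (norm_nonneg _) hB0)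
    rw [ae_restrict_iff' hΩ.measurableSet] at h1
    filter_upwards [h1] with x hx
    by_cases hxΩ : x ∈ Ω
    · rw [hw, indicator_of_mem hxΩ]
      exact hx hxΩ
    · rw [hw, indicator_of_notMem hxΩ, norm_zero]
      have := (norm_nonneg _).trans (hc' 0)
      positivity
  have hmw : ∀ j x, ‖mollify (e j) w x‖ ≤ c * B' + B * c' := by
    intro j x
    have hi : Integrable fun y => e j (y - x) := ((he j).contDiff.continuous
      |>.integrable_of_hasCompactSupport (he j).hasCompactSupport).comp_sub_right x
    calc ‖mollify (e j) w x‖ ≤ ∫ y, e j (y - x) * (c * B' + B * c') := by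
          refine norm_integral_le_of_norm_le (hi.mul_const _) ?_
          filter_upwards [hwb] with y hy
          rw [norm_smul, Real.norm_of_nonneg ((he j).nonneg _)]
          exact mul_le_mul_of_nonneg_left hy ((he j).nonneg _)
      _ = c * B' + B * c' := by
          rw [integral_mul_const, (he j).integral_sub_eq_one, one_mul]
  have hDm : ∀ j x v, fderiv ℝ (mollify (e j) g) x v = mollify (e j) w x v :=
    fun j x v => (he j).fderiv_mollify_indicator hΩ hG hχ hgi hwi x v
  have hzero : ∀ j, ∫ x, ρ x * mollify (e j) w x (u x) ∂ν = 0 := by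
    intro j
    have hψ : IsTestFunction ⊤ univ (mollify (e j) g) := by
      exact ⟨(he j).contDiff_mollify hgi.locallyIntegrable, (he j).hasCompactSupport_mollify hgs,
        subset_univ _⟩
    have := hcont _ hψ
    simp_rw [hDm] at this
    exact this
  have hlim : Tendsto (fun j => ∫ x, ρ x * mollify (e j) w x (u x) ∂ν) atTop
      (𝓝 (∫ x, ρ x * w₀ x (u x) ∂ν)) := by
    refine tendsto_integral_of_dominated_convergence
      (fun x => (c * B' + B * c') * ‖ρ x • u x‖) ?_ (hρu.norm.const_mul _) ?_ ?_
    · intro j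
      have hcm : Continuous (fderiv ℝ (mollify (e j) g)) :=
        ((he j).contDiff_mollify hgi.locallyIntegrable).continuous_fderiv (by simp)
      have h1 : AEStronglyMeasurable (fun x => fderiv ℝ (mollify (e j) g) x (ρ x • u x)) ν :=
        isBoundedBilinearMap_apply.continuous.comp_aestronglyMeasurable
          (hcm.aestronglyMeasurable.prodMk hρu.1)
      refine h1.congr (Eventually.of_forall fun x => ?_)
      simp [hDm]
    · refine fun j => Eventually.of_forall fun x => ?_
      rw [← smul_eq_mul, ← map_smul]
      exact ((mollify (e j) w x).le_opNorm _).trans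
        (mul_le_mul_of_nonneg_right (hmw j x) (norm_nonneg _))
    · have h1 := ae_restrict_of_ae (s := Ω) (tendsto_mollify_ae hε hε0 he hwi.locallyIntegrable)
      filter_upwards [h1, ae_restrict_mem hΩ.measurableSet] with x hx hxΩ
      have h2 : w x = w₀ x := by rw [hw, indicator_of_mem hxΩ]
      rw [← h2]
      have h3 := ((ContinuousLinearMap.apply ℝ ℝ (u x)).continuous.tendsto _).comp hx.2
      exact h3.const_mul (ρ x)
  simp_rw [hzero] at hlim
  have := tendsto_nhds_unique hlim tendsto_const_nhds
  simpa [hw₀] using this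

theorem hasFDerivAt_normSq_div {φ : R3 → R3} {x : R3} (hφ : DifferentiableAt ℝ φ x) {δ : ℝ}
    (hδ : 0 < δ) :
    HasFDerivAt (fun x => ‖φ x‖ ^ 2 / (‖φ x‖ ^ 2 + δ))
      ((δ / (‖φ x‖ ^ 2 + δ) ^ 2) • (2 • (innerSL ℝ (φ x)).comp (fderiv ℝ φ x))) x := by
  have hs : ‖φ x‖ ^ 2 + δ ≠ 0 := by positivity
  have h1 : HasDerivAt (fun s : ℝ => s / (s + δ)) (δ / (‖φ x‖ ^ 2 + δ) ^ 2) (‖φ x‖ ^ 2) := by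
    have := (hasDerivAt_id (‖φ x‖ ^ 2)).div ((hasDerivAt_id (‖φ x‖ ^ 2)).add_const δ) hs
    convert! this using 1
    simp
  exact h1.comp_hasFDerivAt x hφ.hasFDerivAt.norm_sq

theorem fderiv_normSq_div_apply {φ : R3 → R3} {x : R3} (hφ : DifferentiableAt ℝ φ x) {δ : ℝ}
    (hδ : 0 < δ) (v : R3) : fderiv ℝ (fun x => ‖φ x‖ ^ 2 / (‖φ x‖ ^ 2 + δ)) x v
      = inner ℝ ((2 * δ / (‖φ x‖ ^ 2 + δ) ^ 2) • φ x) (fderiv ℝ φ x v) := by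
  rw [(hasFDerivAt_normSq_div hφ hδ).fderiv, real_inner_smul_left]
  simp
  ring

theorem isTestFunction_normSq_div {Ω : Set R3} {φ : R3 → R3} (hφ : IsTestFunction ⊤ Ω φ) {δ : ℝ}
    (hδ : 0 < δ) : IsTestFunction ⊤ Ω fun x => ‖φ x‖ ^ 2 / (‖φ x‖ ^ 2 + δ) := by
  refine ⟨?_, ?_, ?_⟩
  · exact (hφ.1.norm_sq ℝ).div ((hφ.1.norm_sq ℝ).add contDiff_const) fun x => by positivity
  · exact hφ.2.comp_left (g := fun y => ‖y‖ ^ 2 / (‖y‖ ^ 2 + δ)) (by simp)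
  · have hsub : Function.support (fun x => ‖φ x‖ ^ 2 / (‖φ x‖ ^ 2 + δ)) ⊆ Function.support φ :=
      fun x hx h => hx (by simp [h])
    exact (closure_mono hsub).trans hφ.3

/-- The gradient `2 δ y / (|y|² + δ)²` of `|y|² / (|y|² + δ)` is bounded, but not uniformly
in `δ`. -/
theorem norm_smul_self_le {δ : ℝ} (hδ : 0 < δ) (y : R3) :
    ‖(2 * δ / (‖y‖ ^ 2 + δ) ^ 2) • y‖ ≤ 1 + 1 / δ := by
  rw [norm_smul, Real.norm_of_nonneg (by positivity), div_mul_eq_mul_div,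
    div_le_iff₀ (by positivity)]
  have h1 : (1 + 1 / δ) * (‖y‖ ^ 2 + δ) ^ 2 = (‖y‖ ^ 2 + δ) ^ 2 + (‖y‖ ^ 2 + δ) ^ 2 / δ := by ring
  have h2 : 2 * ‖y‖ ^ 2 + δ ≤ (‖y‖ ^ 2 + δ) ^ 2 / δ := by
    rw [le_div_iff₀ hδ]
    nlinarith [sq_nonneg (‖y‖ ^ 2)]
  rw [h1]
  nlinarith [sq_nonneg (‖y‖ ^ 2), sq_nonneg (‖y‖ - δ), sq_nonneg (‖y‖ - 1), hδ,
    mul_nonneg hδ.le (sq_nonneg (‖y‖ - 1)), mul_nonneg hδ.le (sq_nonneg ‖y‖), sq_nonneg ‖y‖]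

/-- Multiplied by `|y|`, the gradient of `|y|² / (|y|² + δ)` is bounded uniformly in `δ`. -/
theorem norm_smul_self_mul_norm_le_one {δ : ℝ} (hδ : 0 < δ) (y : R3) :
    ‖(2 * δ / (‖y‖ ^ 2 + δ) ^ 2) • y‖ * ‖y‖ ≤ 1 := by
  rw [norm_smul, Real.norm_of_nonneg (by positivity), mul_assoc, div_mul_eq_mul_div,
    div_le_one (by positivity)]
  nlinarith [sq_nonneg (‖y‖ ^ 2), sq_nonneg δ]

/-- A bounded potential with bounded gradient does no work on a divergence-free momentum `ρ u`,
with no condition on `G` at the boundary: the cutoffs `|φₙ|² / (|φₙ|² + δ)` built from the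
approximations of `u` vanish near `∂Ω`, and the error they cause is controlled by
`∫ ρ |G| |∇u|` over the set where `u` is small but not zero. -/
theorem integral_bounded_potential_eq_zero {Ω : Set R3} (hΩ : IsOpen Ω) {G : R3 → ℝ}
    {DG : R3 → R3 →L[ℝ] ℝ} (hG : MemW1Infty Ω G DG) {ρ : R3 → ℝ} {u : R3 → R3}
    {Du : R3 → R3 →L[ℝ] R3} (hρm : AEStronglyMeasurable ρ (volume.restrict Ω))
    (hum : AEStronglyMeasurable u (volume.restrict Ω))
    (hρ2 : MemLp ρ 2 (volume.restrict Ω))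
    (hρu : Integrable (fun x => ρ x • u x) (volume.restrict Ω))
    (hρu2 : MemLp (fun x => ρ x * ‖u x‖) 2 (volume.restrict Ω))
    (hDu : MemLp Du 2 (volume.restrict Ω))
    (hcont : ∀ ψ : R3 → ℝ, IsTestFunction ⊤ univ ψ → ∫ x in Ω, ρ x * fderiv ℝ ψ x (u x) = 0)
    {φ : ℕ → R3 → R3} (hφ : ∀ n, IsTestFunction ⊤ Ω (φ n))
    (hφD : Tendsto (fun n => eLpNorm (fun x => fderiv ℝ (φ n) x - Du x) 2 (volume.restrict Ω))
      atTop (𝓝 0))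
    (hφu : ∀ᵐ x ∂(volume.restrict Ω), Tendsto (fun n => φ n x) atTop (𝓝 (u x))) :
    ∫ x in Ω, ρ x * DG x (u x) = 0 := by
  set ν := volume.restrict Ω with hν
  obtain ⟨B, hB0, hB⟩ := exists_ae_norm_le_of_memLp_top hG.memLp
  obtain ⟨B', hB'0, hB'⟩ := exists_ae_norm_le_of_memLp_top hG.memLp_deriv
  have hGm := hG.memLp.1
  have hDGm := hG.memLp_deriv.1
  have hDuu : AEStronglyMeasurable (fun x => Du x (u x)) ν :=
    isBoundedBilinearMap_apply.continuous.comp_aestronglyMeasurable (hDu.1.prodMk hum)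
  have hDGu : AEStronglyMeasurable (fun x => DG x (u x)) ν :=
    isBoundedBilinearMap_apply.continuous.comp_aestronglyMeasurable (hDGm.prodMk hum)
  set k : ℝ → R3 → R3 := fun δ y => (2 * δ / (‖y‖ ^ 2 + δ) ^ 2) • y with hk
  have hkc : ∀ δ, 0 < δ → Continuous (k δ) := fun δ hδ => by
    have h1 : Continuous fun y : R3 => 2 * δ / (‖y‖ ^ 2 + δ) ^ 2 :=
      Continuous.div (by fun_prop) (by fun_prop) fun y => by positivity
    exact h1.smul continuous_id
  have hhc : ∀ δ, 0 < δ → Continuous fun y : R3 => ‖y‖ ^ 2 / (‖y‖ ^ 2 + δ) := fun δ hδ =>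
    Continuous.div (by fun_prop) (by fun_prop) fun y => by positivity
  have hh1 : ∀ δ, 0 < δ → ∀ y : R3, |‖y‖ ^ 2 / (‖y‖ ^ 2 + δ)| ≤ 1 := fun δ hδ y => by
    rw [abs_of_nonneg (by positivity), div_le_one (by positivity)]
    linarith
  -- The part of the equation in which the cutoff is not differentiated.
  have hpart1 : ∀ h : R3 → ℝ, AEStronglyMeasurable h ν → (∀ x, |h x| ≤ 1) →
      Integrable (fun x => ρ x * (h x * DG x (u x))) ν ∧
      ∀ᵐ x ∂ν, ‖ρ x * (h x * DG x (u x))‖ ≤ B' * ‖ρ x • u x‖ := by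
    intro h hm h1
    have hb : ∀ᵐ x ∂ν, ‖ρ x * (h x * DG x (u x))‖ ≤ B' * ‖ρ x • u x‖ := by
      filter_upwards [hB'] with x hx
      rw [norm_smul, norm_mul, norm_mul]
      calc ‖ρ x‖ * (‖h x‖ * ‖DG x (u x)‖) ≤ ‖ρ x‖ * (1 * (B' * ‖u x‖)) := by
            gcongr
            · exact h1 x
            · exact (DG x).le_of_opNorm_le hx _
        _ = _ := by ring
    exact ⟨(hρu.norm.const_mul B').mono' (hρm.mul (hm.mul hDGu)) hb, hb⟩
  have hDuρ : Integrable (fun x => (ρ x * ‖u x‖) * ‖Du x‖) ν := hρu2.integrable_mul hDu.norm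
  have hδ : ∀ δ, 0 < δ → ∫ x, ρ x * (‖u x‖ ^ 2 / (‖u x‖ ^ 2 + δ) * DG x (u x)
      + G x * inner ℝ (k δ (u x)) (Du x (u x))) ∂ν = 0 := by
    intro δ hδ
    have hpart2 : ∀ v : R3 → R3, AEStronglyMeasurable v ν →
        Integrable (fun x => ρ x * (G x * inner ℝ (k δ (v x)) (Du x (u x)))) ν ∧
        ∀ᵐ x ∂ν, ‖ρ x * (G x * inner ℝ (k δ (v x)) (Du x (u x)))‖
          ≤ B * (1 + 1 / δ) * ‖(ρ x * ‖u x‖) * ‖Du x‖‖ := by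
      intro v hv
      have hb : ∀ᵐ x ∂ν, ‖ρ x * (G x * inner ℝ (k δ (v x)) (Du x (u x)))‖
          ≤ B * (1 + 1 / δ) * ‖(ρ x * ‖u x‖) * ‖Du x‖‖ := by
        filter_upwards [hB] with x hx
        rw [norm_mul, norm_mul, norm_mul, norm_mul, norm_norm, norm_norm]
        calc ‖ρ x‖ * (‖G x‖ * ‖inner ℝ (k δ (v x)) (Du x (u x))‖)
            ≤ ‖ρ x‖ * (B * ((1 + 1 / δ) * (‖Du x‖ * ‖u x‖))) := by
              gcongr
              refine (norm_inner_le_norm _ _).trans ?_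
              gcongr
              · exact norm_smul_self_le hδ _
              · exact (Du x).le_opNorm _
          _ = _ := by ring
      refine ⟨(hDuρ.norm.const_mul _).mono' ?_ hb, hb⟩
      exact hρm.mul (hGm.mul (((hkc δ hδ).comp_aestronglyMeasurable hv).inner hDuu))
    have hφm : ∀ n, AEStronglyMeasurable (φ n) ν := fun n =>
      (hφ n).1.continuous.aestronglyMeasurable
    have hDφm : ∀ n, AEStronglyMeasurable (fderiv ℝ (φ n)) ν := fun n =>
      (hφ n).continuous_fderiv.aestronglyMeasurable
    have hrem : ∀ n, Integrable (fun x => ρ x * (G x * inner ℝ (k δ (φ n x))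
        ((fderiv ℝ (φ n) x - Du x) (u x)))) ν ∧ ∀ᵐ x ∂ν, |ρ x * (G x * inner ℝ (k δ (φ n x))
        ((fderiv ℝ (φ n) x - Du x) (u x))) - 0| ≤ B * (1 + 1 / δ) * (|ρ x * ‖u x‖| *
          ‖fderiv ℝ (φ n) x - Du x‖) := by
      intro n
      have hb : ∀ᵐ x ∂ν, |ρ x * (G x * inner ℝ (k δ (φ n x))
        ((fderiv ℝ (φ n) x - Du x) (u x)))| ≤ B * (1 + 1 / δ) * (|ρ x * ‖u x‖| *
          ‖fderiv ℝ (φ n) x - Du x‖) := by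
        filter_upwards [hB] with x hx
        rw [← Real.norm_eq_abs, ← Real.norm_eq_abs, norm_mul, norm_mul, norm_mul, norm_norm]
        calc ‖ρ x‖ * (‖G x‖ * ‖inner ℝ (k δ (φ n x)) ((fderiv ℝ (φ n) x - Du x) (u x))‖)
            ≤ ‖ρ x‖ * (B * ((1 + 1 / δ) * (‖fderiv ℝ (φ n) x - Du x‖ * ‖u x‖))) := by
              gcongr
              refine (norm_inner_le_norm _ _).trans ?_
              gcongr
              · exact norm_smul_self_le hδ _
              · exact (fderiv ℝ (φ n) x - Du x).le_opNorm _
          _ = _ := by ring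
      simp_rw [sub_zero]
      refine ⟨Integrable.mono' (g := fun x => B * (1 + 1 / δ) * (|ρ x * ‖u x‖| *
          ‖fderiv ℝ (φ n) x - Du x‖)) ?_ ?_ hb, hb⟩
      · refine Integrable.const_mul ?_ _
        exact MemLp.integrable_mul (p := 2) (q := 2) hρu2.abs
          (((hφ n).memLp_fderiv 2 ν).sub hDu).norm
      · have h1 : AEStronglyMeasurable (fun x => (fderiv ℝ (φ n) x - Du x) (u x)) ν :=
          isBoundedBilinearMap_apply.continuous.comp_aestronglyMeasurable
            (((hDφm n).sub hDu.1).prodMk hum)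
        exact hρm.mul (hGm.mul (((hkc δ hδ).comp_aestronglyMeasurable (hφm n)).inner h1))
    have hzero : ∀ n, (∫ x, ρ x * (‖φ n x‖ ^ 2 / (‖φ n x‖ ^ 2 + δ) * DG x (u x)) ∂ν)
        + (∫ x, ρ x * (G x * inner ℝ (k δ (φ n x)) (Du x (u x))) ∂ν)
        + ∫ x, ρ x * (G x * inner ℝ (k δ (φ n x)) ((fderiv ℝ (φ n) x - Du x) (u x))) ∂ν = 0 := by
      intro n
      have h1 := integral_cutoff_potential_eq_zero hΩ hG hρu hcont
        (isTestFunction_normSq_div (hφ n) hδ)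
      simp_rw [fun x => fderiv_normSq_div_apply ((hφ n).1.differentiable (by simp) x) hδ (u x)]
        at h1
      have i1 := (hpart1 (fun x => ‖φ n x‖ ^ 2 / (‖φ n x‖ ^ 2 + δ))
        ((hhc δ hδ).comp_aestronglyMeasurable (hφm n)) fun x => hh1 δ hδ _).1
      have i2 := (hpart2 (φ n) (hφm n)).1
      have i12 : Integrable (fun x => ρ x * (‖φ n x‖ ^ 2 / (‖φ n x‖ ^ 2 + δ) * DG x (u x))
          + ρ x * (G x * inner ℝ (k δ (φ n x)) (Du x (u x)))) ν := i1.add i2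
      rw [← integral_add i1 i2, ← integral_add i12 (hrem n).1, ← h1]
      refine integral_congr_ae (Eventually.of_forall fun x => ?_)
      simp only [hk, sub_apply, inner_sub_right]
      ring
    have hl1 : Tendsto (fun n => ∫ x, ρ x * (‖φ n x‖ ^ 2 / (‖φ n x‖ ^ 2 + δ) * DG x (u x)) ∂ν)
        atTop (𝓝 (∫ x, ρ x * (‖u x‖ ^ 2 / (‖u x‖ ^ 2 + δ) * DG x (u x)) ∂ν)) := by
      have hp := fun n => hpart1 (fun x => ‖φ n x‖ ^ 2 / (‖φ n x‖ ^ 2 + δ))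
        ((hhc δ hδ).comp_aestronglyMeasurable (hφm n)) fun x => hh1 δ hδ _
      refine tendsto_integral_of_dominated_convergence (fun x => B' * ‖ρ x • u x‖)
        (fun n => (hp n).1.1) (hρu.norm.const_mul _) (fun n => (hp n).2) ?_
      filter_upwards [hφu] with x hx
      exact ((((hhc δ hδ).tendsto _).comp hx).mul_const _).const_mul _
    have hl2 : Tendsto (fun n => ∫ x, ρ x * (G x * inner ℝ (k δ (φ n x)) (Du x (u x))) ∂ν)
        atTop (𝓝 (∫ x, ρ x * (G x * inner ℝ (k δ (u x)) (Du x (u x))) ∂ν)) := by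
      refine tendsto_integral_of_dominated_convergence _
        (fun n => (hpart2 (φ n) (hφm n)).1.1) (hDuρ.norm.const_mul (B * (1 + 1 / δ)))
        (fun n => (hpart2 (φ n) (hφm n)).2) ?_
      filter_upwards [hφu] with x hx
      exact (((((hkc δ hδ).tendsto _).comp hx).inner tendsto_const_nhds).const_mul _).const_mul _
    have hl3 : Tendsto (fun n => ∫ x, ρ x * (G x * inner ℝ (k δ (φ n x))
        ((fderiv ℝ (φ n) x - Du x) (u x))) ∂ν) atTop (𝓝 (∫ x, (0 : ℝ) ∂ν)) :=
      tendsto_integral_of_norm_sub_le_mul_const (p := 2) (q := 2) hρu2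
        (fun n => (hDφm n).sub hDu.1) hφD (fun n => (hrem n).1) aestronglyMeasurable_const _
        fun n => (hrem n).2
    have hl := (hl1.add hl2).add hl3
    simp_rw [hzero] at hl
    have h0 := tendsto_nhds_unique hl tendsto_const_nhds
    rw [integral_zero, add_zero, ← integral_add] at h0
    · rw [← h0]
      refine integral_congr_ae (Eventually.of_forall fun x => ?_)
      simp only
      ring
    · exact (hpart1 (fun x => ‖u x‖ ^ 2 / (‖u x‖ ^ 2 + δ))
        ((hhc δ hδ).comp_aestronglyMeasurable hum) fun x => hh1 δ hδ _).1
    · exact (hpart2 u hum).1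
  let δ : ℕ → ℝ := fun j => 1 / ((j : ℝ) + 1)
  have hδpos : ∀ j, 0 < δ j := fun j => Nat.one_div_pos_of_nat
  have hδ0 : Tendsto δ atTop (𝓝 0) := tendsto_one_div_add_atTop_nhds_zero_nat
  have hlim : Tendsto (fun j => ∫ x, ρ x * (‖u x‖ ^ 2 / (‖u x‖ ^ 2 + δ j) * DG x (u x)
      + G x * inner ℝ (k (δ j) (u x)) (Du x (u x))) ∂ν) atTop
      (𝓝 (∫ x, ρ x * DG x (u x) ∂ν)) := by
    refine tendsto_integral_of_dominated_convergence
      (fun x => B' * ‖ρ x • u x‖ + B * (|ρ x| * ‖Du x‖)) ?_ ?_ ?_ ?_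
    · intro j
      exact hρm.mul ((((hhc _ (hδpos j)).comp_aestronglyMeasurable hum).mul hDGu).add
        (hGm.mul (((hkc _ (hδpos j)).comp_aestronglyMeasurable hum).inner hDuu)))
    · exact (hρu.norm.const_mul _).add
        ((MemLp.integrable_mul (p := 2) (q := 2) hρ2.abs hDu.norm).const_mul _)
    · intro j
      filter_upwards [(hpart1 (fun x => ‖u x‖ ^ 2 / (‖u x‖ ^ 2 + δ j))
        ((hhc _ (hδpos j)).comp_aestronglyMeasurable hum) fun x => hh1 _ (hδpos j) _).2, hB]
        with x hx hxB
      rw [mul_add]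
      refine (norm_add_le _ _).trans (add_le_add hx ?_)
      rw [norm_mul, norm_mul, Real.norm_eq_abs (ρ x)]
      calc |ρ x| * (‖G x‖ * ‖inner ℝ (k (δ j) (u x)) (Du x (u x))‖)
          ≤ |ρ x| * (B * (‖k (δ j) (u x)‖ * (‖Du x‖ * ‖u x‖))) := by
            gcongr
            refine (norm_inner_le_norm _ _).trans ?_
            gcongr
            exact (Du x).le_opNorm _
        _ = |ρ x| * (B * (‖k (δ j) (u x)‖ * ‖u x‖ * ‖Du x‖)) := by ring
        _ ≤ |ρ x| * (B * (1 * ‖Du x‖)) := by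
            gcongr
            exact norm_smul_self_mul_norm_le_one (hδpos j) _
        _ = _ := by ring
    · refine Eventually.of_forall fun x => ?_
      by_cases hx : u x = 0
      · simp [hx]
      have hpos : 0 < ‖u x‖ ^ 2 := by positivity
      have h1 : Tendsto (fun j => ‖u x‖ ^ 2 / (‖u x‖ ^ 2 + δ j)) atTop
          (𝓝 (‖u x‖ ^ 2 / (‖u x‖ ^ 2 + 0))) :=
        tendsto_const_nhds.div (tendsto_const_nhds.add hδ0) (by simpa using hx)
      rw [add_zero, div_self hpos.ne'] at h1
      have h2 : Tendsto (fun j => k (δ j) (u x)) atTop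
          (𝓝 ((2 * 0 / (‖u x‖ ^ 2 + 0) ^ 2) • u x)) :=
        ((hδ0.const_mul 2).div ((tendsto_const_nhds.add hδ0).pow 2)
          (by simpa using hx)).smul_const _
      have h3 := ((h1.mul_const (DG x (u x))).add ((h2.inner
        (tendsto_const_nhds (x := Du x (u x)))).const_mul (G x))).const_mul (ρ x)
      simpa using h3
  simp_rw [fun j => hδ _ (hδpos j)] at hlim
  exact tendsto_nhds_unique hlim tendsto_const_nhds

/-! ### Viscous dissipation -/

/-- The bilinear form `𝕊(L') : L` of viscous dissipation. -/
noncomputable def viscousForm (μ η : ℝ) (L' L : R3 →L[ℝ] R3) : ℝ :=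
  contract (viscousStress μ η (jacobian L')) (jacobian L)

theorem viscousForm_eq_sum (μ η : ℝ) (L' L : R3 →L[ℝ] R3) :
    viscousForm μ η L' L = ∑ i, ∑ j, (μ * (jacobian L' i j + jacobian L' j i
      - (2 / 3 * divergence L') * (if i = j then 1 else 0))
      + (η * divergence L') * (if i = j then 1 else 0)) * jacobian L i j := by
  simp [viscousForm, contract, viscousStress, divergence, Matrix.one_apply]

theorem jacobian_apply (L : R3 →L[ℝ] R3) (i j : Fin 3) :
    jacobian L i j = L (EuclideanSpace.single j 1) i := rfl

theorem continuous_jacobian_apply (i j : Fin 3) :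
    Continuous fun L : R3 →L[ℝ] R3 => jacobian L i j := by
  simp_rw [jacobian_apply]
  fun_prop

theorem jacobian_sub (L L' : R3 →L[ℝ] R3) : jacobian (L - L') = jacobian L - jacobian L' := by
  ext i j
  simp [jacobian_apply]

theorem continuous_viscousForm (μ η : ℝ) :
    Continuous fun p : (R3 →L[ℝ] R3) × (R3 →L[ℝ] R3) => viscousForm μ η p.1 p.2 := by
  simp_rw [viscousForm_eq_sum]
  have h := continuous_jacobian_apply
  have hd := continuous_divergence
  have h1 : ∀ i j, Continuous fun p : (R3 →L[ℝ] R3) × (R3 →L[ℝ] R3) => jacobian p.1 i j :=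
    fun i j => (h i j).comp continuous_fst
  have h2 : ∀ i j, Continuous fun p : (R3 →L[ℝ] R3) × (R3 →L[ℝ] R3) => jacobian p.2 i j :=
    fun i j => (h i j).comp continuous_snd
  have h3 : Continuous fun p : (R3 →L[ℝ] R3) × (R3 →L[ℝ] R3) => divergence p.1 :=
    hd.comp continuous_fst
  fun_prop

theorem viscousForm_sub_right (μ η : ℝ) (L' L₁ L₂ : R3 →L[ℝ] R3) :
    viscousForm μ η L' (L₁ - L₂) = viscousForm μ η L' L₁ - viscousForm μ η L' L₂ := by
  simp only [viscousForm_eq_sum, jacobian_sub, Matrix.sub_apply, mul_sub, Finset.sum_sub_distrib]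

theorem viscousForm_sub_left (μ η : ℝ) (L₁ L₂ L : R3 →L[ℝ] R3) :
    viscousForm μ η (L₁ - L₂) L = viscousForm μ η L₁ L - viscousForm μ η L₂ L := by
  simp only [viscousForm_eq_sum, jacobian_sub, Matrix.sub_apply, divergence_sub,
    ← Finset.sum_sub_distrib]
  refine Finset.sum_congr rfl fun i _ => Finset.sum_congr rfl fun j _ => ?_
  ring

theorem abs_viscousForm_le {μ η : ℝ} (hμ : 0 ≤ μ) (hη : 0 ≤ η) (L' L : R3 →L[ℝ] R3) :
    |viscousForm μ η L' L| ≤ 9 * (4 * μ + 3 * η) * (‖L'‖ * ‖L‖) := by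
  have hent : ∀ i j : Fin 3, |(μ * (jacobian L' i j + jacobian L' j i
      - (2 / 3 * divergence L') * (if i = j then 1 else 0))
      + (η * divergence L') * (if i = j then 1 else 0)) * jacobian L i j|
      ≤ (4 * μ + 3 * η) * (‖L'‖ * ‖L‖) := by
    intro i j
    have h1 := abs_le.1 (abs_apply_single_le L' i j)
    have h2 := abs_le.1 (abs_apply_single_le L' j i)
    have h3 := abs_le.1 (abs_divergence_le L')
    rw [← jacobian_apply] at h1 h2
    rw [abs_mul, ← mul_assoc]
    refine mul_le_mul ?_ (abs_apply_single_le L i j) (abs_nonneg _) (by positivity)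
    split_ifs
    · have e1 : |jacobian L' i j + jacobian L' j i - 2 / 3 * divergence L' * 1| ≤ 4 * ‖L'‖ := by
        rw [abs_le]
        constructor <;> linarith [h1.1, h1.2, h2.1, h2.2, h3.1, h3.2]
      have e2 : |divergence L'| ≤ 3 * ‖L'‖ := abs_divergence_le L'
      rw [mul_one] at e1
      rw [mul_one, mul_one]
      refine (abs_add_le _ _).trans ?_
      rw [abs_mul, abs_mul, abs_of_nonneg hμ, abs_of_nonneg hη]
      nlinarith [mul_le_mul_of_nonneg_left e1 hμ, mul_le_mul_of_nonneg_left e2 hη]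
    · have e1 : |jacobian L' i j + jacobian L' j i| ≤ 4 * ‖L'‖ := by
        rw [abs_le]
        constructor <;> linarith [h1.1, h1.2, h2.1, h2.2, norm_nonneg L']
      rw [mul_zero, mul_zero, sub_zero, add_zero, abs_mul, abs_of_nonneg hμ]
      nlinarith [mul_le_mul_of_nonneg_left e1 hμ, mul_nonneg hη (norm_nonneg L')]
  rw [viscousForm_eq_sum]
  calc _ ≤ ∑ i : Fin 3, ∑ j : Fin 3, (4 * μ + 3 * η) * (‖L'‖ * ‖L‖) :=
        (Finset.abs_sum_le_sum_abs _ _).trans (Finset.sum_le_sum fun i _ =>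
          (Finset.abs_sum_le_sum_abs _ _).trans (Finset.sum_le_sum fun j _ => hent i j))
    _ = _ := by
        simp
        ring

theorem viscousForm_self (μ η : ℝ) (L : R3 →L[ℝ] R3) :
    viscousForm μ η L L = μ * (∑ i, ∑ j, jacobian L i j ^ 2)
      + μ * (∑ i, ∑ j, jacobian L i j * jacobian L j i)
      + (η - 2 / 3 * μ) * divergence L ^ 2 := by
  simp only [viscousForm_eq_sum, divergence, Matrix.trace, Matrix.diag, Fin.sum_univ_three]
  simp
  ring

theorem sq_norm_le_sum (L : R3 →L[ℝ] R3) : ‖L‖ ^ 2 ≤ ∑ i, ∑ j, jacobian L i j ^ 2 := by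
  have h0 : 0 ≤ ∑ i, ∑ j, jacobian L i j ^ 2 :=
    Finset.sum_nonneg fun i _ => Finset.sum_nonneg fun j _ => sq_nonneg _
  have h1 : ‖L‖ ≤ √(∑ i, ∑ j, jacobian L i j ^ 2) := by
    refine L.opNorm_le_bound (Real.sqrt_nonneg _) fun v => ?_
    rw [EuclideanSpace.norm_eq, EuclideanSpace.norm_eq, ← Real.sqrt_mul h0]
    refine Real.sqrt_le_sqrt ?_
    rw [Finset.sum_mul]
    refine Finset.sum_le_sum fun i _ => ?_
    have h2 : L v i = ∑ j, jacobian L i j * v j := by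
      rw [apply_eq_sum L v]
      simp [jacobian_apply, Finset.sum_apply, mul_comm]
    simp only [Real.norm_eq_abs, sq_abs]
    rw [h2]
    exact Finset.sum_mul_sq_le_sq_mul_sq _ _ _
  calc ‖L‖ ^ 2 ≤ √(∑ i, ∑ j, jacobian L i j ^ 2) ^ 2 := by gcongr
    _ = _ := Real.sq_sqrt h0

theorem integral_fderiv_mul_fderiv_swap {a b : R3 → ℝ} (ha : ContDiff ℝ 1 a)
    (hb : ContDiff ℝ 2 b) (hbs : HasCompactSupport b) (v w : R3) :
    ∫ x, fderiv ℝ a x v * fderiv ℝ b x w = ∫ x, fderiv ℝ a x w * fderiv ℝ b x v := by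
  have hb' : ContDiff ℝ 1 (fderiv ℝ b) := hb.fderiv_right (by norm_num)
  have hd : ∀ v, ContDiff ℝ 1 fun x => fderiv ℝ b x v := fun v => hb'.clm_apply contDiff_const
  rw [integral_mul_fderiv_of_hasCompactSupport ha (hd w) (hasCompactSupport_fderiv_apply hbs w) v,
    integral_mul_fderiv_of_hasCompactSupport ha (hd v) (hasCompactSupport_fderiv_apply hbs v) w]
  congr 1
  refine integral_congr_ae (Eventually.of_forall fun x => ?_)
  have h2 : ∀ v w, fderiv ℝ (fun x => fderiv ℝ b x v) x w = fderiv ℝ (fderiv ℝ b) x w v := by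
    intro v w
    have := ((hb'.differentiable one_ne_zero x).hasFDerivAt.clm_apply
      (hasFDerivAt_const v x)).fderiv
    rw [this]
    simp
  simp only [h2]
  have hsym : IsSymmSndFDerivAt ℝ b x :=
    hb.contDiffAt.isSymmSndFDerivAt (by simp [minSmoothness_of_isRCLikeNormedField])
  rw [hsym.eq]

/-- Korn's identity for test functions: `∫ ∇φ : ∇ᵗφ = ∫ (div φ)²`, by two integrations by parts. -/
theorem integral_sum_jacobian_mul_swap {φ : R3 → R3} (hφ : ContDiff ℝ 2 φ)
    (hφs : HasCompactSupport φ) :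
    ∫ x, ∑ i, ∑ j, jacobian (fderiv ℝ φ x) i j * jacobian (fderiv ℝ φ x) j i
      = ∫ x, divergence (fderiv ℝ φ x) ^ 2 := by
  have hφ1 : ContDiff ℝ 1 φ := hφ.of_le (by norm_num)
  have hc := hφ.continuous_fderiv (by norm_num)
  have hj : ∀ i j, Continuous fun x => jacobian (fderiv ℝ φ x) i j := fun i j =>
    (continuous_jacobian_apply i j).comp hc
  have hjs : ∀ i j, HasCompactSupport fun x => jacobian (fderiv ℝ φ x) i j := fun i j =>
    (hφs.fderiv ℝ).comp_left (g := fun L => jacobian L i j) (by simp [jacobian_apply])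
  have hint : ∀ i j k l, Integrable fun x =>
      jacobian (fderiv ℝ φ x) i j * jacobian (fderiv ℝ φ x) k l := fun i j k l =>
    ((hj i j).mul (hj k l)).integrable_of_hasCompactSupport (hjs k l).mul_left
  have hje : ∀ i j x, jacobian (fderiv ℝ φ x) i j
      = fderiv ℝ (fun x => φ x i) x (EuclideanSpace.single j 1) := fun i j x => by
    rw [fderiv_apply_coord (hφ1.differentiable one_ne_zero), jacobian_apply]
  have hsq : ∀ x, divergence (fderiv ℝ φ x) ^ 2
      = ∑ i, ∑ j, jacobian (fderiv ℝ φ x) i i * jacobian (fderiv ℝ φ x) j j := fun x => by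
    rw [sq, divergence_eq_sum, Finset.sum_mul_sum]
    rfl
  simp_rw [hsq]
  rw [integral_finsetSum _ fun i _ => integrable_finsetSum _ fun j _ => hint i j j i,
    integral_finsetSum _ fun i _ => integrable_finsetSum _ fun j _ => hint i i j j]
  refine Finset.sum_congr rfl fun i _ => ?_
  rw [integral_finsetSum _ fun j _ => hint i j j i, integral_finsetSum _ fun j _ => hint i i j j]
  refine Finset.sum_congr rfl fun j _ => ?_
  simp_rw [hje]
  exact integral_fderiv_mul_fderiv_swap (contDiff_coord hφ1 i) (contDiff_coord hφ j)
    (hasCompactSupport_coord hφs j) _ _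

/-- The viscous dissipation controls the full gradient of a test function: it equals
`μ ∫ |∇φ|² + (η + μ/3) ∫ (div φ)²`. -/
theorem mul_integral_sq_norm_fderiv_le {μ η : ℝ} (hμ : 0 ≤ μ) (hη : 0 ≤ η) {φ : R3 → R3}
    (hφ : ContDiff ℝ 2 φ) (hφs : HasCompactSupport φ) :
    μ * ∫ x, ‖fderiv ℝ φ x‖ ^ 2 ≤ ∫ x, viscousForm μ η (fderiv ℝ φ x) (fderiv ℝ φ x) := by
  have hc := hφ.continuous_fderiv (by norm_num)
  have hj : ∀ i j, Continuous fun x => jacobian (fderiv ℝ φ x) i j := fun i j =>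
    (continuous_jacobian_apply i j).comp hc
  have hdc : Continuous fun x => divergence (fderiv ℝ φ x) := continuous_divergence.comp hc
  have hcs : ∀ {g : (R3 →L[ℝ] R3) → ℝ}, g 0 = 0 → Continuous (fun x => g (fderiv ℝ φ x)) →
      Integrable fun x => g (fderiv ℝ φ x) := fun {g} h0 hg =>
    hg.integrable_of_hasCompactSupport ((hφs.fderiv ℝ).comp_left (g := g) h0)
  have hd0 : divergence 0 = 0 := by simp [divergence_eq_sum]
  have hj0 : ∀ i j, jacobian (0 : R3 →L[ℝ] R3) i j = 0 := fun i j => by simp [jacobian_apply]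
  have i1 : Integrable fun x => ∑ i, ∑ j, jacobian (fderiv ℝ φ x) i j ^ 2 :=
    hcs (g := fun L => ∑ i, ∑ j, jacobian L i j ^ 2) (by simp [hj0]) (by fun_prop)
  have i2 : Integrable fun x => ∑ i, ∑ j, jacobian (fderiv ℝ φ x) i j * jacobian (fderiv ℝ φ x) j i :=
    hcs (g := fun L => ∑ i, ∑ j, jacobian L i j * jacobian L j i) (by simp [hj0]) (by fun_prop)
  have i3 : Integrable fun x => divergence (fderiv ℝ φ x) ^ 2 :=
    hcs (g := fun L => divergence L ^ 2) (by simp [hd0]) (by fun_prop)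
  have i4 : Integrable fun x => ‖fderiv ℝ φ x‖ ^ 2 :=
    hcs (g := fun L => ‖L‖ ^ 2) (by simp) (by fun_prop)
  have i12 : Integrable fun x => μ * (∑ i, ∑ j, jacobian (fderiv ℝ φ x) i j ^ 2)
      + μ * (∑ i, ∑ j, jacobian (fderiv ℝ φ x) i j * jacobian (fderiv ℝ φ x) j i) :=
    (i1.const_mul μ).add (i2.const_mul μ)
  simp_rw [viscousForm_self]
  rw [integral_add i12 (i3.const_mul _), integral_add (i1.const_mul μ) (i2.const_mul μ),
    integral_const_mul, integral_const_mul, integral_const_mul,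
    integral_sum_jacobian_mul_swap hφ hφs]
  have h1 : ∫ x, ‖fderiv ℝ φ x‖ ^ 2 ≤ ∫ x, ∑ i, ∑ j, jacobian (fderiv ℝ φ x) i j ^ 2 :=
    integral_mono i4 i1 fun x => sq_norm_le_sum _
  have h2 : 0 ≤ ∫ x, divergence (fderiv ℝ φ x) ^ 2 := integral_nonneg fun x => sq_nonneg _
  nlinarith [mul_le_mul_of_nonneg_left h1 hμ, mul_nonneg hμ h2, mul_nonneg hη h2]

/-! ### The convective term and the pressure do no work -/

theorem integrable_of_abs_le_mul {α A E : Type*} [MeasurableSpace α] {ν : Measure α}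
    [NormedAddCommGroup A] [NormedAddCommGroup E] {p q : ℝ≥0∞} [ENNReal.HolderTriple p q 1]
    {a : α → A} {b : α → E} (ha : MemLp a p ν) (hb : MemLp b q ν) {X : α → ℝ}
    (hX : AEStronglyMeasurable X ν) (C : ℝ) (hle : ∀ᵐ x ∂ν, |X x| ≤ C * (‖a x‖ * ‖b x‖)) :
    Integrable X ν :=
  ((MemLp.integrable_mul ha.norm hb.norm).const_mul C).mono' hX hle

/-- The data that the approximation of the velocity provides: `u` is in `L⁶`, `Du` in `L²`, and
test functions `φ n` converge to `u` in these norms. -/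
structure IsVelocityApprox (Ω : Set R3) (u : R3 → R3) (Du : R3 → R3 →L[ℝ] R3)
    (φ : ℕ → R3 → R3) : Prop where
  isTestFunction : ∀ n, IsTestFunction ⊤ Ω (φ n)
  memLp_six : MemLp u 6 (volume.restrict Ω)
  memLp_deriv : MemLp Du 2 (volume.restrict Ω)
  tendsto_deriv :
    Tendsto (fun n => eLpNorm (fun x => fderiv ℝ (φ n) x - Du x) 2 (volume.restrict Ω)) atTop (𝓝 0)
  tendsto_six : Tendsto (fun n => eLpNorm (fun x => φ n x - u x) 6 (volume.restrict Ω)) atTop (𝓝 0)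

section
variable {Ω : Set R3} {u : R3 → R3} {Du : R3 → R3 →L[ℝ] R3} {φ : ℕ → R3 → R3} {ρ : R3 → ℝ}
  {DG : R3 → R3 →L[ℝ] ℝ}

/-- The convective term does no work: in the limit it is tested with `∇(|φₙ|²)/2`. -/
theorem IsVelocityApprox.tendsto_convective (h : IsVelocityApprox Ω u Du φ)
    (h1 : MemLp ρ 1 (volume.restrict Ω)) (ht : MemLp ρ ∞ (volume.restrict Ω))
    (hcont : ∀ ψ : R3 → ℝ, IsTestFunction ⊤ univ ψ → ∫ x in Ω, ρ x * fderiv ℝ ψ x (u x) = 0) :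
    (∀ n, Integrable (fun x => ρ x * inner ℝ (u x) (fderiv ℝ (φ n) x (u x)))
      (volume.restrict Ω)) ∧
    Tendsto (fun n => ∫ x in Ω, ρ x * inner ℝ (u x) (fderiv ℝ (φ n) x (u x))) atTop (𝓝 0) := by
  set ν := volume.restrict Ω with hν
  have hum := h.memLp_six.1
  have hρm := h1.1
  have hφm : ∀ n, AEStronglyMeasurable (φ n) ν := fun n =>
    (h.isTestFunction n).1.continuous.aestronglyMeasurable
  have hφ6 : ∀ n, MemLp (φ n) 6 ν := fun n => (h.isTestFunction n).memLp 6 ν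
  have hD2 : ∀ n, MemLp (fderiv ℝ (φ n)) 2 ν := fun n => (h.isTestFunction n).memLp_fderiv 2 ν
  have happ : ∀ {L : R3 → R3 →L[ℝ] R3}, AEStronglyMeasurable L ν →
      AEStronglyMeasurable (fun x => L x (u x)) ν := fun hL =>
    isBoundedBilinearMap_apply.continuous.comp_aestronglyMeasurable (hL.prodMk hum)
  have t362 : ENNReal.HolderTriple 3 6 2 :=
    holderTriple_of_toReal (by simp) (by simp) (by simp) (by norm_num)
  have t32 : ENNReal.HolderTriple 3 2 (6 / 5) :=
    holderTriple_of_toReal (by simp) (by simp) (by simp) (by norm_num)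
  have t65 : ENNReal.HolderTriple (6 / 5) 6 1 :=
    holderTriple_of_toReal (by simp) (by simp) (by simp) (by norm_num)
  have hρu3 : MemLp (fun x => ρ x * ‖u x‖) 3 ν :=
    memLp_mul_norm_of_le h1 ht h.memLp_six (by norm_num) (by norm_num)
  have hρuu : MemLp (fun x => (ρ x * ‖u x‖) * ‖u x‖) 2 ν := h.memLp_six.norm.mul hρu3
  have hZle : ∀ L : R3 →L[ℝ] R3, ∀ x, |ρ x * inner ℝ (u x) (L (u x))|
      ≤ 1 * (|(ρ x * ‖u x‖) * ‖u x‖| * ‖L‖) := by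
    intro L x
    rw [abs_mul, abs_mul, abs_mul, abs_norm]
    calc |ρ x| * |inner ℝ (u x) (L (u x))| ≤ |ρ x| * (‖u x‖ * (‖L‖ * ‖u x‖)) := by
          gcongr
          refine (abs_real_inner_le_norm _ _).trans ?_
          gcongr
          exact L.le_opNorm _
      _ = _ := by ring
  have hZm : ∀ {L : R3 → R3 →L[ℝ] R3}, AEStronglyMeasurable L ν →
      AEStronglyMeasurable (fun x => ρ x * inner ℝ (u x) (L x (u x))) ν := fun hL =>
    hρm.mul (hum.inner (happ hL))
  have hZi : ∀ {L : R3 → R3 →L[ℝ] R3}, MemLp L 2 ν →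
      Integrable (fun x => ρ x * inner ℝ (u x) (L x (u x))) ν := fun {L} hL =>
    integrable_of_abs_le_mul (p := 2) (q := 2) hρuu hL (hZm hL.1) 1
      (Eventually.of_forall fun x => hZle (L x) x)
  refine ⟨fun n => hZi (hD2 n), ?_⟩
  -- `∫ ρ ⟨φₙ, Dφₙ u⟩ = 0`, and it remains to exchange `φₙ` and `u`.
  have hX : ∀ n, ∫ x, ρ x * inner ℝ (φ n x) (fderiv ℝ (φ n) x (u x)) ∂ν = 0 := by
    intro n
    have hφ := h.isTestFunction n
    have hψ : IsTestFunction ⊤ univ fun x => ‖φ n x‖ ^ 2 := by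
      refine ⟨hφ.1.norm_sq ℝ, hφ.2.comp_left (g := fun y => ‖y‖ ^ 2) (by simp), subset_univ _⟩
    have h2 := hcont _ hψ
    have h3 : ∀ x, ρ x * fderiv ℝ (fun x => ‖φ n x‖ ^ 2) x (u x)
        = 2 * (ρ x * inner ℝ (φ n x) (fderiv ℝ (φ n) x (u x))) := fun x => by
      rw [((hφ.1.differentiable (by simp) x).hasFDerivAt.norm_sq).fderiv]
      simp
      ring
    simp_rw [h3, integral_const_mul] at h2
    simpa using h2
  have hdi : ∀ n, Integrable (fun x => ρ x * inner ℝ (u x - φ n x) (fderiv ℝ (φ n) x (u x))) ν ∧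
      ∀ x, |ρ x * inner ℝ (u x - φ n x) (fderiv ℝ (φ n) x (u x)) - 0|
        ≤ 1 * (|(ρ x * ‖u x‖) * ‖fderiv ℝ (φ n) x‖| * ‖φ n x - u x‖) := by
    intro n
    have hle : ∀ x, |ρ x * inner ℝ (u x - φ n x) (fderiv ℝ (φ n) x (u x))|
        ≤ 1 * (|(ρ x * ‖u x‖) * ‖fderiv ℝ (φ n) x‖| * ‖φ n x - u x‖) := by
      intro x
      rw [abs_mul, abs_mul, abs_mul, abs_norm, abs_norm, norm_sub_rev (φ n x)]
      calc |ρ x| * |inner ℝ (u x - φ n x) (fderiv ℝ (φ n) x (u x))|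
          ≤ |ρ x| * (‖u x - φ n x‖ * (‖fderiv ℝ (φ n) x‖ * ‖u x‖)) := by
            gcongr
            refine (abs_real_inner_le_norm _ _).trans ?_
            gcongr
            exact (fderiv ℝ (φ n) x).le_opNorm _
        _ = _ := by ring
    simp_rw [sub_zero]
    refine ⟨integrable_of_abs_le_mul (p := 6 / 5) (q := 6)
      (a := fun x => (ρ x * ‖u x‖) * ‖fderiv ℝ (φ n) x‖) ((hD2 n).norm.mul hρu3)
      ((hφ6 n).sub h.memLp_six) ?_ 1 (Eventually.of_forall hle), hle⟩
    exact hρm.mul ((hum.sub (hφm n)).inner (happ (hD2 n).1))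
  have hlim : Tendsto (fun n => ∫ x, ρ x * inner ℝ (u x - φ n x) (fderiv ℝ (φ n) x (u x)) ∂ν) atTop
      (𝓝 (∫ x, (0 : ℝ) ∂ν)) := by
    refine tendsto_integral_of_norm_sub_le_mul (p := 6 / 5) (q := 6)
      (N := eLpNorm (fun x => ρ x * ‖u x‖) 3 ν * (eLpNorm Du 2 ν + 1))
      (a := fun n x => (ρ x * ‖u x‖) * ‖fderiv ℝ (φ n) x‖) ?_ (fun n => hρu3.1.mul (hD2 n).1.norm)
      ?_ (fun n => (hφm n).sub hum) h.tendsto_six (fun n => (hdi n).1) aestronglyMeasurable_const 1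
      fun n => Eventually.of_forall (hdi n).2
    · exact ENNReal.mul_ne_top hρu3.2.ne (ENNReal.add_ne_top.2 ⟨h.memLp_deriv.2.ne, by simp⟩)
    · filter_upwards [eventually_eLpNorm_le_add_one (by norm_num) (fun n => (hD2 n).1)
        h.memLp_deriv.1 h.tendsto_deriv] with n hn
      refine (eLpNorm_smul_le_mul_eLpNorm (hD2 n).1.norm hρu3.1 (p := 3) (q := 2)).trans ?_
      rw [eLpNorm_norm]
      gcongr
  rw [integral_zero] at hlim
  refine hlim.congr fun n => ?_
  rw [← sub_zero (∫ x, ρ x * inner ℝ (u x) (fderiv ℝ (φ n) x (u x)) ∂ν), ← hX n,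
    ← integral_sub (hZi (hD2 n))]
  · refine integral_congr_ae (Eventually.of_forall fun x => ?_)
    simp only [inner_sub_left]
    ring
  · have := (hZi (hD2 n)).sub (hdi n).1
    refine this.congr (Eventually.of_forall fun x => ?_)
    simp only [Pi.sub_apply, inner_sub_left]
    ring

theorem exists_abs_le_mul_sqrt {p : ℝ → ℝ} (hp_cont : ContinuousOn p (Ici 0))
    (hp_nonneg : ∀ s, 0 ≤ s → 0 ≤ p s) (hp_sqrt : ∃ C : ℝ, ∀ s, 0 ≤ s → s < 1 → p s ≤ C * √s)
    (M : ℝ) : ∃ C : ℝ, ∀ s ∈ Icc 0 M, |p s| ≤ C * √s := by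
  obtain ⟨C, hC⟩ := hp_sqrt
  obtain ⟨Q, hQ⟩ := (isCompact_Icc (a := (0 : ℝ)) (b := M)).exists_bound_of_continuousOn
    (hp_cont.mono fun s hs => hs.1)
  refine ⟨max C Q, fun s hs => ?_⟩
  rcases lt_or_ge s 1 with h1 | h1
  · rw [abs_of_nonneg (hp_nonneg s hs.1)]
    exact (hC s hs.1 h1).trans (mul_le_mul_of_nonneg_right (le_max_left _ _) (Real.sqrt_nonneg _))
  · have hs1 : 1 ≤ √s := Real.one_le_sqrt.2 h1
    have h2 := hQ s hs
    have h3 : 0 ≤ Q := (norm_nonneg _).trans h2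
    rw [Real.norm_eq_abs] at h2
    calc |p s| ≤ Q * 1 := by linarith
      _ ≤ max C Q * √s := mul_le_mul (le_max_right _ _) hs1 zero_le_one (h3.trans (le_max_right _ _))

/-- The growth `p(s) ≤ C √s` makes the pressure square integrable. -/
theorem memLp_two_pressure {α : Type*} [MeasurableSpace α] {ν : Measure α} {ρ : α → ℝ} {M : ℝ}
    (hρ : Integrable ρ ν) (h0 : ∀ᵐ x ∂ν, ρ x ∈ Icc 0 M) {p : ℝ → ℝ}
    (hp_cont : ContinuousOn p (Ici 0)) {C : ℝ} (hC : ∀ s ∈ Icc 0 M, |p s| ≤ C * √s) :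
    MemLp (fun x => p (ρ x)) 2 ν := by
  have hpc : Continuous fun t : ℝ => p (max t 0) :=
    hp_cont.comp_continuous (by fun_prop) fun t => mem_Ici.2 (le_max_right _ _)
  have hm : AEStronglyMeasurable (fun x => p (ρ x)) ν := by
    refine (hpc.comp_aestronglyMeasurable hρ.1).congr ?_
    filter_upwards [h0] with x hx
    rw [max_eq_left hx.1]
  rw [memLp_two_iff_integrable_sq hm]
  refine (hρ.const_mul (C ^ 2)).mono' (hm.pow 2) ?_
  filter_upwards [h0] with x hx
  have h1 := hC _ hx
  rw [norm_pow, Real.norm_eq_abs]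
  calc |p (ρ x)| ^ 2 ≤ (C * √(ρ x)) ^ 2 := by gcongr
    _ = C ^ 2 * ρ x := by rw [mul_pow, Real.sq_sqrt hx.1]

theorem memLp_indicator_of_restrict {E : Type*} [NormedAddCommGroup E] {Ω : Set R3}
    (hΩm : MeasurableSet Ω) {f : R3 → E} {q : ℝ≥0∞} (h : MemLp f q (volume.restrict Ω)) :
    MemLp (Ω.indicator f) q volume :=
  (memLp_indicator_iff_restrict hΩm).2 h

theorem eLpNorm_sub_indicator_eq_restrict {E : Type*} [NormedAddCommGroup E] {Ω : Set R3}
    (hΩm : MeasurableSet Ω) {f g : R3 → E} {q : ℝ≥0∞} (hg : ∀ x ∉ Ω, g x = 0) :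
    eLpNorm (fun x => g x - Ω.indicator f x) q volume
      = eLpNorm (fun x => g x - f x) q (volume.restrict Ω) := by
  rw [← eLpNorm_indicator_eq_eLpNorm_restrict hΩm]
  congr 1
  ext1 x
  by_cases hx : x ∈ Ω
  · simp [hx]
  · simp [hx, hg x hx]

theorem IsVelocityApprox.integral_pressure_eq_zero (h : IsVelocityApprox Ω u Du φ)
    (hΩ : IsOpen Ω) (h1 : MemLp ρ 1 (volume.restrict Ω)) (ht : MemLp ρ ∞ (volume.restrict Ω))
    (hρ0 : ∀ᵐ x ∂(volume.restrict Ω), 0 ≤ ρ x)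
    (hcont : ∀ ψ : R3 → ℝ, IsTestFunction ⊤ univ ψ → ∫ x in Ω, ρ x * fderiv ℝ ψ x (u x) = 0)
    {p : ℝ → ℝ} (hp_cont : ContinuousOn p (Ici 0)) (hp_zero : p 0 = 0)
    (hp_nonneg : ∀ s, 0 ≤ s → 0 ≤ p s) (hp_sqrt : ∃ C : ℝ, ∀ s, 0 ≤ s → s < 1 → p s ≤ C * √s) :
    MemLp (fun x => p (ρ x)) 2 (volume.restrict Ω) ∧
      ∫ x in Ω, p (ρ x) * divergence (Du x) = 0 := by
  set ν := volume.restrict Ω with hν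
  have hΩm := hΩ.measurableSet
  obtain ⟨M, hM0, hM⟩ := exists_ae_norm_le_of_memLp_top ht
  have hρI : ∀ᵐ x ∂ν, ρ x ∈ Icc 0 M := by
    filter_upwards [hρ0, hM] with x hx hx'
    exact ⟨hx, (le_abs_self _).trans hx'⟩
  have hρi : Integrable ρ ν := memLp_one_iff_integrable.1 h1
  obtain ⟨C, hC⟩ := exists_abs_le_mul_sqrt hp_cont hp_nonneg hp_sqrt M
  refine ⟨memLp_two_pressure hρi hρI hp_cont hC, ?_⟩
  -- A representative of the density, extended by zero, for which the bounds hold everywhere.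
  set r₀ : R3 → ℝ := fun x => max 0 (min M (h1.1.mk ρ x)) with hr₀
  have hr₀ρ : r₀ =ᵐ[ν] ρ := by
    filter_upwards [hρI, h1.1.ae_eq_mk] with x hx hx'
    simp only [hr₀]
    rw [← hx', min_eq_right hx.2, max_eq_right hx.1]
  have hr₀m : Measurable r₀ :=
    measurable_const.max (measurable_const.min h1.1.stronglyMeasurable_mk.measurable)
  set r : R3 → ℝ := Ω.indicator r₀ with hr
  have hrd : IsBoundedDensity M r := by
    refine ⟨hr₀m.indicator hΩm, fun x => ?_, fun x => ?_, ?_⟩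
    · exact indicator_nonneg (fun x _ => le_max_left _ _) x
    · exact indicator_apply_le' (fun _ => max_le hM0 (min_le_left _ _)) fun _ => hM0
    · exact (integrable_indicator_iff hΩm).2 (hρi.congr hr₀ρ.symm)
  have t65 : ENNReal.HolderTriple (6 / 5) 6 1 :=
    holderTriple_of_toReal (by simp) (by simp) (by simp) (by norm_num)
  have hρ65 : MemLp ρ (6 / 5) ν := memLp_of_one_of_top h1 ht (by
    rw [ENNReal.le_div_iff_mul_le (by simp) (by simp)]
    norm_num)
  have hDφ0 : ∀ n x, x ∉ Ω → fderiv ℝ (φ n) x = 0 := fun n x hx =>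
    (h.isTestFunction n).fderiv_eq_zero_of_notMem hx
  have hmain := integral_pressure_mul_divergence_eq_zero hrd (U := u) (DU := Ω.indicator Du)
    (φ := φ) (p := p) ?_ ?_ (memLp_indicator_of_restrict hΩm h.memLp_deriv)
    (fun n => (h.isTestFunction n).mono) ?_ ?_ hp_cont hp_zero
    (memLp_two_pressure hrd.integrable
      (Eventually.of_forall fun x => ⟨hrd.nonneg x, hrd.le x⟩) hp_cont hC)
  · rw [← hmain, ← integral_indicator hΩm]
    have hae : (Ω.indicator fun x => p (ρ x) * divergence (Du x))
        =ᵐ[volume] Ω.indicator fun x => p (r₀ x) * divergence (Du x) := by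
      refine (ae_eq_restrict_iff_indicator_ae_eq hΩm).1 ?_
      filter_upwards [hr₀ρ] with x hx
      rw [hx]
    refine integral_congr_ae (hae.trans (Eventually.of_forall fun x => ?_))
    by_cases hx : x ∈ Ω <;> simp [hr, hx, hp_zero]
  · have hi : Integrable (fun x => ρ x • u x) ν :=
      memLp_one_iff_integrable.1 (h.memLp_six.smul hρ65)
    have h2 : Integrable (Ω.indicator fun x => r₀ x • u x) := by
      refine (integrable_indicator_iff hΩm).2 (hi.congr ?_)
      filter_upwards [hr₀ρ] with x hx
      rw [hx]
    refine h2.congr (Eventually.of_forall fun x => ?_)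
    by_cases hx : x ∈ Ω <;> simp [hr, hx]
  · intro ψ hψ
    rw [← hcont ψ hψ]
    have h2 : ∀ x, r x * fderiv ℝ ψ x (u x)
        = Ω.indicator (fun x => r₀ x * fderiv ℝ ψ x (u x)) x := fun x => by
      by_cases hx : x ∈ Ω <;> simp [hr, hx]
    simp_rw [h2]
    rw [integral_indicator hΩm]
    refine integral_congr_ae ?_
    filter_upwards [hr₀ρ] with x hx
    rw [hx]
  · have h2 : ∀ n, ∫⁻ y, ‖r y • (φ n y - u y)‖ₑ ≤
        eLpNorm ρ (6 / 5) ν * eLpNorm (fun x => φ n x - u x) 6 ν := by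
      intro n
      have h3 : ∀ x, ‖r x • (φ n x - u x)‖ₑ
          = Ω.indicator (fun x => ‖r₀ x • (φ n x - u x)‖ₑ) x := fun x => by
        by_cases hx : x ∈ Ω <;> simp [hr, hx]
      simp_rw [h3]
      rw [lintegral_indicator hΩm]
      calc ∫⁻ x in Ω, ‖r₀ x • (φ n x - u x)‖ₑ = eLpNorm (ρ • fun x => φ n x - u x) 1 ν := by
            rw [eLpNorm_one_eq_lintegral_enorm]
            refine lintegral_congr_ae ?_
            filter_upwards [hr₀ρ] with x hx
            simp [hx]
        _ ≤ _ := eLpNorm_smul_le_mul_eLpNorm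
            (((h.isTestFunction n).memLp 6 ν).1.sub h.memLp_six.1) h1.1
    refine tendsto_of_tendsto_of_tendsto_of_le_of_le tendsto_const_nhds ?_ (fun _ => zero_le) h2
    simpa using ENNReal.Tendsto.const_mul h.tendsto_six (Or.inr hρ65.2.ne)
  · refine h.tendsto_deriv.congr fun n => ?_
    exact (eLpNorm_sub_indicator_eq_restrict hΩm fun x => hDφ0 n x).symm

/-! ### The potential does no work -/

theorem aestronglyMeasurable_apply {α F : Type*} [MeasurableSpace α] {ν : Measure α}
    [NormedAddCommGroup F] [NormedSpace ℝ F] {L : α → R3 →L[ℝ] F} {v : α → R3}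
    (hL : AEStronglyMeasurable L ν) (hv : AEStronglyMeasurable v ν) :
    AEStronglyMeasurable (fun x => L x (v x)) ν :=
  isBoundedBilinearMap_apply.continuous.comp_aestronglyMeasurable (hL.prodMk hv)

theorem aestronglyMeasurable_comp_prodMk {α E F : Type*} [MeasurableSpace α] {ν : Measure α}
    [TopologicalSpace E] [TopologicalSpace F] {g : E × F → ℝ} (hg : Continuous g) {a : α → E}
    {b : α → F} (ha : AEStronglyMeasurable a ν) (hb : AEStronglyMeasurable b ν) :
    AEStronglyMeasurable (fun x => g (a x, b x)) ν :=
  hg.comp_aestronglyMeasurable (ha.prodMk hb)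

/-- A potential in `D_0^{1,q}` does no work on a divergence-free momentum `ρ u`: this is clear for
test functions, and `ρ u` lies in the dual space of `L^q` because `q ≥ 6/5`. -/
theorem MemD0ModConst.integral_potential_eq_zero {q : ℝ≥0∞} {G : R3 → ℝ}
    (hG : MemD0ModConst q Ω G DG) (hq : 6 / 5 ≤ q)
    (h1 : MemLp ρ 1 (volume.restrict Ω)) (ht : MemLp ρ ∞ (volume.restrict Ω))
    (hu : MemLp u 6 (volume.restrict Ω))
    (hcont : ∀ ψ : R3 → ℝ, IsTestFunction ⊤ univ ψ → ∫ x in Ω, ρ x * fderiv ℝ ψ x (u x) = 0) :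
    ∫ x in Ω, ρ x * DG x (u x) = 0 := by
  set ν := volume.restrict Ω with hν
  obtain ⟨ψ, hψ, hψD⟩ := hG.exists_approx
  have h65 : (1 : ℝ≥0∞) ≤ 6 / 5 := by
    rw [ENNReal.le_div_iff_mul_le (by simp) (by simp)]
    norm_num
  have hqi : q⁻¹ ≤ 1 := ENNReal.inv_le_one.2 (h65.trans hq)
  set q' : ℝ≥0∞ := (1 - q⁻¹)⁻¹ with hq'
  have hT : ENNReal.HolderTriple q' q 1 := ⟨by
    rw [hq', inv_inv, tsub_add_cancel_of_le hqi, inv_one]⟩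
  have hq'1 : 1 ≤ q' := by
    rw [hq', ENNReal.one_le_inv]
    exact tsub_le_self
  have hq'6 : q' ≤ 6 := by
    rw [hq', ENNReal.inv_le_iff_inv_le]
    have h2 : q⁻¹ ≤ 5 / 6 := by
      rw [ENNReal.inv_le_iff_inv_le, ENNReal.inv_div (by simp) (by simp)]
      exact hq
    refine le_trans (le_of_eq ?_) (tsub_le_tsub_left h2 1)
    rw [← ENNReal.toReal_eq_toReal_iff' (by simp) (by simp),
      ENNReal.toReal_sub_of_le (by
        rw [ENNReal.div_le_iff (by simp) (by simp)]; norm_num) (by simp)]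
    simp
    norm_num
  have hρu := memLp_mul_norm_of_le h1 ht hu hq'1 hq'6
  have hψm : ∀ n, MemLp (fderiv ℝ (ψ n)) q ν := fun n => (hψ n).memLp_fderiv q ν
  have hle : ∀ L : R3 →L[ℝ] ℝ, ∀ x, |ρ x * L (u x)| ≤ 1 * (|ρ x * ‖u x‖| * ‖L‖) := by
    intro L x
    rw [abs_mul, abs_mul, abs_norm]
    calc |ρ x| * |L (u x)| ≤ |ρ x| * (‖L‖ * ‖u x‖) := by
          gcongr
          exact L.le_opNorm _
      _ = _ := by ring
  have hlim : Tendsto (fun n => ∫ x, ρ x * fderiv ℝ (ψ n) x (u x) ∂ν) atTop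
      (𝓝 (∫ x, ρ x * DG x (u x) ∂ν)) := by
    refine tendsto_integral_of_norm_sub_le_mul_const (p := q') (q := q) hρu
      (β := fun n x => fderiv ℝ (ψ n) x - DG x)
      (fun n => (hψm n).1.sub hG.memLp_deriv.1) hψD (fun n => ?_)
      (h1.1.mul (aestronglyMeasurable_apply hG.memLp_deriv.1 hu.1)) 1
      fun n => Eventually.of_forall fun x => ?_
    · exact integrable_of_abs_le_mul (p := q') (q := q) hρu (hψm n)
        (h1.1.mul (aestronglyMeasurable_apply (hψm n).1 hu.1)) 1
        (Eventually.of_forall fun x => hle _ x)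
    · rw [← mul_sub, ← sub_apply]
      exact hle _ x
  refine tendsto_nhds_unique hlim ?_
  simp_rw [fun n => hcont _ (hψ n).mono]
  exact tendsto_const_nhds

/-- The force, tested with the approximations of the velocity, does no work in the limit. -/
theorem IsVelocityApprox.tendsto_force (h : IsVelocityApprox Ω u Du φ)
    (h1 : MemLp ρ 1 (volume.restrict Ω)) (ht : MemLp ρ ∞ (volume.restrict Ω)) {q : ℝ≥0∞}
    (hq : 6 / 5 ≤ q) (hG : MemLp DG q (volume.restrict Ω))
    (h0 : ∫ x in Ω, ρ x * DG x (u x) = 0) :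
    Tendsto (fun n => ∫ x in Ω, ρ x * DG x (φ n x)) atTop (𝓝 0) := by
  have h65 : (1 : ℝ≥0∞) ≤ 6 / 5 := by
    rw [ENNReal.le_div_iff_mul_le (by simp) (by simp)]
    norm_num
  have t65 : ENNReal.HolderTriple (6 / 5) 6 1 :=
    holderTriple_of_toReal (by simp) (by simp) (by simp) (by norm_num)
  have hρG := memLp_mul_norm_of_le h1 ht hG h65 hq
  have hφ6 : ∀ n, MemLp (φ n) 6 (volume.restrict Ω) := fun n => (h.isTestFunction n).memLp 6 _
  have hle : ∀ v x, |ρ x * DG x v| ≤ 1 * (|ρ x * ‖DG x‖| * ‖v‖) := by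
    intro v x
    rw [abs_mul, abs_mul, abs_norm, one_mul, mul_assoc]
    gcongr
    exact (DG x).le_opNorm _
  rw [← h0]
  refine tendsto_integral_of_norm_sub_le_mul_const (p := 6 / 5) (q := 6) hρG
    (β := fun n x => φ n x - u x)
    (fun n => (hφ6 n).1.sub h.memLp_six.1) h.tendsto_six (fun n => ?_)
    (h1.1.mul (aestronglyMeasurable_apply hG.1 h.memLp_six.1)) 1
    fun n => Eventually.of_forall fun x => ?_
  · exact integrable_of_abs_le_mul (p := 6 / 5) (q := 6) hρG (hφ6 n)
      (h1.1.mul (aestronglyMeasurable_apply hG.1 (hφ6 n).1)) 1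
      (Eventually.of_forall fun x => hle _ x)
  · rw [← mul_sub, ← map_sub]
    exact hle _ x

/-! ### Vanishing of the velocity -/

theorem contract_smul_vecMulVec (r : ℝ) (v : R3) (L : R3 →L[ℝ] R3) :
    contract (r • Matrix.vecMulVec v v) (jacobian L) = r * inner ℝ v (L v) := by
  have h1 : ∀ i, L v i = ∑ j, v j * jacobian L i j := by
    intro i
    conv_lhs => rw [apply_eq_sum L v]
    simp [jacobian_apply]
  simp only [contract, Matrix.smul_apply, Matrix.vecMulVec_apply, smul_eq_mul, PiLp.inner_apply,
    RCLike.inner_apply, conj_trivial, h1, Finset.mul_sum, Finset.sum_mul]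
  refine Finset.sum_congr rfl fun i _ => Finset.sum_congr rfl fun j _ => ?_
  ring

theorem aestronglyMeasurable_viscousForm (μ η : ℝ) {ν : Measure R3} {L' L : R3 → R3 →L[ℝ] R3}
    (hL' : AEStronglyMeasurable L' ν) (hL : AEStronglyMeasurable L ν) :
    AEStronglyMeasurable (fun x => viscousForm μ η (L' x) (L x)) ν :=
  aestronglyMeasurable_comp_prodMk (continuous_viscousForm μ η) hL' hL

theorem integrable_viscousForm {μ η : ℝ} (hμ : 0 ≤ μ) (hη : 0 ≤ η) {ν : Measure R3}
    {L' L : R3 → R3 →L[ℝ] R3} (hL' : MemLp L' 2 ν) (hL : MemLp L 2 ν) :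
    Integrable (fun x => viscousForm μ η (L' x) (L x)) ν := by
  have h1 : MemLp (fun x => ‖L' x‖) 2 ν := hL'.norm
  have h2 : MemLp (fun x => ‖L x‖) 2 ν := hL.norm
  have h3 := aestronglyMeasurable_viscousForm μ η hL'.1 hL.1
  refine integrable_of_abs_le_mul (p := 2) (q := 2) h1 h2 h3 (9 * (4 * μ + 3 * η))
    (Eventually.of_forall fun x => ?_)
  rw [norm_norm, norm_norm]
  exact abs_viscousForm_le hμ hη _ _

theorem tendsto_integral_viscousForm {μ η : ℝ} (hμ : 0 ≤ μ) (hη : 0 ≤ η) {ν : Measure R3}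
    {A : R3 → R3 →L[ℝ] R3} {L : ℕ → R3 → R3 →L[ℝ] R3} {L' : R3 → R3 →L[ℝ] R3}
    (hA : MemLp A 2 ν) (hL : ∀ n, MemLp (L n) 2 ν) (hL' : MemLp L' 2 ν)
    (h : Tendsto (fun n => eLpNorm (fun x => L n x - L' x) 2 ν) atTop (𝓝 0)) :
    Tendsto (fun n => ∫ x, viscousForm μ η (A x) (L n x) ∂ν) atTop
      (𝓝 (∫ x, viscousForm μ η (A x) (L' x) ∂ν)) := by
  refine tendsto_integral_of_norm_sub_le_mul_const (p := 2) (q := 2) hA.norm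
    (β := fun n x => L n x - L' x) (fun n => (hL n).1.sub hL'.1) h
    (fun n => integrable_viscousForm hμ hη hA (hL n)) (integrable_viscousForm hμ hη hA hL').1
    (9 * (4 * μ + 3 * η)) fun n => Eventually.of_forall fun x => ?_
  rw [← viscousForm_sub_right, abs_norm]
  exact abs_viscousForm_le hμ hη _ _

theorem tendsto_integral_viscousForm_self {μ η : ℝ} (hμ : 0 ≤ μ) (hη : 0 ≤ η) {ν : Measure R3}
    {L : ℕ → R3 → R3 →L[ℝ] R3} {L' : R3 → R3 →L[ℝ] R3}
    (hL : ∀ n, MemLp (L n) 2 ν) (hL' : MemLp L' 2 ν)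
    (h : Tendsto (fun n => eLpNorm (fun x => L n x - L' x) 2 ν) atTop (𝓝 0)) :
    Tendsto (fun n => ∫ x, viscousForm μ η (L n x) (L n x) ∂ν) atTop
      (𝓝 (∫ x, viscousForm μ η (L' x) (L' x) ∂ν)) := by
  have h1 := tendsto_integral_viscousForm (μ := μ) (η := η) hμ hη hL' hL hL' h
  have h2 : Tendsto (fun n => ∫ x, viscousForm μ η (L n x - L' x) (L n x) ∂ν) atTop
      (𝓝 (∫ x, (0 : ℝ) ∂ν)) := by
    refine tendsto_integral_of_norm_sub_le_mul (p := 2) (q := 2)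
      (N := eLpNorm L' 2 ν + 1) (a := fun n x => ‖L n x‖) (β := fun n x => L n x - L' x)
      (ENNReal.add_ne_top.2 ⟨hL'.2.ne, by simp⟩) (fun n => (hL n).1.norm) ?_
      (fun n => (hL n).1.sub hL'.1) h
      (fun n => integrable_viscousForm hμ hη ((hL n).sub hL') (hL n)) aestronglyMeasurable_const
      (9 * (4 * μ + 3 * η)) fun n => Eventually.of_forall fun x => ?_
    · filter_upwards [eventually_eLpNorm_le_add_one (by norm_num) (fun n => (hL n).1) hL'.1 h]
        with n hn
      rwa [eLpNorm_norm]
    · rw [sub_zero, abs_norm]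
      refine (abs_viscousForm_le hμ hη _ _).trans_eq ?_
      ring
  have h3 := h1.add h2
  rw [integral_zero, add_zero] at h3
  refine h3.congr fun n => ?_
  have h4 : Integrable (fun x => viscousForm μ η (L n x - L' x) (L n x)) ν :=
    integrable_viscousForm hμ hη ((hL n).sub hL') (hL n)
  rw [← integral_add (integrable_viscousForm hμ hη hL' (hL n)) h4]
  refine integral_congr_ae (Eventually.of_forall fun x => ?_)
  simp only [viscousForm_sub_left]
  ring

theorem tendsto_eLpNorm_two_of_tendsto_integral {α E : Type*} [MeasurableSpace α] {ν : Measure α}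
    [NormedAddCommGroup E] {f : ℕ → α → E} (hf : ∀ n, MemLp (f n) 2 ν)
    (h : Tendsto (fun n => ∫ x, ‖f n x‖ ^ 2 ∂ν) atTop (𝓝 0)) :
    Tendsto (fun n => eLpNorm (f n) 2 ν) atTop (𝓝 0) := by
  have h1 : ∀ n, eLpNorm (f n) 2 ν = ENNReal.ofReal (√(∫ x, ‖f n x‖ ^ 2 ∂ν)) := by
    intro n
    rw [(hf n).eLpNorm_eq_integral_rpow_norm (by simp) (by simp), Real.sqrt_eq_rpow]
    simp
  simp_rw [h1]
  rw [← ENNReal.ofReal_zero, ← Real.sqrt_zero]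
  exact ENNReal.tendsto_ofReal h.sqrt

/-- By Korn's and Sobolev's inequalities, a velocity without dissipation vanishes. -/
theorem IsVelocityApprox.ae_eq_zero (h : IsVelocityApprox Ω u Du φ)
    {μ η : ℝ} (hμ : 0 < μ) (hη : 0 ≤ η) (h0 : ∫ x in Ω, viscousForm μ η (Du x) (Du x) = 0) :
    ∀ᵐ x ∂(volume.restrict Ω), u x = 0 := by
  set ν := volume.restrict Ω with hν
  have hD2 : ∀ n, MemLp (fderiv ℝ (φ n)) 2 ν := fun n => (h.isTestFunction n).memLp_fderiv 2 ν
  have hlim := tendsto_integral_viscousForm_self (μ := μ) (η := η) hμ.le hη hD2 h.memLp_deriv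
    h.tendsto_deriv
  rw [h0] at hlim
  have hle : ∀ n, ∫ x, ‖fderiv ℝ (φ n) x‖ ^ 2 ∂ν
      ≤ μ⁻¹ * ∫ x, viscousForm μ η (fderiv ℝ (φ n) x) (fderiv ℝ (φ n) x) ∂ν := by
    intro n
    have hφ := h.isTestFunction n
    have h1 := mul_integral_sq_norm_fderiv_le hμ.le hη (hφ.1.of_le (WithTop.coe_le_coe.2 (le_top : (2 : ℕ∞) ≤ ⊤))) hφ.2
    have h2 : ∀ g : (R3 →L[ℝ] R3) → ℝ, g 0 = 0 →
        ∫ x, g (fderiv ℝ (φ n) x) ∂ν = ∫ x, g (fderiv ℝ (φ n) x) := fun g hg =>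
      setIntegral_eq_integral_of_forall_compl_eq_zero fun x hx => by
        rw [hφ.fderiv_eq_zero_of_notMem hx, hg]
    rw [h2 (fun L => ‖L‖ ^ 2) (by simp), h2 (fun L => viscousForm μ η L L)
      (by simp [viscousForm_self, divergence_eq_sum, jacobian_apply])]
    rwa [inv_mul_eq_div, le_div_iff₀ hμ, mul_comm]
  have hD0 : Tendsto (fun n => eLpNorm (fderiv ℝ (φ n)) 2 ν) atTop (𝓝 0) := by
    refine tendsto_eLpNorm_two_of_tendsto_integral hD2 ?_
    refine squeeze_zero (fun n => integral_nonneg fun x => sq_nonneg _) hle ?_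
    simpa using hlim.const_mul μ⁻¹
  obtain ⟨S, hS, hSob⟩ := exists_sobolev_const
  have hφ0 : Tendsto (fun n => eLpNorm (φ n) 6 ν) atTop (𝓝 0) := by
    refine tendsto_of_tendsto_of_tendsto_of_le_of_le tendsto_const_nhds ?_ (fun _ => zero_le)
      fun n => (h.isTestFunction n).eLpNorm_le
        (hSob _ ((h.isTestFunction n).1.of_le (by simp)) (h.isTestFunction n).2)
    simpa using ENNReal.Tendsto.const_mul hD0 (Or.inr hS)
  have hφm : ∀ n, AEStronglyMeasurable (φ n) ν := fun n => ((h.isTestFunction n).memLp 6 ν).1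
  have hφ0' : Tendsto (fun n => eLpNorm (φ n - fun _ => 0) 6 ν) atTop (𝓝 0) :=
    hφ0.congr fun n => by
      congr 1
      ext1 x
      simp
  exact tendstoInMeasure_ae_unique
    (tendstoInMeasure_of_tendsto_eLpNorm (by simp) hφm h.memLp_six.1 h.tendsto_six)
    (tendstoInMeasure_of_tendsto_eLpNorm (by simp) hφm aestronglyMeasurable_const hφ0')

/-- A subsequence of an approximation of the velocity converges almost everywhere. -/
theorem IsVelocityApprox.exists_subseq_ae (h : IsVelocityApprox Ω u Du φ) :
    ∃ ψ : ℕ → R3 → R3, IsVelocityApprox Ω u Du ψ ∧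
      ∀ᵐ x ∂(volume.restrict Ω), Tendsto (fun n => ψ n x) atTop (𝓝 (u x)) := by
  obtain ⟨ns, hns, hae⟩ := (tendstoInMeasure_of_tendsto_eLpNorm (by simp)
    (fun n => ((h.isTestFunction n).memLp 6 (volume.restrict Ω)).1) h.memLp_six.1
    h.tendsto_six).exists_seq_tendsto_ae
  exact ⟨fun n => φ (ns n), ⟨fun n => h.isTestFunction _, h.memLp_six, h.memLp_deriv,
    h.tendsto_deriv.comp hns.tendsto_atTop, h.tendsto_six.comp hns.tendsto_atTop⟩, hae⟩

end

theorem theorem1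
    (Ω : Set R3) (hΩ_open : IsOpen Ω) (hΩ_conn : IsConnected Ω)
    (μ η : ℝ) (hμ : 0 < μ) (hη : 0 ≤ η)
    (p : ℝ → ℝ) (hp_cont : ContinuousOn p (Ici 0)) (hp_zero : p 0 = 0)
    (hp_nonneg : ∀ s, 0 ≤ s → 0 ≤ p s)
    (hp_sqrt : ∃ C : ℝ, ∀ s, 0 ≤ s → s < 1 → p s ≤ C * √s)
    (G : R3 → ℝ) (DG : R3 → R3 →L[ℝ] ℝ)
    (hG : (∃ q : ℝ≥0∞, 6 / 5 ≤ q ∧ q < ∞ ∧ MemD0ModConst q Ω G DG) ∨ MemW1Infty Ω G DG)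
    (ρ : R3 → ℝ) (u : R3 → R3)
    (hsol : IsWeakSolution Ω μ η p DG ρ u)
    (hρ_one : MemLp ρ 1 (volume.restrict Ω)) (hρ_infty : MemLp ρ ∞ (volume.restrict Ω)) :
    ∀ᵐ x ∂(volume.restrict Ω), u x = 0 := by
  set ν := volume.restrict Ω with hν
  obtain ⟨Du, hDu, hmom⟩ := hsol.momentum_eq
  have hcont := hsol.continuity_eq
  obtain ⟨hu6, φ₀, hφ₀, hφ₀D, hφ₀6⟩ := hDu.exists_approx_six hΩ_open
  obtain ⟨φ, h, hae⟩ :=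
    (IsVelocityApprox.mk hφ₀ hu6 hDu.memLp_deriv hφ₀D hφ₀6).exists_subseq_ae
  have hD2 : ∀ n, MemLp (fderiv ℝ (φ n)) 2 ν := fun n => (h.isTestFunction n).memLp_fderiv 2 ν
  have hpot : ∃ q : ℝ≥0∞, 6 / 5 ≤ q ∧ MemLp DG q ν ∧ ∫ x in Ω, ρ x * DG x (u x) = 0 := by
    rcases hG with ⟨q, hq, -, hG⟩ | hG
    · exact ⟨q, hq, hG.memLp_deriv,
        hG.integral_potential_eq_zero hq hρ_one hρ_infty hu6 hcont⟩
    · refine ⟨∞, le_top, hG.memLp_deriv, ?_⟩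
      have hρu1 := memLp_mul_norm_of_le hρ_one hρ_infty hu6 (t := 1) le_rfl (by norm_num)
      refine integral_bounded_potential_eq_zero hΩ_open hG hρ_one.1 hu6.1
        (memLp_of_one_of_top hρ_one hρ_infty (by norm_num)) ?_
        (memLp_mul_norm_of_le hρ_one hρ_infty hu6 (by norm_num) (by norm_num))
        hDu.memLp_deriv hcont h.isTestFunction h.tendsto_deriv hae
      refine (memLp_one_iff_integrable.1 hρu1).mono (hρ_one.1.smul hu6.1)
        (Eventually.of_forall fun x => ?_)
      simp [norm_smul]
  obtain ⟨q, hq, hGq, hpot⟩ := hpot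
  have hforce := h.tendsto_force hρ_one hρ_infty hq hGq hpot
  obtain ⟨hci, hconv⟩ := h.tendsto_convective hρ_one hρ_infty hcont
  obtain ⟨hp2, hpz⟩ := h.integral_pressure_eq_zero hΩ_open hρ_one hρ_infty hsol.density_nonneg
    hcont hp_cont hp_zero hp_nonneg hp_sqrt
  have hpress := tendsto_integral_mul_divergence hp2 hD2 h.memLp_deriv h.tendsto_deriv
  rw [hpz] at hpress
  have hvisc := tendsto_integral_viscousForm (μ := μ) (η := η) hμ.le hη h.memLp_deriv hD2
    h.memLp_deriv h.tendsto_deriv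
  have hpi : ∀ n, Integrable (fun x => p (ρ x) * divergence (fderiv ℝ (φ n) x)) ν := fun n =>
    integrable_of_abs_le_mul (p := 2) (q := 2) hp2 (hD2 n)
      (hp2.1.mul (continuous_divergence.comp_aestronglyMeasurable (hD2 n).1)) 3
      (Eventually.of_forall fun x => by
        rw [abs_mul, Real.norm_eq_abs, mul_left_comm]
        gcongr
        exact abs_divergence_le _)
  have hbal : ∀ n, ∫ x, viscousForm μ η (Du x) (fderiv ℝ (φ n) x) ∂ν
      = (∫ x in Ω, ρ x * inner ℝ (u x) (fderiv ℝ (φ n) x (u x)))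
        + (∫ x in Ω, p (ρ x) * divergence (fderiv ℝ (φ n) x))
        + ∫ x in Ω, ρ x * DG x (φ n x) := by
    intro n
    have hφ := h.isTestFunction n
    have h2 := hmom (φ n) ⟨hφ.1.of_le (by simp), hφ.2, hφ.3⟩
    simp_rw [contract_smul_vecMulVec] at h2
    rw [integral_add (g := fun x => p (ρ x) * (jacobian (fderiv ℝ (φ n) x)).trace) (hci n)
      (hpi n)] at h2
    exact (sub_eq_iff_eq_add.1 h2.symm)
  refine h.ae_eq_zero hμ hη (tendsto_nhds_unique hvisc ?_)
  refine Tendsto.congr (fun n => (hbal n).symm) ?_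
  simpa using (hconv.add hpress).add hforce
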